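/- **Setting.** All spaces are complex. On $\mathbb C[x,\xi]$ ($x$ even, $\xi$ odd, $\xi^2=0$) let $\epsilon(f+\xi g)=f-\xi g$, $F'=\partial_xF$, $D=\partial_\xi+\xi\partial_x$ and $\overline D=\partial_\xi-\xi\partial_x$. Let $\mathcal K$ be the Lie superalgebra of contact vector fields, i.e. the stabilizer of $\mathbb C[x,\xi]\overline D$ in $\operatorname{Span}_{\mathbb C[x,\xi]}\{\partial_x,\partial_\xi\}$. It is the bijective image of $\mathbb C[x,\xi]$ under $\mathbb X(f+\xi g)=f\partial_x+\tfrac12f'\xi\partial_\xi+\tfrac12gD$ ($f,g\in\mathbb C[x]$), with basis $e_{n-1}=\mathbb X(x^n)$, $e_{n-1/2}=2\mathbb X(\xi x^n)$ ($n\in\mathbb N$), and $\mathfrak s=\operatorname{Span}\{e_{-1},e_{-1/2},e_0,e_{1/2},e_1\}$. For $\lambda\in\mathbb C$, $\mathbb F(\lambda)=\omega^\lambda\mathbb C[x,\xi]$ carries the action $\pi_\lambda(\mathbb X(F))(\omega^\lambda G)=\omega^\lambda(\mathbb X(F)(G)+\lambda F'G)$; the superscript $j\Pi$ means that parity is reversed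 $j$ times. For $X\in\mathcal K$ and a linear map $T:\mathbb F(\lambda)\to\mathbb F(\lambda+p)$, both homogeneous, $\sigma_{\lambda,p}(X)T=\pi_{\lambda+p}(X)\circ T-(-1)^{|X||T|}T\circ\pi_\lambda(X)$. For $k\in\tfrac12\mathbb N\cup\{\infty\}$ let $\mathbb D^k(\lambda,p)=\operatorname{Span}\{\omega^pG\overline D^j: G\in\mathbb C[x,\xi],\ j\le 2k\}$, where $\omega^pG\overline D^j$ maps $\omega^\lambda F$ to $\omega^{\lambda+p}G\overline D^j(F)$, and let $\mathbb D^{-1/2}(\lambda,p)=0$. Put $k_p=p-\tfrac12$ if $2p$ is a positive integer and $k_p=\infty$ otherwise. There is a unique $\mathfrak s$-equivalence $\mathrm{CQ}_{\lambda,p}:\bigoplus_{j=0}^{2k_p}\mathbb F(p-\tfrac j2)^{j\Pi}\to\mathbb D^{k_p}(\lambda,p)$ with $\mathrm{CQ}_{\lambda,p}(\omega^{p-j/2}G)\equiv\omega^pG\overline D^j$ modulo $\mathbb D^{(j-1)/2}(\lambda,p)$ for all $j$ and $G$. Its inverse $\mathrm{CS}_{\lambda,p}$ is the conformal symbol. Put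 $\pi(\lambda,p)(X)=\mathrm{CS}_{\lambda,p}\circ\sigma_{\lambda,p}(X)\circ\mathrm{CS}_{\lambda,p}^{-1}$ and, for $r=p-\tfrac i2$, $s=p-\tfrac j2$ with $0\le i,j\le 2k_p$, let $\pi_{rs}(\lambda,p)(X):\mathbb F(s)\to\mathbb F(r)$ be the corresponding matrix entry. For $2q\in 3+\mathbb N$ let $\overline\beta_q(\lambda):\mathcal K\to\operatorname{Hom}(\mathbb F(\lambda),\mathbb F(\lambda+q))$ be the linear map that vanishes on $\mathfrak s$ and satisfies, for $n\in\tfrac12\mathbb N$ with $n\ge\tfrac32$, $$\overline\beta_q(\lambda)(e_n)=\frac{2^{-2\{n-1/2\}}}{\lfloor n-3/2\rfloor!}\,(-1)^{(2n-1)2q}\,\sigma_{\lambda,q}(e_{1/2})^{2n-3}\bigl(4\omega^q\overline D^{2q-3}\bigr),$$ and let $\beta_q(\lambda)(X)=\epsilon^{2q}\circ\overline\beta_q(\lambda)(X)$, where $\epsilon$ acts on $\mathbb F(\lambda+q)$. **Theorem.** Let $\lambda,p\in\mathbb C$, let $r,s\in\{p-\tfrac j2:0\le j\le 2k_p\}$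 with $r-s\ge\tfrac32$, and let $m\in\{0,1\}$ with $m\equiv 2(p-s)$ mod $2$. Then there is a unique scalar $b^m_{rs}=b^m_{rs}(\lambda,p)$ such that $\pi_{rs}(\lambda,p)=b^m_{rs}\,\beta_{r-s}(s)$. For fixed $m$ and $r-s$, $b^m_{rs}$ is polynomial in $(\lambda,p)$ and rational in $s$: it is $N(\lambda,p,s)/d(s)$ with polynomials $N$ and $d$ that depend only on $m$ and $r-s$, and $d(s)\neq0$ for all such $s$. It is given by $b^m_{rs}=P^m_{rs}/B_{rs}$, where $$B_{rs}=2^{1+2\{r-s\}}(2s)(2s+1)\cdots(2s-2+\lfloor r-s\rfloor)\neq0,\qquad P^m_{rs}=\sum_{n=0}^{2(r-s-1)}\tilde s_{r-s,n}(r)\,G^{2(p-s),m}_{r-s,n},$$ no $p_n$ with $n\le 2(r-s)$ has a pole at $r$, and, with the falling factorial $\left[{z\atop n}\right]=z(z-1)\cdots(z-n+1)$, the ingredients are $$p_n(t)=\frac1{\lfloor n/2\rfloor!}\prod_{a=1}^{\lfloor(n+1)/2\rfloor}\frac1{a-2t},\qquad C_{\mu n}=2^{-2\{n/2\}(-1)^{2\mu}}\left[{\lfloor\mu+1\rfloor\atop\lfloor(n+1)/2\rfloor-2\{\mu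 n\}}\right],$$ $$\tilde s_{\mu,n}=C_{\mu n}p_n\ (0\le n\le2\mu-3),\qquad \tilde s_{\mu,2\mu-2}(t)=C_{\mu,2\mu-2}p_{2\mu-2}(t)+C_{\mu,2\mu-1}p_{2\mu-1}(t)+(t-\mu)C_{\mu,2\mu}p_{2\mu}(t),$$ $$G^{z,m}_{\mu,n}=E^{z-2\mu+n,\,m-2\mu+n}_n\,F^{z,m}_{\mu-n/2}\quad\text{(second superscripts modulo 2, taken in $\{0,1\}$)},$$ $$E^{z,m}_n=\left[{(z-m)/2\atop\lfloor n/2\rfloor+2(1-m)\{n/2\}}\right]\left[{(z+m)/2-1+2\lambda\atop\lfloor n/2\rfloor+2m\{n/2\}}\right],$$ and, for $n\in\mathbb N$, $$F^{z,m}_n=-(-1)^n\left[{(z-m)/2\atop n}\right]\Bigl(\frac z2-\frac n{2^m}+(n+1)\lambda\Bigr),\qquad F^{z,m}_{n+1/2}=(-1)^n\left[{(z-m)/2\atop n}\right]\Bigl(\frac{z-m}2-n+2m(n+1)\lambda\Bigr).$$ With $c=\lambda+\tfrac p2-\tfrac14$, one has for $r-s=\tfrac32,2,\tfrac52$ $$b^0_{s+3/2,s}=-c\binom{p-s}2\frac1{s+1/2},\qquad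 b^1_{s+3/2,s}=\Bigl(p-s-\tfrac12\Bigr)\frac{4ps+2p+1-16c^2}{16(s+1/2)},$$ $$b^0_{s+2,s}=\binom{p-s}2\frac{(2s+3)(4p+2s+1)-48c^2}{32s(s+3/2)},\qquad b^1_{s+2,s}=\binom{p-s-1/2}2\frac{s(2p+s+1)-12c^2}{8s(s+3/2)},$$ $$b^0_{s+5/2,s}=-\binom{p-s}3\binom{s+2}3^{-1}\frac{4(s+1)p+3-48c^2}{64},$$ $$b^1_{s+5/2,s}=-c\binom{p-s-1/2}2\binom{s+2}3^{-1}\frac{4(s+1)p-s^2-2s+2-12c^2}{24}.$$ -/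

import Mathlib

noncomputable section

namespace SuperLine

/-! ## Super linear algebra

A superspace is a complex vector space `V` together with its parity involution `ε`
(`+1` on the even part and `-1` on the odd part). -/

section Super

variable {V W : Type*} [AddCommGroup V] [Module ℂ V] [AddCommGroup W] [Module ℂ W]

/-- The even part of an endomorphism. -/
def evenPart (ε A : Module.End ℂ V) : Module.End ℂ V := (1 / 2 : ℂ) • (A + ε * A * ε)

/-- The odd part of an endomorphism. -/
def oddPart (ε A : Module.End ℂ V) : Module.End ℂ V := (1 / 2 : ℂ) • (A - ε * A * ε)

/-- If an element `X` of a Lie superalgebra acts on `V` by `A` and on `W` by `B`, this is its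
action on `Hom(V,W)`: for homogeneous `X` it is `T ↦ B ∘ T - ε^{|X|}(T) ∘ A`, where
`ε(T) = ε_W ∘ T ∘ ε_V`, and it is extended linearly to all `X`.  (The parity of `A` is the parity
of `X`, since representations are even.)  For `V = W` and `A = B` it is the superbracket
`T ↦ [A, T]`. -/
def homAction (εV A : Module.End ℂ V) (εW B : Module.End ℂ W) :
    (V →ₗ[ℂ] W) →ₗ[ℂ] (V →ₗ[ℂ] W) where
  toFun T := B ∘ₗ T - T ∘ₗ evenPart εV A - (εW ∘ₗ T ∘ₗ εV) ∘ₗ oddPart εV A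
  map_add' S T := by
    simp only [LinearMap.comp_add, LinearMap.add_comp]; abel
  map_smul' c T := by
    simp only [LinearMap.comp_smul, LinearMap.smul_comp, RingHom.id_apply, smul_sub]

end Super

/-! ## The superline -/

/-- `ℂ[x, ξ]` with `x` even, `ξ` odd and `ξ² = 0`: the dual numbers over `ℂ[x]`.
The element `f + ξ g` has `fst = f` and `snd = g`. -/
abbrev SPoly : Type := DualNumber (Polynomial ℂ)

/-- Linear endomorphisms of `ℂ[x, ξ]`. -/
abbrev Op : Type := Module.End ℂ SPoly

/-- The element `f + ξ g` of `ℂ[x, ξ]`. -/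
def mk (f g : Polynomial ℂ) : SPoly := (TrivSqZeroExt.inl f : SPoly) + TrivSqZeroExt.inr g

@[simp] theorem fst_mk (f g : Polynomial ℂ) : (mk f g).fst = f := by simp [mk]

@[simp] theorem snd_mk (f g : Polynomial ℂ) : (mk f g).snd = g := by simp [mk]

/-- A linear endomorphism of `ℂ[x, ξ]` from its two components. -/
def mkOp (a b : SPoly → Polynomial ℂ)
    (ha : ∀ F G, a (F + G) = a F + a G) (hb : ∀ F G, b (F + G) = b F + b G)
    (ha' : ∀ (c : ℂ) F, a (c • F) = c • a F) (hb' : ∀ (c : ℂ) F, b (c • F) = c • b F) : Op where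
  toFun F := mk (a F) (b F)
  map_add' F G := by ext1 <;> simp [ha, hb]
  map_smul' c F := by ext1 <;> simp [ha', hb']

/-- The parity endomorphism `f + ξ g ↦ f - ξ g`. -/
def eps : Op := mkOp (fun F => F.fst) (fun F => -F.snd)
  (by simp) (by intros; simp; ring) (by simp) (by simp)

/-- `∂_x`. -/
def dx : Op := mkOp (fun F => Polynomial.derivative F.fst) (fun F => Polynomial.derivative F.snd)
  (by simp) (by simp) (by simp) (by simp)

/-- `∂_ξ`. -/
def dxi : Op := mkOp (fun F => F.snd) (fun _ => 0) (by simp) (by simp) (by simp) (by simp)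

/-- The operator of multiplication by `G`. -/
def mulOp (G : SPoly) : Op := LinearMap.mulLeft ℂ G

/-- The odd coordinate `ξ`. -/
def xi : SPoly := mk 0 1

/-- `D = ∂_ξ + ξ ∂_x`. -/
def D : Op := dxi + mulOp xi * dx

/-- `D̄ = ∂_ξ - ξ ∂_x`. -/
def Dbar : Op := dxi - mulOp xi * dx

/-! ## The contact superalgebra -/

/-- The polynomial vector fields: the `ℂ[x, ξ]`-span of `∂_x` and `∂_ξ`. -/
def vectorFields : Submodule ℂ Op where
  carrier := {X | ∃ a b : SPoly, X = mulOp a * dx + mulOp b * dxi}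
  add_mem' := by
    rintro _ _ ⟨a, b, rfl⟩ ⟨a', b', rfl⟩
    refine ⟨a + a', b + b', ?_⟩
    ext1 F
    simp [mulOp, add_mul]
    abel
  zero_mem' := ⟨0, 0, by ext1 F; simp [mulOp]⟩
  smul_mem' := by
    rintro c _ ⟨a, b, rfl⟩
    refine ⟨c • a, c • b, ?_⟩
    ext1 F
    simp [mulOp]

/-- `ℂ[x, ξ] D̄`, the vector fields tangent to the contact distribution. -/
def tangentFields : Submodule ℂ Op where
  carrier := {X | ∃ G : SPoly, X = mulOp G * Dbar}
  add_mem' := by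
    rintro _ _ ⟨a, rfl⟩ ⟨a', rfl⟩
    refine ⟨a + a', ?_⟩
    ext1 F
    simp [mulOp, add_mul]
  zero_mem' := ⟨0, by ext1 F; simp [mulOp]⟩
  smul_mem' := by
    rintro c _ ⟨a, rfl⟩
    refine ⟨c • a, ?_⟩
    ext1 F
    simp [mulOp]

@[simp] theorem fst_eps (F : SPoly) : (eps F).fst = F.fst := fst_mk _ _
@[simp] theorem snd_eps (F : SPoly) : (eps F).snd = -F.snd := snd_mk _ _
@[simp] theorem fst_dx (F : SPoly) : (dx F).fst = Polynomial.derivative F.fst := fst_mk _ _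
@[simp] theorem snd_dx (F : SPoly) : (dx F).snd = Polynomial.derivative F.snd := snd_mk _ _
@[simp] theorem fst_dxi (F : SPoly) : (dxi F).fst = F.snd := fst_mk _ _
@[simp] theorem snd_dxi (F : SPoly) : (dxi F).snd = 0 := snd_mk _ _
@[simp] theorem mulOp_apply (G F : SPoly) : mulOp G F = G * F := rfl
@[simp] theorem fst_xi : xi.fst = 0 := fst_mk _ _
@[simp] theorem snd_xi : xi.snd = 1 := snd_mk _ _
@[simp] theorem fst_D (F : SPoly) : (D F).fst = F.snd := by simp [D]
@[simp] theorem snd_D (F : SPoly) : (D F).snd = Polynomial.derivative F.fst := by simp [D]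
@[simp] theorem fst_Dbar (F : SPoly) : (Dbar F).fst = F.snd := by simp [Dbar]
@[simp] theorem snd_Dbar (F : SPoly) : (Dbar F).snd = -Polynomial.derivative F.fst := by
  simp [Dbar]

section Super

variable {V W : Type*} [AddCommGroup V] [Module ℂ V] [AddCommGroup W] [Module ℂ W]

theorem evenPart_add (ε A B : Module.End ℂ V) :
    evenPart ε (A + B) = evenPart ε A + evenPart ε B := by
  simp only [evenPart, mul_add, add_mul, ← smul_add]; congr 1; abel

theorem oddPart_add (ε A B : Module.End ℂ V) :
    oddPart ε (A + B) = oddPart ε A + oddPart ε B := by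
  simp only [oddPart, mul_add, add_mul, ← smul_add]; congr 1; abel

theorem evenPart_smul (c : ℂ) (ε A : Module.End ℂ V) :
    evenPart ε (c • A) = c • evenPart ε A := by
  simp only [evenPart, mul_smul_comm, smul_mul_assoc, ← smul_add, smul_comm c]

theorem oddPart_smul (c : ℂ) (ε A : Module.End ℂ V) :
    oddPart ε (c • A) = c • oddPart ε A := by
  simp only [oddPart, mul_smul_comm, smul_mul_assoc, ← smul_sub, smul_comm c]

theorem homAction_add (εV A A' : Module.End ℂ V) (εW B B' : Module.End ℂ W) :
    homAction εV (A + A') εW (B + B') = homAction εV A εW B + homAction εV A' εW B' := by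
  ext1 T
  simp only [homAction, evenPart_add, oddPart_add, LinearMap.coe_mk, AddHom.coe_mk,
    LinearMap.add_apply, LinearMap.comp_add, LinearMap.add_comp]
  abel

theorem homAction_smul (c : ℂ) (εV A : Module.End ℂ V) (εW B : Module.End ℂ W) :
    homAction εV (c • A) εW (c • B) = c • homAction εV A εW B := by
  ext1 T
  simp only [homAction, evenPart_smul, oddPart_smul, LinearMap.coe_mk, AddHom.coe_mk,
    LinearMap.smul_apply, LinearMap.comp_smul, LinearMap.smul_comp, smul_sub]

end Super

/-- The Lie superalgebra `𝒦` of contact vector fields: the stabilizer of `ℂ[x, ξ] D̄` in the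
polynomial vector fields under the superbracket. -/
def contactAlgebra : Submodule ℂ Op where
  carrier := {X | X ∈ vectorFields ∧ ∀ T ∈ tangentFields, homAction eps X eps X T ∈ tangentFields}
  add_mem' := by
    rintro X Y ⟨hX, hX'⟩ ⟨hY, hY'⟩
    refine ⟨add_mem hX hY, fun T hT => ?_⟩
    rw [homAction_add]
    exact add_mem (hX' T hT) (hY' T hT)
  zero_mem' := by
    refine ⟨zero_mem _, fun T _ => ?_⟩
    have h := homAction_smul (0 : ℂ) eps (0 : Op) eps (0 : Op)
    simp only [zero_smul] at h
    rw [h]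
    exact zero_mem _
  smul_mem' := by
    rintro c X ⟨hX, hX'⟩
    refine ⟨Submodule.smul_mem _ c hX, fun T hT => ?_⟩
    rw [homAction_smul]
    exact Submodule.smul_mem _ c (hX' T hT)

/-- `𝕏(f + ξ g) = f ∂_x + ½ f' ξ ∂_ξ + ½ g D`. -/
def contactField : SPoly →ₗ[ℂ] Op where
  toFun F := mulOp (mk F.fst 0) * dx
    + (1 / 2 : ℂ) • (mulOp (mk 0 (Polynomial.derivative F.fst)) * dxi)
    + (1 / 2 : ℂ) • (mulOp (mk F.snd 0) * D)
  map_add' F G := by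
    ext1 u
    ext1 <;> simp [add_mul, smul_add] <;> abel
  map_smul' c F := by
    ext1 u
    ext1 <;> simp [smul_comm c]

theorem fst_contactField (F u : SPoly) : (contactField F u).fst
    = F.fst * Polynomial.derivative u.fst + (1 / 2 : ℂ) • (F.snd * u.snd) := by
  simp [contactField]

theorem snd_contactField (F u : SPoly) : (contactField F u).snd
    = F.fst * Polynomial.derivative u.snd
      + (1 / 2 : ℂ) • (Polynomial.derivative F.fst * u.snd)
      + (1 / 2 : ℂ) • (F.snd * Polynomial.derivative u.fst) := by
  simp [contactField]


theorem contactField_mem (F : SPoly) : contactField F ∈ contactAlgebra := by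
  constructor
  · refine ⟨mk F.fst ((1 / 2 : ℂ) • F.snd), mk ((1 / 2 : ℂ) • F.snd)
      ((1 / 2 : ℂ) • Polynomial.derivative F.fst), ?_⟩
    ext1 u
    ext1
    · simp [fst_contactField]
    · simp [snd_contactField, mul_comm]
      abel
  · rintro _ ⟨G, rfl⟩
    refine ⟨contactField F G - (1 / 2 : ℂ) • (dx F * G), ?_⟩
    ext1 u
    ext1
    · simp [homAction, evenPart, oddPart, fst_contactField, snd_contactField,
        Polynomial.smul_eq_C_mul]
      have h : (Polynomial.C (2⁻¹ : ℂ)) * 2 = 1 := by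
        rw [show (2 : Polynomial ℂ) = Polynomial.C 2 from rfl, ← Polynomial.C_mul]; simp
      generalize Polynomial.C (2⁻¹ : ℂ) = c at h
      grind
    · simp [homAction, evenPart, oddPart, fst_contactField, snd_contactField,
        Polynomial.smul_eq_C_mul]
      have h : (Polynomial.C (2⁻¹ : ℂ)) * 2 = 1 := by
        rw [show (2 : Polynomial ℂ) = Polynomial.C 2 from rfl, ← Polynomial.C_mul]; simp
      generalize Polynomial.C (2⁻¹ : ℂ) = c at h
      grind

theorem contactField_of_mem (Z : Op) (hZ : Z ∈ contactAlgebra) :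
    contactField (mk (Z (mk Polynomial.X 0)).fst ((2 : ℂ) • (Z xi).fst)) = Z := by
  obtain ⟨⟨a, b, rfl⟩, h⟩ := hZ
  obtain ⟨H, hH⟩ := h Dbar ⟨1, by ext1 u; simp⟩
  have h1 := congrArg (fun T : Op => (T (mk Polynomial.X 0)).fst) hH
  have h2 := congrArg (fun T : Op => (T (mk Polynomial.X 0)).snd) hH
  have h3 := congrArg (fun T : Op => (T xi).fst) hH
  have h4 := congrArg (fun T : Op => (T xi).snd) hH
  simp [homAction, evenPart, oddPart, Polynomial.smul_eq_C_mul] at h1 h2 h3 h4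
  have h : (Polynomial.C (2⁻¹ : ℂ)) * 2 = 1 := by
    rw [show (2 : Polynomial ℂ) = Polynomial.C 2 from rfl, ← Polynomial.C_mul]; simp
  have e1 : a.snd = b.fst := by
    linear_combination h1 - a.snd * h
  have e2 : b.snd = Polynomial.C (2⁻¹ : ℂ) * Polynomial.derivative a.fst := by
    generalize Polynomial.C (2⁻¹ : ℂ) = c at *
    grind
  ext1 u
  ext1
  · simp [fst_contactField, smul_smul]
  · have h' : (Polynomial.C (1 / 2 : ℂ)) * Polynomial.C 2 = 1 := by
      rw [← Polynomial.C_mul]; simp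
    simp [snd_contactField, e1, e2, Polynomial.smul_eq_C_mul]
    ring_nf
    rw [h', one_mul]

theorem contactField_fst (F : SPoly) : (contactField F (mk Polynomial.X 0)).fst = F.fst := by
  simp [fst_contactField]

theorem contactField_snd (F : SPoly) : (2 : ℂ) • (contactField F xi).fst = F.snd := by
  simp [fst_contactField, smul_smul]

/-- The even linear bijection `𝕏` from `ℂ[x, ξ]` to `𝒦`. -/
def contactEquiv : SPoly ≃ₗ[ℂ] contactAlgebra where
  toFun F := ⟨contactField F, contactField_mem F⟩
  map_add' F G := by ext1; simp
  map_smul' c F := by ext1; simp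
  invFun Z := mk (Z.1 (mk Polynomial.X 0)).fst ((2 : ℂ) • (Z.1 xi).fst)
  left_inv F := by
    ext1
    · simp [contactField_fst]
    · simp [contactField_snd]
  right_inv Z := Subtype.ext (contactField_of_mem Z.1 Z.2)


/-- The contact Hamiltonian of a contact vector field, `𝕏⁻¹`. -/
def hamiltonian : contactAlgebra ≃ₗ[ℂ] SPoly := contactEquiv.symm

/-- The Virasoro-like basis of `𝒦`: `virasoro a` is `e_{a/2 - 1}`, where
`e_{n-1} = 𝕏(x^n)` and `e_{n-1/2} = 2 𝕏(ξ x^n)`. -/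
def virasoro (a : ℕ) : contactAlgebra :=
  if a % 2 = 0 then contactEquiv (mk (Polynomial.X ^ (a / 2)) 0)
  else (2 : ℂ) • contactEquiv (mk 0 (Polynomial.X ^ (a / 2)))

/-- The conformal subalgebra `𝔰`, spanned by `e_{-1}, e_{-1/2}, e_0, e_{1/2}, e_1`. -/
def conformalAlgebra : Submodule ℂ contactAlgebra :=
  Submodule.span ℂ {Z | ∃ a ≤ 4, Z = virasoro a}

/-! ## Tensor densities and differential operators

The underlying space of every tensor density module `𝔽(λ)` is `ℂ[x, ξ]`, with `ω^λ G` written `G`;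
so a linear map `𝔽(λ) → 𝔽(λ + p)` is an endomorphism of `ℂ[x, ξ]`. -/

/-- The action `π_λ(𝕏(F))(ω^λ G) = ω^λ (𝕏(F)(G) + λ F' G)` of `𝒦` on `𝔽(λ)`. -/
def density (lam : ℂ) : contactAlgebra →ₗ[ℂ] Op where
  toFun Z := (Z : Op) + lam • mulOp (dx (hamiltonian Z))
  map_add' Y Z := by
    ext1 u
    simp [add_mul]
    abel
  map_smul' c Z := by
    ext1 u
    simp [smul_comm c]

/-- The action `σ_{λ,p}` of `𝒦` on all linear maps from `𝔽(λ)` to `𝔽(λ + p)`. -/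
def sigma (lam p : ℂ) (Z : contactAlgebra) : Module.End ℂ Op :=
  homAction eps (density lam Z) eps (density (lam + p) Z)

/-- The span of the operators `G D̄^j` with `G ∈ ℂ[x, ξ]` and `j ∈ I`.  For `I = {j | j ≤ 2k}` it is
the step `𝔻^k` of the fine filtration. -/
def fineOps (I : Set ℕ) : Submodule ℂ Op :=
  Submodule.span ℂ {T | ∃ j ∈ I, ∃ G : SPoly, T = mulOp G * Dbar ^ j}

/-- The set `{j ∈ ℕ | j ≤ 2 k_p}`, where `k_p = p - 1/2` if `2p` is a positive integer (then
`2 k_p = n` for `2p = n + 1`) and `k_p = ∞` otherwise. -/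
def nonResonantIdx (p : ℂ) : Set ℕ := {j | ∀ n : ℕ, 2 * p = n + 1 → j ≤ n}

theorem mulOp_mul_mem {I : Set ℕ} {T : Op} (G : SPoly) (hT : T ∈ fineOps I) :
    mulOp G * T ∈ fineOps I := by
  induction hT using Submodule.span_induction with
  | mem T hT =>
    obtain ⟨j, hj, H, rfl⟩ := hT
    refine Submodule.subset_span ⟨j, hj, G * H, ?_⟩
    ext1 u
    simp [mul_assoc]
  | zero => simp
  | add S T _ _ hS hT => rw [mul_add]; exact add_mem hS hT
  | smul c T _ hT => rw [mul_smul_comm]; exact Submodule.smul_mem _ _ hT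

theorem fineOps_mono {I J : Set ℕ} (h : I ⊆ J) : fineOps I ≤ fineOps J :=
  Submodule.span_mono fun _ ⟨j, hj, G, hG⟩ => ⟨j, h hj, G, hG⟩

theorem Dbar_mulOp (G : SPoly) : Dbar * mulOp G = mulOp (Dbar G) + mulOp (eps G) * Dbar := by
  ext1 u
  ext1 <;> simp <;> ring

theorem Dbar_mul_mem {n : ℕ} {T : Op} (hT : T ∈ fineOps (Set.Iic n)) :
    Dbar * T ∈ fineOps (Set.Iic (n + 1)) := by
  induction hT using Submodule.span_induction with
  | mem T hT =>
    obtain ⟨j, hj, H, rfl⟩ := hT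
    rw [← mul_assoc, Dbar_mulOp, add_mul, mul_assoc _ Dbar, ← pow_succ']
    simp only [Set.mem_Iic] at hj
    refine add_mem (Submodule.subset_span ⟨j, ?_, _, rfl⟩) (Submodule.subset_span ⟨j + 1, ?_, _, rfl⟩)
    · simp only [Set.mem_Iic]; omega
    · simp only [Set.mem_Iic]; omega
  | zero => simp
  | add S T _ _ hS hT => rw [mul_add]; exact add_mem hS hT
  | smul c T _ hT => rw [mul_smul_comm]; exact Submodule.smul_mem _ _ hT

theorem Dbar_pow_mulOp_mem (j : ℕ) (G : SPoly) : Dbar ^ j * mulOp G ∈ fineOps (Set.Iic j) := by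
  induction j with
  | zero => exact Submodule.subset_span ⟨0, by simp, G, by simp⟩
  | succ j ih => rw [pow_succ', mul_assoc]; exact Dbar_mul_mem ih

theorem mul_Dbar_mem {n : ℕ} {T : Op} (hT : T ∈ fineOps (Set.Iic n)) :
    T * Dbar ∈ fineOps (Set.Iic (n + 1)) := by
  induction hT using Submodule.span_induction with
  | mem T hT =>
    obtain ⟨j, hj, H, rfl⟩ := hT
    rw [mul_assoc, ← pow_succ]
    simp only [Set.mem_Iic] at hj
    exact Submodule.subset_span ⟨j + 1, by simp only [Set.mem_Iic]; omega, _, rfl⟩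
  | zero => simp
  | add S T _ _ hS hT => rw [add_mul]; exact add_mem hS hT
  | smul c T _ hT => rw [smul_mul_assoc]; exact Submodule.smul_mem _ _ hT

theorem eps_mul_eps : eps * eps = 1 := by
  ext1 u
  ext1 <;> simp

theorem eps_mul_mulOp (G : SPoly) : eps * mulOp G = mulOp (eps G) * eps := by
  ext1 u
  ext1
  · simp
  · simp [add_comm]

theorem eps_mul_Dbar : eps * Dbar = (-1 : ℂ) • (Dbar * eps) := by
  ext1 u
  ext1 <;> simp

theorem eps_mul_Dbar_pow (j : ℕ) : eps * Dbar ^ j = (-1 : ℂ) ^ j • (Dbar ^ j * eps) := by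
  induction j with
  | zero => simp
  | succ j ih =>
    rw [pow_succ, ← mul_assoc, ih, smul_mul_assoc, mul_assoc, eps_mul_Dbar, mul_smul_comm,
      smul_smul, ← pow_succ, ← mul_assoc, ← pow_succ]

theorem eps_conj (G : SPoly) (j : ℕ) :
    eps * (mulOp G * Dbar ^ j) * eps = (-1 : ℂ) ^ j • (mulOp (eps G) * Dbar ^ j) := by
  rw [← mul_assoc, eps_mul_mulOp, mul_assoc (mulOp _), eps_mul_Dbar_pow, mul_smul_comm,
    smul_mul_assoc, mul_assoc, mul_assoc, eps_mul_eps, mul_one]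

/-- The parity involution of `Hom(𝔽(λ), 𝔽(λ + p))`. -/
def epsHom : Module.End ℂ Op where
  toFun T := eps * T * eps
  map_add' S T := by rw [mul_add, add_mul]
  map_smul' c T := by rw [mul_smul_comm, smul_mul_assoc]; rfl

theorem epsHom_mem {I : Set ℕ} {T : Op} (hT : T ∈ fineOps I) : epsHom T ∈ fineOps I := by
  induction hT using Submodule.span_induction with
  | mem T hT =>
    obtain ⟨j, hj, H, rfl⟩ := hT
    change eps * _ * eps ∈ _
    rw [eps_conj]
    exact Submodule.smul_mem _ _ (Submodule.subset_span ⟨j, hj, _, rfl⟩)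
  | zero => simp
  | add S T _ _ hS hT => rw [map_add]; exact add_mem hS hT
  | smul c T _ hT => rw [map_smul]; exact Submodule.smul_mem _ _ hT

theorem density_contactEquiv (lam : ℂ) (F : SPoly) :
    density lam (contactEquiv F) = contactField F + lam • mulOp (dx F) := by
  simp only [density, hamiltonian, LinearMap.coe_mk, AddHom.coe_mk, LinearEquiv.symm_apply_apply]
  rfl

theorem sigma_apply (lam p : ℂ) (Z : contactAlgebra) (T : Op) :
    sigma lam p Z T = density (lam + p) Z * T - T * evenPart eps (density lam Z)
      - eps * T * eps * oddPart eps (density lam Z) := rfl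

theorem C_half : (Polynomial.C (2⁻¹ : ℂ)) * 2 = 1 := by
  rw [show (2 : Polynomial ℂ) = Polynomial.C 2 from rfl, ← Polynomial.C_mul]; simp

theorem evenPart_density (lam : ℂ) (F : SPoly) :
    evenPart eps (density lam (contactEquiv F)) = density lam (contactEquiv (mk F.fst 0)) := by
  rw [density_contactEquiv, density_contactEquiv]
  have h := C_half
  ext1 u
  ext1 <;>
  · simp [evenPart, fst_contactField, snd_contactField, Polynomial.smul_eq_C_mul]
    generalize Polynomial.C (2⁻¹ : ℂ) = c at *
    grind

theorem oddPart_density (lam : ℂ) (F : SPoly) :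
    oddPart eps (density lam (contactEquiv F)) = density lam (contactEquiv (mk 0 F.snd)) := by
  rw [density_contactEquiv, density_contactEquiv]
  have h := C_half
  ext1 u
  ext1 <;>
  · simp [oddPart, fst_contactField, snd_contactField, Polynomial.smul_eq_C_mul]
    generalize Polynomial.C (2⁻¹ : ℂ) = c at *
    grind

theorem sigma_mulOp_mem (lam p : ℂ) (F G : SPoly) :
    sigma lam p (contactEquiv F) (mulOp G) ∈ fineOps (Set.Iic 0) := by
  refine Submodule.subset_span ⟨0, by simp, contactField F G + p • (dx F * G), ?_⟩
  rw [sigma_apply, evenPart_density, oddPart_density]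
  simp only [density_contactEquiv]
  ext1 u
  ext1 <;>
  · simp [fst_contactField, snd_contactField, Polynomial.smul_eq_C_mul]
    ring

theorem even_comm_Dbar (lam : ℂ) (F : SPoly) : ∃ a b : SPoly,
    evenPart eps (density lam (contactEquiv F)) * Dbar
      - Dbar * evenPart eps (density lam (contactEquiv F)) = mulOp a * Dbar + mulOp b := by
  refine ⟨mk (-(1 / 2 : ℂ) • Polynomial.derivative F.fst) 0,
    mk 0 (lam • Polynomial.derivative (Polynomial.derivative F.fst)), ?_⟩
  rw [evenPart_density, density_contactEquiv]
  have h := C_half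
  ext1 u
  ext1 <;>
  · simp [fst_contactField, snd_contactField, Polynomial.smul_eq_C_mul]
    generalize Polynomial.C (2⁻¹ : ℂ) = c at *
    grind

theorem odd_comm_Dbar (lam : ℂ) (F : SPoly) : ∃ a b : SPoly,
    oddPart eps (density lam (contactEquiv F)) * Dbar
      + Dbar * oddPart eps (density lam (contactEquiv F)) = mulOp a * Dbar + mulOp b := by
  refine ⟨mk 0 (-(1 / 2 : ℂ) • Polynomial.derivative F.snd),
    mk (lam • Polynomial.derivative F.snd) 0, ?_⟩
  rw [oddPart_density, density_contactEquiv]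
  have h := C_half
  ext1 u
  ext1 <;>
  · simp [fst_contactField, snd_contactField, Polynomial.smul_eq_C_mul]
    generalize Polynomial.C (2⁻¹ : ℂ) = c at *
    grind

theorem mul_first_order_mem (n : ℕ) (c : ℂ) (H a b : SPoly) :
    (c • (mulOp H * Dbar ^ n)) * (mulOp a * Dbar + mulOp b) ∈ fineOps (Set.Iic (n + 1)) := by
  rw [smul_mul_assoc]
  refine Submodule.smul_mem _ _ ?_
  rw [mul_assoc, mul_add, ← mul_assoc (Dbar ^ n)]
  refine mulOp_mul_mem _ (add_mem (mul_Dbar_mem (Dbar_pow_mulOp_mem _ _)) ?_)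
  exact fineOps_mono (Set.Iic_subset_Iic.2 (Nat.le_succ n)) (Dbar_pow_mulOp_mem _ _)

theorem sigma_gen_mem (lam p : ℂ) (F G : SPoly) (j : ℕ) :
    sigma lam p (contactEquiv F) (mulOp G * Dbar ^ j) ∈ fineOps (Set.Iic j) := by
  induction j with
  | zero => simpa using sigma_mulOp_mem lam p F G
  | succ j ih =>
    obtain ⟨a, b, h0⟩ := even_comm_Dbar lam F
    obtain ⟨a', b', h1⟩ := odd_comm_Dbar lam F
    have key : sigma lam p (contactEquiv F) (mulOp G * Dbar ^ (j + 1))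
        = sigma lam p (contactEquiv F) (mulOp G * Dbar ^ j) * Dbar
          + ((1 : ℂ) • (mulOp G * Dbar ^ j)) * (mulOp a * Dbar + mulOp b)
          + ((-1 : ℂ) ^ j • (mulOp (eps G) * Dbar ^ j)) * (mulOp a' * Dbar + mulOp b') := by
      rw [sigma_apply, sigma_apply, eps_conj, eps_conj, ← h0, ← h1, pow_succ, pow_succ (-1 : ℂ),
        mul_neg_one]
      generalize (-1 : ℂ) ^ j = e
      simp only [smul_mul_assoc, sub_mul, mul_sub, mul_add, mul_assoc, one_smul]
      module
    rw [key]
    exact add_mem (add_mem (mul_Dbar_mem ih) (mul_first_order_mem _ _ _ _ _))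
      (mul_first_order_mem _ _ _ _ _)

theorem sigma_mem (lam p q : ℂ) (Z : contactAlgebra) {T : Op}
    (hT : T ∈ fineOps (nonResonantIdx q)) : sigma lam p Z T ∈ fineOps (nonResonantIdx q) := by
  obtain ⟨F, rfl⟩ := contactEquiv.surjective Z
  induction hT using Submodule.span_induction with
  | mem T hT =>
    obtain ⟨j, hj, H, rfl⟩ := hT
    exact fineOps_mono (fun i hi n hn => le_trans hi (hj n hn)) (sigma_gen_mem lam p F H j)
  | zero => simp
  | add S T _ _ hS hT => rw [map_add]; exact add_mem hS hT
  | smul c T _ hT => rw [map_smul]; exact Submodule.smul_mem _ _ hT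


/-- The index type `{0, 1, …, 2 k_p}` of the summands `𝔽(p - j/2)^{jΠ}`. -/
abbrev SymIdx (p : ℂ) : Type := nonResonantIdx p

/-- `⨁_{j = 0}^{2 k_p} 𝔽(p - j/2)^{jΠ}` (underlying vector space). -/
abbrev SymbolSpace (p : ℂ) : Type := SymIdx p →₀ SPoly

/-- The block diagonal endomorphism with blocks `f j`. -/
def diagonal {p : ℂ} (f : SymIdx p → Op) : Module.End ℂ (SymbolSpace p) :=
  Finsupp.lsum ℂ fun j => Finsupp.lsingle j ∘ₗ f j

/-- The parity involution of `⨁_j 𝔽(p - j/2)^{jΠ}`. -/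
def symbolEps (p : ℂ) : Module.End ℂ (SymbolSpace p) :=
  diagonal fun j : SymIdx p => (-1 : ℂ) ^ (j : ℕ) • eps

/-- The diagonal action of `𝒦` on `⨁_j 𝔽(p - j/2)^{jΠ}`. -/
def symbolAction (p : ℂ) (Z : contactAlgebra) : Module.End ℂ (SymbolSpace p) :=
  diagonal fun j : SymIdx p => density (p - (j : ℕ) / 2) Z

/-- The maximal non-resonant space `𝔻^{k_p}(λ, p)` of polynomial differential operators from
`𝔽(λ)` to `𝔽(λ + p)`. -/
abbrev DiffOps (p : ℂ) : Submodule ℂ Op := fineOps (nonResonantIdx p)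

/-- The parity involution of `𝔻^{k_p}(λ, p)`. -/
def diffEps (p : ℂ) : Module.End ℂ (DiffOps p) := epsHom.restrict fun _ hT => epsHom_mem hT

/-- The action `σ_{λ,p}` of `𝒦` on `𝔻^{k_p}(λ, p)`. -/
def diffAction (lam p : ℂ) (Z : contactAlgebra) : Module.End ℂ (DiffOps p) :=
  (sigma lam p Z).restrict fun _ hT => sigma_mem lam p p Z hT

/-! ## The conformal symbol -/

/-- `Q` is the conformal quantization `CQ_{λ,p}`: an `𝔰`-equivalence from `⨁_j 𝔽(p - j/2)^{jΠ}` to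
`𝔻^{k_p}(λ, p)` (a bijective `𝔰`-invariant element of the superspace of linear maps) such that
`Q(ω^{p-j/2} G) ≡ ω^p G D̄^j` modulo `𝔻^{(j-1)/2}(λ, p)`. -/
structure IsConformalQuantization (lam p : ℂ) (Q : SymbolSpace p ≃ₗ[ℂ] DiffOps p) : Prop where
  invariant : ∀ Z ∈ conformalAlgebra,
    homAction (V := SymbolSpace p) (W := DiffOps p) (symbolEps p) (symbolAction p Z) (diffEps p)
      (diffAction lam p Z) Q.toLinearMap = 0
  normalized : ∀ (j : SymIdx p) (G : SPoly),
    (Q (Finsupp.single j G) : Op) - mulOp G * Dbar ^ (j : ℕ)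
      ∈ fineOps {i | i < (j : ℕ)}

/-- The action `π(λ,p)(Z) = CS ∘ σ_{λ,p}(Z) ∘ CS⁻¹` of `𝒦` on the symbols, where `CS = Q⁻¹`. -/
def symbolRep (lam p : ℂ) (Q : SymbolSpace p ≃ₗ[ℂ] DiffOps p) (Z : contactAlgebra) :
    Module.End ℂ (SymbolSpace p) :=
  Q.symm.toLinearMap ∘ₗ diffAction lam p Z ∘ₗ Q.toLinearMap

/-- The matrix entry `π_{rs}(λ,p)(Z) : 𝔽(s) → 𝔽(r)` for `r = p - i/2` and `s = p - j/2`. -/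
def matrixEntry (lam p : ℂ) (Q : SymbolSpace p ≃ₗ[ℂ] DiffOps p) (i j : SymIdx p)
    (Z : contactAlgebra) : Op :=
  Finsupp.lapply i ∘ₗ symbolRep lam p Q Z ∘ₗ Finsupp.lsingle j

/-! ## The cochains `β` -/

/-- For `n = 2p ≥ 3`, the value `β̄_p(λ)(e_{N/2})`: for `N ≥ 3` it is
`2^{-2{(N-1)/2}} / ⌊(N-3)/2⌋! · (-1)^{(N-1)·2p} σ_{λ,p}(e_{1/2})^{N-3} (4 ω^p D̄^{2p-3})`
(here `(-1)^{2p} = (-1)^{|v|+1}` for `v = 4 ω^p D̄^{2p-3}`), and for `N ≤ 2`, that is on `𝔰`, it is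
zero. -/
def betaBarValue (n : ℕ) (lam : ℂ) (N : ℕ) : Op :=
  if N < 3 then 0
  else (((2 : ℂ) ^ ((N - 1) % 2))⁻¹ / (((N - 3) / 2).factorial : ℂ) * (-1) ^ ((N - 1) * n)) •
    ((sigma lam (n / 2) (virasoro 3)) ^ (N - 3)) ((4 : ℂ) • Dbar ^ (n - 3))

/-- The cochain `β̄_{n/2}(λ) : 𝒦 → Hom(𝔽(λ), 𝔽(λ + n/2))`, extended linearly from the basis
`e_{k-1} = 𝕏(x^k)`, `e_{k-1/2} = 2 𝕏(ξ x^k)`. -/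
def betaBar (n : ℕ) (lam : ℂ) (Z : contactAlgebra) : Op :=
  ((hamiltonian Z).fst.sum fun k c => c • betaBarValue n lam (2 * k - 2)) +
    (hamiltonian Z).snd.sum fun k c => (c / 2) • betaBarValue n lam (2 * k - 1)

/-- The even cochain `β_p(λ) = R(ε^{2p}) ∘ β̄_p(λ)` with `p = n/2`.  As a map from `Hom(V, W)` to
`Hom(V^Π, W)`, the operator `R(ε_V)` is `T ↦ (-1)^{|T|} T ∘ ε_V = ε_W ∘ T`. -/
def beta (n : ℕ) (lam : ℂ) (Z : contactAlgebra) : Op := eps ^ n * betaBar n lam Z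

/-! ## The scalars -/

/-- The falling factorial `z (z-1) ⋯ (z-n+1)`. -/
def fallingFactorial (z : ℂ) (n : ℕ) : ℂ := ∏ k ∈ Finset.range n, (z - k)

/-- The generalized binomial symbol. -/
def binom (z : ℂ) (n : ℕ) : ℂ := fallingFactorial z n / (n.factorial : ℂ)

/-- The coefficient `p_n` of the extremal projector, at `e_0 = t`. -/
def projCoef (n : ℕ) (t : ℂ) : ℂ :=
  (∏ a ∈ Finset.Icc 1 ((n + 1) / 2), ((a : ℂ) - 2 * t)⁻¹) / ((n / 2).factorial : ℂ)

/-- The scalar `C_{μ,n}` with `ad(e_{-1/2})^n e_μ = C_{μ,n} e_{μ-n/2}`, for `M = 2μ`. -/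
def adCoef (M n : ℕ) : ℂ :=
  (2 : ℂ) ^ (-((n % 2 : ℕ) : ℤ) * (-1) ^ M) *
    fallingFactorial ((M / 2 + 1 : ℕ) : ℂ) ((n + 1) / 2 - (M * n) % 2)

/-- The coefficient `s̃_{μ,n}` (`0 ≤ n ≤ 2μ - 2`) of the step algebra element `s̃_μ`, at `e_0 = t`,
for `M = 2μ`. -/
def stepCoef (M n : ℕ) (t : ℂ) : ℂ :=
  if n + 3 ≤ M then adCoef M n * projCoef n t
  else adCoef M n * projCoef n t + adCoef M (n + 1) * projCoef (n + 1) t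
    + (t - M / 2) * adCoef M (n + 2) * projCoef (n + 2) t

/-- `E^{z,m}_n`, for `m ∈ {0, 1}`. -/
def coefE (lam z : ℂ) (m n : ℕ) : ℂ :=
  fallingFactorial ((z - m) / 2) (n / 2 + (1 - m) * (n % 2)) *
    fallingFactorial ((z + m) / 2 - 1 + 2 * lam) (n / 2 + m * (n % 2))

/-- `F^{z,m}_{N/2}`, for `m ∈ {0, 1}`. -/
def coefF (lam z : ℂ) (m N : ℕ) : ℂ :=
  if N % 2 = 0 then
    -(-1) ^ (N / 2) * fallingFactorial ((z - m) / 2) (N / 2) *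
      (z / 2 - ((N / 2 : ℕ) : ℂ) / 2 ^ m + (((N / 2 : ℕ) : ℂ) + 1) * lam)
  else
    (-1) ^ (N / 2) * fallingFactorial ((z - m) / 2) (N / 2) *
      ((z - m) / 2 - ((N / 2 : ℕ) : ℂ) + 2 * m * (((N / 2 : ℕ) : ℂ) + 1) * lam)

/-- `G^{z,m}_{μ,n} = E^{z-2μ+n, m-2μ+n}_n F^{z,m}_{μ-n/2}`, for `M = 2μ ≥ n`; the second superscript
of `E` is modulo 2. -/
def coefG (lam z : ℂ) (m M n : ℕ) : ℂ :=
  coefE lam (z - M + n) ((m + M + n) % 2) n * coefF lam z m (M - n)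

/-- `P^m_{rs}(λ,p)` with `r = s + n/2`. -/
def scalarP (m n : ℕ) (lam p s : ℂ) : ℂ :=
  ∑ k ∈ Finset.range (n - 1), stepCoef n k (s + n / 2) * coefG lam (2 * (p - s)) m n k

/-- `B_{rs} = 2^{1+2{r-s}} (2s)(2s+1) ⋯ (2s-2+⌊r-s⌋)` with `r = s + n/2`. -/
def scalarB (n : ℕ) (s : ℂ) : ℂ :=
  2 ^ (1 + n % 2) * ∏ k ∈ Finset.range (n / 2 - 1), (2 * s + k)

/-- `c(λ,p) = λ + p/2 - 1/4`. -/
def cParam (lam p : ℂ) : ℂ := lam + p / 2 - 1 / 4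

end SuperLine

end

noncomputable section

namespace SuperLine

/-! The symbol of $\sigma_{\lambda,p}(e_{n/2})\bar D^j$, with $j=2(p-s)$ and $n=2(r-s)$, determines
everything. The proof has three parts.

Quantization. The map $\sigma(e_{-1/2})$ sends $G\bar D^k$ to $D(G)\bar D^k$, because $D$ and $\bar
D$ anticommute. So the ansatz $G\mapsto\sum_l c_l\,D^l(G)\,\bar D^{j-l}$ commutes with lowering for
any $c_l$. Commutation with $e_{1/2}$ is a two-term recursion in $c_l$ that non-resonance makes
solvable (`sigma_raise_quantOp`). Since $e_{\pm1/2}$ generate $\mathfrak s$, this gives $\mathfrak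
s$-equivariance, and unitriangularity in the order gives bijectivity. For uniqueness
(`IsConformalQuantization.unique`), the difference of two quantizations is killed monomial by
monomial: weights and lowering leave one constant term, which the normalization or raising removes.

Proportionality to $\beta$. On symbols $\mathfrak s$ acts diagonally, so an off-diagonal entry
$\pi_{rs}$ vanishes on $\mathfrak s$, and each bracket relation with one argument in $\mathfrak s$
involves that entry alone. The bracket of $e_{-1/2}$ and $e_{3/2}$ lies in $\mathfrak s$, so
$\pi_{rs}(e_{3/2})$ anticommutes with $D$; its weight then makes it a multiple of $\epsilon^n\bar
D^{n-3}$ (`entry_lowest`). Bracketing with $e_{1/2}$ reaches every later $e_m$, and $\beta$ obeys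
the same recursion (`entry_virasoro`).

The scalar. Both sides are evaluated at $e_{n/2}$ on the lowest weight vector $\omega^s$. The
cochain $\beta$ gives $B_{rs}$ (`ev0_beta`), which is nonzero, so $b$ is unique. On the other side
$\sigma(e_{n/2})\bar D^j$ has weight $r$, and its components in the various $\mathbb F(t)$ are
multiples of monomials. The extremal projector $\sum_l p_l(r)\,e_{1/2}^l e_{-1/2}^l$
(`projector_mon`) kills every component except the lowest weight vector of $\mathbb F(r)$. The
result is a multiple of $\bar D^i$, $i=2(p-r)$, and reading its coefficient needs three ingredients:
$e_{-1/2}^l$ turns $e_{n/2}$ into $C_{n/2,l}\,e_{(n-l)/2}$, the coefficients of $\sigma(e_{N/2})\bar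
D^j$ are the $F$, and $e_{1/2}^l$ contributes the $E$. The last three terms merge because
$e_1=e_{1/2}^2$ and $e_0$ is scalar on $\bar D^j$; this is the exceptional value $\tilde
s_{\mu,2\mu-2}$, and the sum is $P_{rs}$ (`ev0_entry`). -/

open Polynomial in
theorem C_half' : (C (1 / 2 : ℂ)) * 2 = 1 := by simpa using C_half

/-! ## Monomials -/

/-- The monomial basis: `mon (2 a) = x ^ a` and `mon (2 a + 1) = ξ x ^ a`. -/
def mon (d : ℕ) : SPoly :=
  if d % 2 = 0 then mk (Polynomial.X ^ (d / 2)) 0 else mk 0 (Polynomial.X ^ (d / 2))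

theorem mon_even (a : ℕ) : mon (2 * a) = mk (Polynomial.X ^ a) 0 := by simp [mon]

theorem mon_odd (a : ℕ) : mon (2 * a + 1) = mk 0 (Polynomial.X ^ a) := by
  simp [mon, Nat.add_mod, show (2 * a + 1) / 2 = a by omega]

/-- The value at `x = ξ = 0`. -/
def ev0 : SPoly →ₗ[ℂ] ℂ where
  toFun F := F.fst.coeff 0
  map_add' := by simp
  map_smul' := by simp

theorem ev0_apply (F : SPoly) : ev0 F = F.fst.coeff 0 := rfl

theorem ev0_mon (d : ℕ) : ev0 (mon d) = if d = 0 then 1 else 0 := by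
  rcases Nat.even_or_odd' d with ⟨a, rfl | rfl⟩
  · rcases a with _ | a
    · simp [mon, ev0_apply]
    · simp [mon_even, ev0_apply]
  · simp [mon_odd, ev0_apply]

@[simp] theorem ev0_mon_zero : ev0 (mon 0) = 1 := by simp [ev0_mon]

@[simp] theorem ev0_eps (F : SPoly) : ev0 (eps F) = ev0 F := by simp [ev0_apply]

theorem smul_mk (c : ℂ) (f g : Polynomial ℂ) : c • mk f g = mk (c • f) (c • g) := by
  ext1 <;> simp

theorem mk_add_mk (f g f' g' : Polynomial ℂ) : mk f g + mk f' g' = mk (f + f') (g + g') := by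
  ext1 <;> simp

theorem mk_fst_snd (F : SPoly) : mk F.fst F.snd = F := by ext1 <;> simp

theorem span_mon : Submodule.span ℂ (Set.range mon) = ⊤ := by
  rw [eq_top_iff]
  rintro F -
  have h1 : ∀ f : Polynomial ℂ, mk f 0 ∈ Submodule.span ℂ (Set.range mon) := by
    intro f
    induction f using Polynomial.induction_on' with
    | add p q hp hq =>
      have := add_mem hp hq
      rwa [mk_add_mk, add_zero] at this
    | monomial n a =>
      have : mk (Polynomial.monomial n a) 0 = a • mon (2 * n) := by
        rw [mon_even, smul_mk, smul_zero, Polynomial.smul_X_eq_monomial]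
      rw [this]
      exact Submodule.smul_mem _ _ (Submodule.subset_span ⟨_, rfl⟩)
  have h2 : ∀ f : Polynomial ℂ, mk 0 f ∈ Submodule.span ℂ (Set.range mon) := by
    intro f
    induction f using Polynomial.induction_on' with
    | add p q hp hq =>
      have := add_mem hp hq
      rwa [mk_add_mk, add_zero] at this
    | monomial n a =>
      have : mk 0 (Polynomial.monomial n a) = a • mon (2 * n + 1) := by
        rw [mon_odd, smul_mk, smul_zero, Polynomial.smul_X_eq_monomial]
      rw [this]
      exact Submodule.smul_mem _ _ (Submodule.subset_span ⟨_, rfl⟩)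
  have := add_mem (h1 F.fst) (h2 F.snd)
  rwa [mk_add_mk, add_zero, zero_add, mk_fst_snd] at this

theorem linearMap_ext_mon {W : Type*} [AddCommGroup W] [Module ℂ W] {S T : SPoly →ₗ[ℂ] W}
    (h : ∀ d, S (mon d) = T (mon d)) : S = T :=
  LinearMap.ext_on_range span_mon h

/-! ## The action on tensor densities -/

/-- The contact vector field `𝕏(f)`. -/
def evenField (f : Polynomial ℂ) : contactAlgebra := contactEquiv (mk f 0)

/-- The contact vector field `2 𝕏(ξ g)`. -/
def oddField (g : Polynomial ℂ) : contactAlgebra := (2 : ℂ) • contactEquiv (mk 0 g)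

theorem virasoro_even (k : ℕ) : virasoro (2 * k) = evenField (Polynomial.X ^ k) := by
  simp [virasoro, evenField]

theorem virasoro_odd (k : ℕ) : virasoro (2 * k + 1) = oddField (Polynomial.X ^ k) := by
  simp [virasoro, oddField, Nat.add_mod, show (2 * k + 1) / 2 = k by omega]

theorem evenField_smul (c : ℂ) (f : Polynomial ℂ) : evenField (c • f) = c • evenField f := by
  rw [evenField, evenField, ← map_smul, smul_mk, smul_zero]

theorem oddField_smul (c : ℂ) (f : Polynomial ℂ) : oddField (c • f) = c • oddField f := by
  rw [oddField, oddField, smul_comm c, ← map_smul contactEquiv c, smul_mk, smul_zero]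

theorem fst_evenField (t : ℂ) (f : Polynomial ℂ) (F : SPoly) :
    (density t (evenField f) F).fst
      = f * Polynomial.derivative F.fst + Polynomial.C t * Polynomial.derivative f * F.fst := by
  simp [evenField, density_contactEquiv, fst_contactField, Polynomial.smul_eq_C_mul, mul_assoc]

theorem snd_evenField (t : ℂ) (f : Polynomial ℂ) (F : SPoly) :
    (density t (evenField f) F).snd
      = f * Polynomial.derivative F.snd
        + Polynomial.C (t + 1 / 2) * Polynomial.derivative f * F.snd := by
  simp [evenField, density_contactEquiv, snd_contactField, Polynomial.smul_eq_C_mul, mul_assoc]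
  ring

theorem fst_oddField (t : ℂ) (g : Polynomial ℂ) (F : SPoly) :
    (density t (oddField g) F).fst = g * F.snd := by
  simp [oddField, density_contactEquiv, fst_contactField]

theorem snd_oddField (t : ℂ) (g : Polynomial ℂ) (F : SPoly) :
    (density t (oddField g) F).snd
      = g * Polynomial.derivative F.fst
        + Polynomial.C (2 * t) * Polynomial.derivative g * F.fst := by
  simp [oddField, density_contactEquiv, snd_contactField, Polynomial.smul_eq_C_mul, smul_add]
  have h : (Polynomial.C 2 : Polynomial ℂ) * Polynomial.C 2⁻¹ = 1 := by
    rw [← Polynomial.C_mul]; simp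
  linear_combination (g * Polynomial.derivative F.fst) * h

/-- This and the next relation carry the whole bracket structure used later: $e_{\pm1/2}$ generate
$\mathfrak s$, and bracketing $e_{3/2}$ repeatedly with $e_{1/2}$ reaches all higher basis elements.
-/
theorem oddField_anticomm (t : ℂ) (f g : Polynomial ℂ) :
    density t (oddField f) * density t (oddField g) + density t (oddField g) * density t (oddField f)
      = (2 : ℂ) • density t (evenField (f * g)) := by
  have h := C_half'
  ext1 u
  ext1
  · simp only [LinearMap.add_apply, Module.End.mul_apply, LinearMap.smul_apply,
      TrivSqZeroExt.fst_add, TrivSqZeroExt.fst_smul, snd_oddField, fst_oddField, fst_evenField,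
      Polynomial.derivative_mul, Polynomial.smul_eq_C_mul, map_mul, map_ofNat]
    ring
  · simp only [LinearMap.add_apply, Module.End.mul_apply, LinearMap.smul_apply,
      TrivSqZeroExt.snd_add, TrivSqZeroExt.snd_smul, snd_oddField, fst_oddField, snd_evenField,
      Polynomial.derivative_mul, Polynomial.smul_eq_C_mul, map_add, map_mul, map_ofNat]
    linear_combination -(Polynomial.derivative f * g + f * Polynomial.derivative g) * u.snd * h

theorem oddField_evenField_comm (t : ℂ) (f g : Polynomial ℂ) :
    density t (oddField g) * density t (evenField f) - density t (evenField f) * density t (oddField g)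
      = density t (oddField ((1 / 2 : ℂ) • (Polynomial.derivative f * g)
          - f * Polynomial.derivative g)) := by
  have h := C_half'
  ext1 u
  ext1
  · simp only [LinearMap.sub_apply, Module.End.mul_apply, TrivSqZeroExt.fst_sub,
      snd_evenField, fst_oddField, fst_evenField,
      Polynomial.derivative_mul, Polynomial.smul_eq_C_mul, map_add]
    ring
  · simp only [LinearMap.sub_apply, Module.End.mul_apply, TrivSqZeroExt.snd_sub,
      snd_evenField, snd_oddField, fst_evenField, map_sub, map_add,
      Polynomial.derivative_mul, Polynomial.smul_eq_C_mul, map_mul, map_ofNat,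
      Polynomial.derivative_C]
    have h2 : Polynomial.derivative (2 : Polynomial ℂ) = 0 := Polynomial.derivative_ofNat 2
    linear_combination (-(Polynomial.derivative f * g * Polynomial.derivative u.fst)
      - g * Polynomial.C t * Polynomial.derivative (Polynomial.derivative f) * u.fst
      - 2 * Polynomial.derivative f * Polynomial.C t * u.fst * Polynomial.derivative g) * h
      - f * Polynomial.C t * u.fst * Polynomial.derivative g * h2

/-! ## The action on linear maps -/

theorem eps_mul_evenField (t : ℂ) (f : Polynomial ℂ) :
    eps * density t (evenField f) = density t (evenField f) * eps := by
  ext1 u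
  ext1 <;> simp [fst_evenField, snd_evenField]; ring

theorem eps_mul_oddField (t : ℂ) (f : Polynomial ℂ) :
    eps * density t (oddField f) = -(density t (oddField f) * eps) := by
  ext1 u
  ext1 <;> simp [fst_oddField, snd_oddField]

theorem sigma_evenField (lam p : ℂ) (f : Polynomial ℂ) (T : Op) :
    sigma lam p (evenField f) T
      = density (lam + p) (evenField f) * T - T * density lam (evenField f) := by
  have h0 : density lam (contactEquiv (mk 0 0)) = 0 := by
    rw [show mk 0 0 = (0 : SPoly) by ext1 <;> simp, map_zero, map_zero]
  rw [sigma_apply, evenField, evenPart_density, oddPart_density]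
  simp [h0]

theorem sigma_smul (lam p c : ℂ) (Z : contactAlgebra) :
    sigma lam p (c • Z) = c • sigma lam p Z := by
  rw [sigma, map_smul, map_smul, homAction_smul, sigma]

theorem sigma_add (lam p : ℂ) (Y Z : contactAlgebra) :
    sigma lam p (Y + Z) = sigma lam p Y + sigma lam p Z := by
  rw [sigma, map_add, map_add, homAction_add, sigma, sigma]

theorem sigma_oddField (lam p : ℂ) (f : Polynomial ℂ) (T : Op) :
    sigma lam p (oddField f) T
      = density (lam + p) (oddField f) * T - eps * T * eps * density lam (oddField f) := by
  have h0 : density lam (contactEquiv (mk 0 0)) = 0 := by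
    rw [show mk 0 0 = (0 : SPoly) by ext1 <;> simp, map_zero, map_zero]
  rw [oddField, sigma_smul, LinearMap.smul_apply, sigma_apply, evenPart_density, oddPart_density]
  simp [h0, smul_sub]

/-- Because $e$ anticommutes with the odd operators, the mixed terms $A\,(eTe)\,B'$ and
$B\,(eTe)\,A'$ occur twice with opposite signs and cancel. -/
theorem superbracket_aux {R : Type*} [Ring R] {e A B A' B' T : R} (h : e * e = 1)
    (e1 : e * A = -(A * e)) (e2 : e * B = -(B * e)) (e3 : e * A' = -(A' * e))
    (e4 : e * B' = -(B' * e)) :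
    A * (B * T - e * T * e * B') - e * (B * T - e * T * e * B') * e * A'
      + (B * (A * T - e * T * e * A') - e * (A * T - e * T * e * A') * e * B')
      = (A * B + B * A) * T - T * (A' * B' + B' * A') := by
  have k1 : ∀ X : R, e * (A * X) = -(A * (e * X)) := fun X => by
    rw [← mul_assoc, e1, neg_mul, mul_assoc]
  have k2 : ∀ X : R, e * (B * X) = -(B * (e * X)) := fun X => by
    rw [← mul_assoc, e2, neg_mul, mul_assoc]
  have k5 : ∀ X : R, e * (e * X) = X := fun X => by
    rw [← mul_assoc, h, one_mul]
  simp only [mul_sub, sub_mul, mul_add, add_mul, mul_assoc, k1, k2, k5, e3, e4, mul_neg,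
    neg_mul, neg_neg, h, mul_one]
  abel

theorem sigma_oddField_anticomm (lam p : ℂ) (f g : Polynomial ℂ) :
    sigma lam p (oddField f) * sigma lam p (oddField g)
      + sigma lam p (oddField g) * sigma lam p (oddField f)
      = (2 : ℂ) • sigma lam p (evenField (f * g)) := by
  refine LinearMap.ext fun T => ?_
  simp only [LinearMap.add_apply, Module.End.mul_apply, LinearMap.smul_apply, sigma_evenField,
    sigma_oddField, smul_sub]
  rw [← smul_mul_assoc, ← mul_smul_comm, ← oddField_anticomm, ← oddField_anticomm]
  exact superbracket_aux eps_mul_eps (eps_mul_oddField _ _) (eps_mul_oddField _ _)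
    (eps_mul_oddField _ _) (eps_mul_oddField _ _)

theorem sigma_oddField_evenField_comm (lam p : ℂ) (f g : Polynomial ℂ) :
    sigma lam p (oddField g) * sigma lam p (evenField f)
      - sigma lam p (evenField f) * sigma lam p (oddField g)
      = sigma lam p (oddField ((1 / 2 : ℂ) • (Polynomial.derivative f * g)
          - f * Polynomial.derivative g)) := by
  refine LinearMap.ext fun T => ?_
  simp only [LinearMap.sub_apply, Module.End.mul_apply, sigma_evenField, sigma_oddField]
  rw [← oddField_evenField_comm, ← oddField_evenField_comm]
  have e1 := eps_mul_evenField (lam + p) f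
  have e3 := eps_mul_evenField lam f
  generalize density (lam + p) (evenField f) = A at *
  generalize density (lam + p) (oddField g) = B at *
  generalize density lam (evenField f) = A' at *
  generalize density lam (oddField g) = B' at *
  generalize eps = e at *
  have k1 : ∀ X : Op, e * (A * X) = A * (e * X) := fun X => by
    rw [← mul_assoc, e1, mul_assoc]
  have k3 : ∀ X : Op, e * (A' * X) = A' * (e * X) := fun X => by
    rw [← mul_assoc, e3, mul_assoc]
  simp only [mul_sub, sub_mul, mul_assoc, k1, k3]
  abel

end SuperLine
end

noncomputable section

namespace SuperLine

/-! ## The conformal operators on monomials -/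

/-- The coefficient of the lowering operator: `D (mon (d + 1)) = lowerCoef d • mon d`. -/
def lowerCoef (d : ℕ) : ℂ := if d % 2 = 0 then 1 else ((d / 2 : ℕ) : ℂ) + 1

/-- The coefficient of the raising operator `π_t(e_{1/2})`:
it maps `mon d` to `raiseCoef t d • mon (d + 1)`. -/
def raiseCoef (t : ℂ) (d : ℕ) : ℂ := if d % 2 = 0 then ((d / 2 : ℕ) : ℂ) + 2 * t else 1

theorem lowerCoef_even (a : ℕ) : lowerCoef (2 * a) = 1 := by simp [lowerCoef]
theorem lowerCoef_odd (a : ℕ) : lowerCoef (2 * a + 1) = a + 1 := by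
  simp [lowerCoef, Nat.add_mod, show (2 * a + 1) / 2 = a by omega]
theorem raiseCoef_even (t : ℂ) (a : ℕ) : raiseCoef t (2 * a) = a + 2 * t := by simp [raiseCoef]
theorem raiseCoef_odd (t : ℂ) (a : ℕ) : raiseCoef t (2 * a + 1) = 1 := by
  simp [raiseCoef, Nat.add_mod]

theorem lowerCoef_ne_zero (d : ℕ) : lowerCoef d ≠ 0 := by
  rcases Nat.even_or_odd' d with ⟨a, rfl | rfl⟩
  · simp [lowerCoef_even]
  · rw [lowerCoef_odd]; exact Nat.cast_add_one_ne_zero a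

theorem D_mon_zero : D (mon 0) = 0 := by
  rw [show mon 0 = mon (2 * 0) from rfl, mon_even]
  ext1 <;> simp

theorem D_mon_succ (d : ℕ) : D (mon (d + 1)) = lowerCoef d • mon d := by
  rcases Nat.even_or_odd' d with ⟨a, rfl | rfl⟩
  · rw [mon_odd, mon_even, lowerCoef_even]
    ext1 <;> simp
  · rw [show 2 * a + 1 + 1 = 2 * (a + 1) by ring, mon_odd, mon_even, lowerCoef_odd]
    ext1 <;> simp [Polynomial.smul_eq_C_mul]

theorem Dbar_mon_zero : Dbar (mon 0) = 0 := by
  rw [show mon 0 = mon (2 * 0) from rfl, mon_even]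
  ext1 <;> simp

theorem Dbar_mon_succ (d : ℕ) : Dbar (mon (d + 1)) = ((-1) ^ d * lowerCoef d) • mon d := by
  rcases Nat.even_or_odd' d with ⟨a, rfl | rfl⟩
  · rw [mon_odd, mon_even, lowerCoef_even]
    ext1 <;> simp
  · rw [show 2 * a + 1 + 1 = 2 * (a + 1) by ring, mon_odd, mon_even, lowerCoef_odd]
    ext1
    · simp
    · simp [Polynomial.smul_eq_C_mul, pow_succ _ (2 * a), pow_mul]
      ring

theorem eps_mon (d : ℕ) : eps (mon d) = (-1 : ℂ) ^ d • mon d := by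
  rcases Nat.even_or_odd' d with ⟨a, rfl | rfl⟩
  · rw [mon_even]
    ext1 <;> simp [pow_mul]
  · rw [mon_odd]
    ext1 <;> simp [pow_succ, pow_mul]

theorem virasoro_one : virasoro 1 = oddField 1 := by simpa using virasoro_odd 0
theorem virasoro_two : virasoro 2 = evenField Polynomial.X := by simpa using virasoro_even 1
theorem virasoro_three : virasoro 3 = oddField Polynomial.X := by simpa using virasoro_odd 1

theorem density_lower (t : ℂ) : density t (oddField 1) = D := by
  ext1 u
  ext1 <;> simp [fst_oddField, snd_oddField]

theorem density_raise_mon (t : ℂ) (d : ℕ) :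
    density t (oddField Polynomial.X) (mon d) = raiseCoef t d • mon (d + 1) := by
  rcases Nat.even_or_odd' d with ⟨a, rfl | rfl⟩
  · rw [mon_odd, mon_even, raiseCoef_even]
    ext1
    · simp [fst_oddField]
    · rcases a with _ | a
      · simp [snd_oddField, Polynomial.smul_eq_C_mul]
      · simp [snd_oddField, Polynomial.smul_eq_C_mul]
        ring
  · rw [show 2 * a + 1 + 1 = 2 * (a + 1) by ring, mon_odd, mon_even, raiseCoef_odd]
    ext1
    · simp [fst_oddField, pow_succ']
    · simp [snd_oddField]

theorem density_weight_mon (t : ℂ) (d : ℕ) :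
    density t (evenField Polynomial.X) (mon d) = (d / 2 + t) • mon d := by
  rcases Nat.even_or_odd' d with ⟨a, rfl | rfl⟩
  · rw [mon_even]
    ext1
    · rcases a with _ | a
      · simp [fst_evenField, Polynomial.smul_eq_C_mul]
      · simp [fst_evenField, Polynomial.smul_eq_C_mul]
        ring
    · simp [snd_evenField]
  · rw [mon_odd]
    ext1
    · simp [fst_evenField]
    · rcases a with _ | a
      · simp [snd_evenField, Polynomial.smul_eq_C_mul]; ring
      · simp [snd_evenField, Polynomial.smul_eq_C_mul, add_div]
        ring

theorem ev0_raise (t : ℂ) (F : SPoly) : ev0 (density t (oddField Polynomial.X) F) = 0 := by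
  simp [ev0_apply, fst_oddField]

theorem ev0_weight (t : ℂ) (F : SPoly) :
    ev0 (density t (evenField Polynomial.X) F) = t * ev0 F := by
  simp [ev0_apply, fst_evenField]

theorem eq_smul_mon_zero {F : SPoly} (h : D F = 0) : F = ev0 F • mon 0 := by
  have h1 := congrArg TrivSqZeroExt.fst h
  have h2 := congrArg TrivSqZeroExt.snd h
  simp at h1 h2
  rw [show mon 0 = mon (2 * 0) from rfl, mon_even]
  ext1
  · simpa [ev0_apply, Polynomial.smul_eq_C_mul] using Polynomial.eq_C_of_natDegree_eq_zero h2
  · simp [h1]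

/-- A linear map which intertwines the lowering operators up to scalars is determined by the
constant terms of its values. -/
theorem eq_zero_of_lower {T : Op} (h0 : D (T (mon 0)) = 0)
    (h : ∀ d, T (mon d) = 0 → D (T (mon (d + 1))) = 0) (hev : ∀ d, ev0 (T (mon d)) = 0) :
    T = 0 := by
  refine linearMap_ext_mon fun d => ?_
  rw [LinearMap.zero_apply]
  induction d with
  | zero => rw [eq_smul_mon_zero h0, hev, zero_smul]
  | succ d ih => rw [eq_smul_mon_zero (h d ih), hev, zero_smul]

theorem sigma_lower_eq_zero {lam p : ℂ} {T : Op} (hT : sigma lam p (oddField 1) T = 0) (d : ℕ) :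
    D (T (mon 0)) = 0 ∧ D (T (mon (d + 1))) = ((-1) ^ d * lowerCoef d) • eps (T (mon d)) := by
  rw [sigma_oddField, density_lower, density_lower, sub_eq_zero] at hT
  have h : ∀ F, D (T F) = eps (T (eps (D F))) := fun F => LinearMap.congr_fun hT F
  constructor
  · rw [h, D_mon_zero]; simp
  · rw [h, D_mon_succ, map_smul, eps_mon, smul_smul, map_smul, map_smul, mul_comm]

/-! ## Powers of `D̄` -/

/-- The value of `D̄ ^ k` on `mon k`. -/
def diagCoef (k : ℕ) : ℂ := ∏ i ∈ Finset.range k, (-1) ^ i * lowerCoef i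

theorem diagCoef_ne_zero (k : ℕ) : diagCoef k ≠ 0 :=
  Finset.prod_ne_zero_iff.2 fun i _ =>
    mul_ne_zero (pow_ne_zero _ (by simp)) (lowerCoef_ne_zero i)

theorem diagCoef_succ (k : ℕ) : diagCoef (k + 1) = diagCoef k * ((-1) ^ k * lowerCoef k) :=
  Finset.prod_range_succ _ _

theorem Dbar_pow_mon_self (k : ℕ) : (Dbar ^ k) (mon k) = diagCoef k • mon 0 := by
  induction k with
  | zero => simp [diagCoef]
  | succ k ih =>
    rw [pow_succ, Module.End.mul_apply, Dbar_mon_succ, map_smul, ih, smul_smul, diagCoef_succ,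
      mul_comm]

theorem Dbar_pow_mon_lt {k d : ℕ} (h : d < k) : (Dbar ^ k) (mon d) = 0 := by
  obtain ⟨e, rfl⟩ := Nat.exists_eq_add_of_lt h
  rw [show d + e + 1 = e + 1 + d by ring, pow_add, Module.End.mul_apply, Dbar_pow_mon_self,
    map_smul, pow_succ, Module.End.mul_apply, Dbar_mon_zero]
  simp

theorem Dbar_pow_mon_add (k d : ℕ) : ∃ c : ℂ, (Dbar ^ k) (mon (k + d)) = c • mon d := by
  induction k with
  | zero => exact ⟨1, by simp⟩
  | succ k ih =>
    obtain ⟨c, hc⟩ := ih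
    refine ⟨(-1) ^ (k + d) * lowerCoef (k + d) * c, ?_⟩
    rw [show k + 1 + d = k + d + 1 by ring, pow_succ, Module.End.mul_apply, Dbar_mon_succ,
      map_smul, hc, smul_smul]

/-- Each $\bar D$ lowers the index of a monomial by one and `ev0` sees only `mon 0`. Testing an
operator on `mon d` thus isolates the value at the origin of its coefficient of $\bar D^d$. -/
theorem ev0_mulOp_Dbar_pow (G : SPoly) (k d : ℕ) :
    ev0 ((mulOp G * Dbar ^ k) (mon d)) = if d = k then diagCoef k * ev0 G else 0 := by
  have hmul : ∀ F : SPoly, ev0 (G * F) = ev0 G * ev0 F := by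
    simp [ev0_apply, Polynomial.mul_coeff_zero]
  rw [Module.End.mul_apply, mulOp_apply, hmul]
  rcases lt_trichotomy d k with h | rfl | h
  · rw [Dbar_pow_mon_lt h, if_neg h.ne]; simp
  · rw [Dbar_pow_mon_self]; simp [mul_comm]
  · obtain ⟨e, rfl⟩ := Nat.exists_eq_add_of_lt h
    obtain ⟨c, hc⟩ := Dbar_pow_mon_add k (e + 1)
    rw [show k + e + 1 = k + (e + 1) by ring, hc, if_neg (by omega)]
    simp [ev0_mon]

theorem ev0_Dbar_pow (k d : ℕ) :
    ev0 ((Dbar ^ k) (mon d)) = if d = k then diagCoef k else 0 := by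
  have h := ev0_mulOp_Dbar_pow (mon 0) k d
  have h1 : mulOp (mon 0) = 1 := by
    rw [show mon 0 = mon (2 * 0) from rfl, mon_even]
    ext1 u; ext1 <;> simp
  simpa [h1] using h

theorem ev0_of_mem_fineOps {T : Op} {k : ℕ} (hT : T ∈ fineOps {i | i < k}) :
    ev0 (T (mon k)) = 0 := by
  induction hT using Submodule.span_induction with
  | mem T hT =>
    obtain ⟨j, hj, G, rfl⟩ := hT
    have hj' : j < k := hj
    rw [ev0_mulOp_Dbar_pow, if_neg hj'.ne']
  | zero => simp
  | add S T _ _ hS hT => rw [LinearMap.add_apply, map_add, hS, hT, add_zero]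
  | smul c T _ hT => rw [LinearMap.smul_apply, map_smul, hT, smul_zero]

theorem D_mul_Dbar : D * Dbar = -(Dbar * D) := by
  ext1 u
  ext1 <;> simp

theorem eps_mul_D : eps * D = -(D * eps) := by
  ext1 u
  ext1 <;> simp

theorem D_mul_Dbar_pow (k : ℕ) : D * Dbar ^ k = (-1 : ℂ) ^ k • (Dbar ^ k * D) := by
  induction k with
  | zero => simp
  | succ k ih =>
    rw [pow_succ, ← mul_assoc, ih, smul_mul_assoc, mul_assoc, D_mul_Dbar, pow_succ, mul_smul,
      mul_assoc]
    ext1 u; simp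

/-- Since $D$ supercommutes with $\bar D$, lowering differentiates only the coefficient. In
particular every $\bar D^k$ is a lowest weight vector. -/
theorem sigma_lower_mulOp (lam p : ℂ) (G : SPoly) (k : ℕ) :
    sigma lam p (oddField 1) (mulOp G * Dbar ^ k) = mulOp (D G) * Dbar ^ k := by
  rw [sigma_oddField, density_lower, density_lower, eps_conj, smul_mul_assoc, mul_assoc,
    ← mul_smul_comm, ← D_mul_Dbar_pow, ← mul_assoc, ← mul_assoc, ← sub_mul]
  congr 1
  ext1 u
  ext1 <;> simp
  ring

theorem mulOp_mon_zero : mulOp (mon 0) = 1 := by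
  rw [show mon 0 = mon (2 * 0) from rfl, mon_even]
  ext1 u; ext1 <;> simp

theorem sigma_lower_Dbar_pow (lam p : ℂ) (k : ℕ) :
    sigma lam p (oddField 1) (Dbar ^ k) = 0 := by
  have h := sigma_lower_mulOp lam p (mon 0) k
  rw [D_mon_zero, mulOp_mon_zero, one_mul] at h
  rw [h]
  ext1 u; simp

/-- Constant terms of an operator of given weight. -/
theorem ev0_of_weight {lam p w : ℂ} {T : Op} (hT : sigma lam p (evenField Polynomial.X) T = w • T)
    {d : ℕ} (hd : w ≠ p - d / 2) : ev0 (T (mon d)) = 0 := by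
  rw [sigma_evenField] at hT
  have h := congrArg ev0 (LinearMap.congr_fun hT (mon d))
  simp only [LinearMap.sub_apply, Module.End.mul_apply, density_weight_mon, map_sub, map_smul,
    ev0_weight, LinearMap.smul_apply, smul_eq_mul] at h
  have : (w - (p - d / 2)) * ev0 (T (mon d)) = 0 := by linear_combination -h
  exact (mul_eq_zero.1 this).resolve_left (sub_ne_zero.2 hd)

/-- The normalized coefficient of `D̄ ^ k` at `x = ξ = 0` in an operator. -/
def lowCoef (k : ℕ) : Op →ₗ[ℂ] ℂ where
  toFun T := (diagCoef k)⁻¹ * ev0 (T (mon k))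
  map_add' S T := by rw [LinearMap.add_apply, map_add, mul_add]
  map_smul' c T := by
    rw [LinearMap.smul_apply, map_smul, smul_eq_mul, RingHom.id_apply, smul_eq_mul]; ring

theorem lowCoef_apply (k : ℕ) (T : Op) : lowCoef k T = (diagCoef k)⁻¹ * ev0 (T (mon k)) := rfl

theorem lowCoef_Dbar_pow (k : ℕ) : lowCoef k (Dbar ^ k) = 1 := by
  rw [lowCoef_apply, ev0_Dbar_pow, if_pos rfl, inv_mul_cancel₀ (diagCoef_ne_zero k)]

/-- The coefficient in `σ(e_{1/2})(G D̄^k) = π(e_{1/2})(G) D̄^k + orderCoef lam k • ε(G) D̄^{k-1}`. -/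
def orderCoef (lam : ℂ) (k : ℕ) : ℂ :=
  if k % 2 = 0 then ((k / 2 : ℕ) : ℂ) else 2 * lam + ((k / 2 : ℕ) : ℂ)

theorem orderCoef_even (lam : ℂ) (a : ℕ) : orderCoef lam (2 * a) = a := by simp [orderCoef]
theorem orderCoef_odd (lam : ℂ) (a : ℕ) : orderCoef lam (2 * a + 1) = 2 * lam + a := by
  simp [orderCoef, Nat.add_mod, show (2 * a + 1) / 2 = a by omega]

/-- The values of $\pi(e_{1/2})$ vanish at the origin, so only the product with
$\pi_\lambda(e_{1/2})$ on the right contributes, and that moves `mon k` to `mon (k + 1)`. -/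
theorem lowCoef_sigma_raise (lam p : ℂ) (k : ℕ) (T : Op) :
    lowCoef k (sigma lam p (oddField Polynomial.X) T)
      = orderCoef lam (k + 1) * lowCoef (k + 1) T := by
  have h0 := diagCoef_ne_zero k
  have h1 : (-1) ^ k * lowerCoef k ≠ 0 := mul_ne_zero (pow_ne_zero _ (by simp)) (lowerCoef_ne_zero k)
  rw [lowCoef_apply, lowCoef_apply, sigma_oddField, diagCoef_succ]
  simp only [LinearMap.sub_apply, Module.End.mul_apply, density_raise_mon, map_sub, map_smul,
    ev0_raise, eps_mon, ev0_eps, smul_smul, smul_eq_mul]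
  rcases Nat.even_or_odd' k with ⟨a, rfl | rfl⟩
  · rw [raiseCoef_even, orderCoef_odd, lowerCoef_even]
    simp [pow_succ, pow_mul]
    ring
  · rw [raiseCoef_odd, show 2 * a + 1 + 1 = 2 * (a + 1) by ring, orderCoef_even, lowerCoef_odd] at *
    have : (a : ℂ) + 1 ≠ 0 := Nat.cast_add_one_ne_zero a
    have h2 : (-1 : ℂ) ^ (2 * a + 1) = -1 := by simp [pow_succ, pow_mul]
    have h3 : (-1 : ℂ) ^ (2 * (a + 1)) = 1 := by simp [pow_mul]
    rw [h2, h3] at *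
    push_cast
    field_simp
    ring

end SuperLine
end

noncomputable section

namespace SuperLine

/-! ## Block diagonal maps -/

theorem diagonal_single {p : ℂ} (f : SymIdx p → Op) (j : SymIdx p) (G : SPoly) :
    diagonal f (Finsupp.single j G) = Finsupp.single j (f j G) := by
  simp [diagonal]

theorem diagonal_apply {p : ℂ} (f : SymIdx p → Op) (w : SymbolSpace p) (k : SymIdx p) :
    diagonal f w k = f k (w k) := by
  induction w using Finsupp.induction_linear with
  | zero => simp
  | add v w hv hw => rw [map_add, Finsupp.add_apply, hv, hw, Finsupp.add_apply, map_add]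
  | single j G =>
    rw [diagonal_single]
    by_cases h : j = k
    · subst h; simp
    · simp [Finsupp.single_eq_of_ne' h]

theorem symbolAction_single (p : ℂ) (Z : contactAlgebra) (j : SymIdx p) (G : SPoly) :
    symbolAction p Z (Finsupp.single j G)
      = Finsupp.single j (density (p - (j : ℕ) / 2) Z G) := diagonal_single _ _ _

theorem symbolAction_apply (p : ℂ) (Z : contactAlgebra) (w : SymbolSpace p) (k : SymIdx p) :
    symbolAction p Z w k = density (p - (k : ℕ) / 2) Z (w k) := diagonal_apply _ _ _

theorem symbolEps_apply (p : ℂ) (w : SymbolSpace p) (k : SymIdx p) :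
    symbolEps p w k = (-1 : ℂ) ^ (k : ℕ) • eps (w k) := diagonal_apply _ _ _

theorem symbolEps_single (p : ℂ) (j : SymIdx p) (G : SPoly) :
    symbolEps p (Finsupp.single j G) = Finsupp.single j ((-1 : ℂ) ^ (j : ℕ) • eps G) :=
  diagonal_single _ _ _

theorem symbolAction_add (p : ℂ) (Y Z : contactAlgebra) :
    symbolAction p (Y + Z) = symbolAction p Y + symbolAction p Z := by
  refine LinearMap.ext fun w => Finsupp.ext fun k => ?_
  simp [symbolAction_apply]

theorem symbolAction_smul (p c : ℂ) (Z : contactAlgebra) :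
    symbolAction p (c • Z) = c • symbolAction p Z := by
  refine LinearMap.ext fun w => Finsupp.ext fun k => ?_
  simp [symbolAction_apply]

theorem neg_one_pow_mul_self (k : ℕ) : (-1 : ℂ) ^ k * (-1) ^ k = 1 := by
  rw [← mul_pow]; simp

theorem symbolEps_symbolEps (p : ℂ) (w : SymbolSpace p) : symbolEps p (symbolEps p w) = w := by
  refine Finsupp.ext fun k => ?_
  have h : ∀ F, eps (eps F) = F := LinearMap.congr_fun eps_mul_eps
  rw [symbolEps_apply, symbolEps_apply, map_smul, smul_smul, neg_one_pow_mul_self, h, one_smul]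

theorem symbolEps_evenField (p : ℂ) (f : Polynomial ℂ) (w : SymbolSpace p) :
    symbolEps p (symbolAction p (evenField f) w) = symbolAction p (evenField f) (symbolEps p w) := by
  refine Finsupp.ext fun k => ?_
  have h := LinearMap.congr_fun (eps_mul_evenField (p - (k : ℕ) / 2) f) (w k)
  simp only [Module.End.mul_apply] at h
  rw [symbolEps_apply, symbolAction_apply, symbolAction_apply, symbolEps_apply, h, map_smul]

theorem symbolEps_oddField (p : ℂ) (f : Polynomial ℂ) (w : SymbolSpace p) :
    symbolEps p (symbolAction p (oddField f) w)
      = -symbolAction p (oddField f) (symbolEps p w) := by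
  refine Finsupp.ext fun k => ?_
  have h := LinearMap.congr_fun (eps_mul_oddField (p - (k : ℕ) / 2) f) (w k)
  simp only [Module.End.mul_apply, LinearMap.neg_apply] at h
  rw [symbolEps_apply, symbolAction_apply, Finsupp.neg_apply, symbolAction_apply, symbolEps_apply,
    h, map_smul, smul_neg]

/-! ### Equivariance and uniqueness of the conformal quantization -/

theorem homAction_of_even {V W : Type*} [AddCommGroup V] [Module ℂ V] [AddCommGroup W] [Module ℂ W]
    (εV A : Module.End ℂ V) (εW B : Module.End ℂ W) (T : V →ₗ[ℂ] W) (hV : εV * A * εV = A) :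
    homAction εV A εW B T = B ∘ₗ T - T ∘ₗ A := by
  have h1 : evenPart εV A = A := by rw [evenPart, hV, ← two_smul ℂ A, smul_smul]; norm_num
  have h2 : oddPart εV A = 0 := by rw [oddPart, hV, sub_self, smul_zero]
  simp [homAction, h1, h2]

theorem homAction_of_odd {V W : Type*} [AddCommGroup V] [Module ℂ V] [AddCommGroup W] [Module ℂ W]
    (εV A : Module.End ℂ V) (εW B : Module.End ℂ W) (T : V →ₗ[ℂ] W) (hV : εV * A * εV = -A) :
    homAction εV A εW B T = B ∘ₗ T - (εW ∘ₗ T ∘ₗ εV) ∘ₗ A := by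
  have h1 : evenPart εV A = 0 := by rw [evenPart, hV, add_neg_cancel, smul_zero]
  have h2 : oddPart εV A = A := by
    rw [oddPart, hV, sub_neg_eq_add, ← two_smul ℂ A, smul_smul]; norm_num
  simp [homAction, h1, h2]

theorem homAction_even_map {V W : Type*} [AddCommGroup V] [Module ℂ V] [AddCommGroup W]
    [Module ℂ W] (εV A : Module.End ℂ V) (εW B : Module.End ℂ W) (T : V →ₗ[ℂ] W)
    (hT : εW ∘ₗ T ∘ₗ εV = T) :
    homAction εV A εW B T = B ∘ₗ T - T ∘ₗ A := by
  have h : evenPart εV A + oddPart εV A = A := by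
    rw [evenPart, oddPart, ← smul_add, add_add_sub_cancel, ← two_smul ℂ A, smul_smul]; norm_num
  simp only [homAction, LinearMap.coe_mk, AddHom.coe_mk, hT]
  nth_rewrite 3 [← h]
  rw [LinearMap.comp_add, sub_sub]

theorem IsConformalQuantization.evenField_apply {lam p : ℂ} {Q : SymbolSpace p ≃ₗ[ℂ] DiffOps p}
    (hQ : IsConformalQuantization lam p Q) {f : Polynomial ℂ} (hf : evenField f ∈ conformalAlgebra)
    (w : SymbolSpace p) :
    sigma lam p (evenField f) (Q w) = Q (symbolAction p (evenField f) w) := by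
  have h := hQ.invariant _ hf
  rw [homAction_of_even] at h
  · exact sub_eq_zero.1 (congrArg Subtype.val (LinearMap.congr_fun h w))
  · refine LinearMap.ext fun v => ?_
    simp only [Module.End.mul_apply]
    rw [symbolEps_evenField, symbolEps_symbolEps]

theorem IsConformalQuantization.oddField_apply {lam p : ℂ} {Q : SymbolSpace p ≃ₗ[ℂ] DiffOps p}
    (hQ : IsConformalQuantization lam p Q) {f : Polynomial ℂ} (hf : oddField f ∈ conformalAlgebra)
    (w : SymbolSpace p) :
    sigma lam p (oddField f) (Q w)
      = epsHom (Q (symbolEps p (symbolAction p (oddField f) w))) := by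
  have h := hQ.invariant _ hf
  rw [homAction_of_odd] at h
  · exact sub_eq_zero.1 (congrArg Subtype.val (LinearMap.congr_fun h w))
  · refine LinearMap.ext fun v => ?_
    simp only [Module.End.mul_apply, LinearMap.neg_apply]
    rw [symbolEps_oddField, symbolEps_symbolEps]

theorem virasoro_mem {a : ℕ} (ha : a ≤ 4) : virasoro a ∈ conformalAlgebra :=
  Submodule.subset_span ⟨a, ha, rfl⟩

theorem lower_mem : oddField 1 ∈ conformalAlgebra := virasoro_one ▸ virasoro_mem (by norm_num)
theorem weight_mem : evenField Polynomial.X ∈ conformalAlgebra :=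
  virasoro_two ▸ virasoro_mem (by norm_num)
theorem raise_mem : oddField Polynomial.X ∈ conformalAlgebra :=
  virasoro_three ▸ virasoro_mem (by norm_num)

theorem nonResonantIdx_of_le {p : ℂ} {i j : ℕ} (hj : j ∈ nonResonantIdx p) (h : i ≤ j) :
    i ∈ nonResonantIdx p := fun n hn => h.trans (hj n hn)

/-- The non-resonance condition: `2 p - j + a ≠ 0` if `2 a < j + 1`. -/
theorem nonResonant {p : ℂ} {j a : ℕ} (hj : j ∈ nonResonantIdx p) (ha : a < j) :
    2 * (p - j / 2) + a ≠ 0 := by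
  intro h
  obtain ⟨b, rfl⟩ := Nat.exists_eq_add_of_lt ha
  -- With $j=a+b+1$, vanishing would mean $2p=j-a=b+1$, so the index set would stop at $b<j$.
  have := hj b (by push_cast at h ⊢; linear_combination h)
  omega

/-- Parity of `Q` is not assumed, so the odd equivariance carries the twist by `epsHom` and
`symbolEps`. The difference `S` of two quantizations is shown to vanish on the monomials of each
summand, by induction on their index. -/
theorem IsConformalQuantization.unique {lam p : ℂ} {Q Q' : SymbolSpace p ≃ₗ[ℂ] DiffOps p}
    (hQ : IsConformalQuantization lam p Q) (hQ' : IsConformalQuantization lam p Q') : Q = Q' := by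
  set S : SymbolSpace p →ₗ[ℂ] Op := (DiffOps p).subtype ∘ₗ Q.toLinearMap
    - (DiffOps p).subtype ∘ₗ Q'.toLinearMap with hS
  have hSapp : ∀ w, S w = (Q w : Op) - Q' w := fun w => rfl
  have even : ∀ {f}, evenField f ∈ conformalAlgebra → ∀ w,
      sigma lam p (evenField f) (S w) = S (symbolAction p (evenField f) w) := fun hf w => by
    rw [hSapp, map_sub, hQ.evenField_apply hf, hQ'.evenField_apply hf, hSapp]
  have odd : ∀ {f}, oddField f ∈ conformalAlgebra → ∀ w, sigma lam p (oddField f) (S w)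
      = epsHom (S (symbolEps p (symbolAction p (oddField f) w))) := fun hf w => by
    rw [hSapp, map_sub, hQ.oddField_apply hf, hQ'.oddField_apply hf, hSapp, map_sub]
  have key : ∀ (j : SymIdx p) (d : ℕ), S (Finsupp.single j (mon d)) = 0 := by
    intro j d
    have hw : ∀ d : ℕ, sigma lam p (evenField Polynomial.X) (S (Finsupp.single j (mon d)))
        = ((d : ℂ) / 2 + (p - (j : ℕ) / 2)) • S (Finsupp.single j (mon d)) := fun d => by
      rw [even weight_mem, symbolAction_single, density_weight_mon, ← Finsupp.smul_single, map_smul]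
    have hl : ∀ d, sigma lam p (oddField 1) (S (Finsupp.single j (mon d)))
        = epsHom (S (Finsupp.single j ((-1 : ℂ) ^ (j : ℕ) • eps (D (mon d))))) := fun d => by
      rw [odd lower_mem, symbolAction_single, density_lower, symbolEps_single]
    -- An operator killed by lowering is determined by the constant terms of its values; its weight
    -- leaves only the value on `mon e` with `d + e = j`.
    have fin : ∀ d, sigma lam p (oddField 1) (S (Finsupp.single j (mon d))) = 0 →
        (∀ e, d + e = (j : ℕ) → ev0 (S (Finsupp.single j (mon d)) (mon e)) = 0) →
        S (Finsupp.single j (mon d)) = 0 := by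
      intro d h1 h2
      refine eq_zero_of_lower (sigma_lower_eq_zero h1 0).1 (fun e he => ?_) fun e => ?_
      · rw [(sigma_lower_eq_zero h1 e).2, he, map_zero, smul_zero]
      · by_cases he : d + e = (j : ℕ)
        · exact h2 e he
        · refine ev0_of_weight (hw d) fun h => he ?_
          have : ((d + e : ℕ) : ℂ) = (j : ℕ) := by
            push_cast
            linear_combination 2 * h
          exact_mod_cast this
    induction d with
    | zero =>
      refine fin _ ?_ fun e he => ?_
      · rw [hl, D_mon_zero]; simp
      · obtain rfl : e = (j : ℕ) := by omega
        -- Both images agree with $\bar D^j$ up to lower order, and lower order is invisible at `mon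
        -- j`.
        refine ev0_of_mem_fineOps (k := (j : ℕ)) ?_
        have := sub_mem (hQ.normalized j (mon 0)) (hQ'.normalized j (mon 0))
        rwa [sub_sub_sub_cancel_right] at this
    | succ d ih =>
      refine fin _ ?_ ?_
      · rw [hl, D_mon_succ, map_smul, eps_mon, ← Finsupp.smul_single, ← Finsupp.smul_single,
          ← Finsupp.smul_single, map_smul, map_smul, map_smul, map_smul, map_smul, ih]
        simp
      · intro e he
        -- As `S` vanishes at `mon d`, equivariance under $e_{1/2}$ kills a multiple of its value at
        -- `mon (d + 1)`. Here `d < j`, so non-resonance makes the multiple nonzero.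
        have hr := odd raise_mem (Finsupp.single j (mon d))
        have hne : raiseCoef (p - (j : ℕ) / 2) d ≠ 0 := by
          rcases Nat.even_or_odd' d with ⟨a, rfl | rfl⟩
          · rw [raiseCoef_even, add_comm]
            exact nonResonant j.2 (by omega)
          · rw [raiseCoef_odd]; exact one_ne_zero
        rw [ih, map_zero, symbolAction_single, density_raise_mon, symbolEps_single, map_smul,
          eps_mon, ← Finsupp.smul_single, ← Finsupp.smul_single, ← Finsupp.smul_single, map_smul,
          map_smul, map_smul, map_smul, map_smul, map_smul, smul_smul, smul_smul, eq_comm,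
          smul_eq_zero] at hr
        have h0 := hr.resolve_left (by simp [hne])
        have h1 : S (Finsupp.single j (mon (d + 1))) = 0 := by
          have h2 : eps * (eps * S (Finsupp.single j (mon (d + 1))) * eps) * eps = 0 := by
            change eps * epsHom _ * eps = 0
            rw [h0]; simp
          rwa [mul_assoc eps (S _) eps, ← mul_assoc eps eps, eps_mul_eps, one_mul, mul_assoc,
            eps_mul_eps, mul_one] at h2
        rw [h1]; simp
  have hzero : S = 0 := by
    refine Finsupp.lhom_ext' fun j => linearMap_ext_mon fun d => ?_
    simpa using key j d
  refine LinearEquiv.ext fun w => Subtype.ext ?_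
  have := LinearMap.congr_fun hzero w
  rw [hSapp] at this
  exact sub_eq_zero.1 this

end SuperLine
end

noncomputable section

namespace SuperLine

/-! ## Existence of the conformal quantization -/

theorem orderCoef_zero (lam : ℂ) : orderCoef lam 0 = 0 := by simp [orderCoef]

/-- This drives the two inductions that follow: moving $\pi(e_{1/2})$ past one more $D$ or $\bar D$
reverses the sign of what was collected and contributes $2\lambda+k$. -/
theorem orderCoef_succ (lam : ℂ) (k : ℕ) :
    orderCoef lam (k + 1) = 2 * lam + k - orderCoef lam k := by
  rcases Nat.even_or_odd' k with ⟨a, rfl | rfl⟩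
  · rw [orderCoef_odd, orderCoef_even]; push_cast; ring
  · rw [show 2 * a + 1 + 1 = 2 * (a + 1) by ring, orderCoef_even, orderCoef_odd]; push_cast; ring

theorem orderCoef_ne_zero {p : ℂ} {j : ℕ} (hj : j ∈ nonResonantIdx p) {l : ℕ} (hl : l < j) :
    orderCoef (p - j / 2) (l + 1) ≠ 0 := by
  rcases Nat.even_or_odd' l with ⟨a, rfl | rfl⟩
  · rw [orderCoef_odd]; exact nonResonant hj (by omega)
  · rw [show 2 * a + 1 + 1 = 2 * (a + 1) by ring, orderCoef_even]
    exact_mod_cast Nat.succ_ne_zero a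

theorem D_mul_raise (t : ℂ) :
    D * density t (oddField Polynomial.X)
      = density (t + 1 / 2) (oddField Polynomial.X) * D + (2 * t) • eps := by
  ext1 u
  ext1
  · simp [fst_oddField, snd_oddField, Polynomial.smul_eq_C_mul]
  · simp [fst_oddField, snd_oddField, Polynomial.smul_eq_C_mul, mul_add]
    ring

/-- At `l = 0` the exponent `l - 1` is truncated, harmlessly, since the coefficient `orderCoef t 0`
is zero. -/
theorem D_pow_mul_raise (t : ℂ) (l : ℕ) :
    D ^ l * density t (oddField Polynomial.X)
      = density (t + l / 2) (oddField Polynomial.X) * D ^ l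
        + orderCoef t l • (eps * D ^ (l - 1)) := by
  induction l with
  | zero => simp [orderCoef_zero]
  | succ l ih =>
    have h1 : orderCoef t l • (D * (eps * D ^ (l - 1))) = -(orderCoef t l • (eps * D ^ l)) := by
      rcases l with _ | l
      · simp [orderCoef_zero]
      · have h : D * eps = -(eps * D) := by rw [eps_mul_D, neg_neg]
        rw [← mul_assoc, h, Nat.add_sub_cancel, pow_succ', ← mul_assoc]
        ext1 u; simp
    have h2 : t + ((l + 1 : ℕ) : ℂ) / 2 = t + l / 2 + 1 / 2 := by push_cast; ring
    rw [pow_succ', mul_assoc, ih, mul_add, ← mul_assoc, D_mul_raise, mul_smul_comm, h1,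
      orderCoef_succ, h2, Nat.add_sub_cancel, add_mul, mul_assoc _ D, smul_mul_assoc, add_assoc,
      mul_add 2 t, show 2 * ((l : ℂ) / 2) = l by ring]
    module

theorem raise_comm_Dbar_pow (lam : ℂ) (k : ℕ) :
    density lam (oddField Polynomial.X) * Dbar ^ k
        - (-1 : ℂ) ^ k • (Dbar ^ k * density lam (oddField Polynomial.X))
      = orderCoef lam k • Dbar ^ (k - 1) - (k : ℂ) • (mulOp xi * Dbar ^ k) := by
  induction k with
  | zero => simp [orderCoef_zero]
  | succ k ih =>
    have h0 : density lam (oddField Polynomial.X) * Dbar + Dbar * density lam (oddField Polynomial.X)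
        = (2 * lam) • (1 : Op) - mulOp xi * Dbar := by
      ext1 u
      ext1
      · simp [fst_oddField, snd_oddField, Polynomial.smul_eq_C_mul]
      · simp [fst_oddField, snd_oddField, Polynomial.smul_eq_C_mul]
        ring
    have h1 : orderCoef lam k • (Dbar * Dbar ^ (k - 1)) = orderCoef lam k • Dbar ^ k := by
      rcases k with _ | k
      · simp [orderCoef_zero]
      · rw [← pow_succ', Nat.add_sub_cancel]
    have h2 : Dbar * mulOp xi = 1 - mulOp xi * Dbar := by
      ext1 u
      ext1 <;> simp
    have h3 : density lam (oddField Polynomial.X) * Dbar ^ (k + 1)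
        - (-1 : ℂ) ^ (k + 1) • (Dbar ^ (k + 1) * density lam (oddField Polynomial.X))
        = (density lam (oddField Polynomial.X) * Dbar + Dbar * density lam (oddField Polynomial.X))
            * Dbar ^ k
          - Dbar * (density lam (oddField Polynomial.X) * Dbar ^ k
            - (-1 : ℂ) ^ k • (Dbar ^ k * density lam (oddField Polynomial.X))) := by
      rw [pow_succ', pow_succ, mul_sub, add_mul, mul_smul_comm, mul_neg_one]
      simp only [mul_assoc]
      module
    rw [h3, h0, ih, orderCoef_succ, Nat.add_sub_cancel, mul_sub, mul_smul_comm, mul_smul_comm, h1,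
      ← mul_assoc, h2, pow_succ']
    simp only [sub_mul, smul_mul_assoc, one_mul, mul_assoc]
    push_cast
    module

/-- By the Leibniz rule the weight $\lambda+p$ splits as $(p-k/2)+\lambda+k/2$. The part $k/2$ gives
multiplication by $k\xi$, which cancels the term $-k\xi\bar D^k$ of the commutator with $\bar D^k$.
So the coefficient of $\bar D^k$ transforms as a density of weight $p-k/2$, up to an error one order
lower. -/
theorem sigma_raise_mulOp (lam p : ℂ) (G : SPoly) (k : ℕ) :
    sigma lam p (oddField Polynomial.X) (mulOp G * Dbar ^ k)
      = mulOp (density (p - k / 2) (oddField Polynomial.X) G) * Dbar ^ k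
        + orderCoef lam k • (mulOp (eps G) * Dbar ^ (k - 1)) := by
  have h1 : density (lam + p) (oddField Polynomial.X) * mulOp G
      = mulOp (density (p - k / 2) (oddField Polynomial.X) G)
        + mulOp (eps G) * density lam (oddField Polynomial.X)
        + (k : ℂ) • (mulOp (eps G) * mulOp xi) := by
    ext1 u
    ext1
    · simp [fst_oddField]
      ring
    · have h : Polynomial.C 2 * Polynomial.C (k / 2 : ℂ) = (k : Polynomial ℂ) := by
        rw [← Polynomial.C_mul, mul_div_cancel₀ _ two_ne_zero, map_natCast]
      simp [fst_oddField, snd_oddField, Polynomial.smul_eq_C_mul, mul_sub]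
      linear_combination (u.fst * G.fst) * h
  have h2 := raise_comm_Dbar_pow lam k
  rw [sub_eq_iff_eq_add] at h2
  rw [sigma_oddField, eps_conj, ← mul_assoc, h1, add_mul, add_mul, smul_mul_assoc, mul_assoc,
    mul_assoc (mulOp (eps G)), h2, smul_mul_assoc, mul_assoc (mulOp (eps G))]
  simp only [mul_add, mul_sub, mul_smul_comm]
  module

theorem D_pow_eps (l : ℕ) (G : SPoly) : (D ^ l) (eps G) = (-1 : ℂ) ^ l • eps ((D ^ l) G) := by
  induction l with
  | zero => simp
  | succ l ih =>
    have h := LinearMap.congr_fun eps_mul_D ((D ^ l) G)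
    simp only [Module.End.mul_apply, LinearMap.neg_apply] at h
    rw [pow_succ', Module.End.mul_apply, ih, map_smul, Module.End.mul_apply, h, pow_succ, mul_smul]
    simp

/-- The coefficients of the conformal quantization of `ω^{p-j/2} G`. -/
def quantCoef (lam p : ℂ) (j l : ℕ) : ℂ :=
  ∏ i ∈ Finset.range l, orderCoef lam (j - i) / orderCoef (p - j / 2) (i + 1)

/-- The map `G ↦ ω^p G D̄ ^ k`. -/
def symbolOp (k : ℕ) : SPoly →ₗ[ℂ] Op where
  toFun G := mulOp G * Dbar ^ k
  map_add' F G := by rw [← add_mul]; congr 1; ext1 u; simp [add_mul]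
  map_smul' c G := by
    rw [RingHom.id_apply, ← smul_mul_assoc]; congr 1; ext1 u; simp

theorem symbolOp_apply (k : ℕ) (G : SPoly) : symbolOp k G = mulOp G * Dbar ^ k := rfl

theorem symbolOp_mem {I : Set ℕ} {k : ℕ} (hk : k ∈ I) (G : SPoly) : symbolOp k G ∈ fineOps I :=
  Submodule.subset_span ⟨k, hk, G, rfl⟩

/-- The conformal quantization on the summand `𝔽(p - j/2)`. -/
def quantOp (lam p : ℂ) (j : ℕ) : SPoly →ₗ[ℂ] Op :=
  ∑ l ∈ Finset.range (j + 1), quantCoef lam p j l • (symbolOp (j - l) ∘ₗ D ^ l)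

theorem quantOp_apply (lam p : ℂ) (j : ℕ) (G : SPoly) : quantOp lam p j G
    = ∑ l ∈ Finset.range (j + 1), quantCoef lam p j l • symbolOp (j - l) ((D ^ l) G) := by
  simp [quantOp, LinearMap.sum_apply]

theorem quantOp_sub_mem (lam p : ℂ) (j : ℕ) (G : SPoly) :
    quantOp lam p j G - symbolOp j G ∈ fineOps {i | i < j} := by
  rw [quantOp_apply, Finset.sum_range_succ']
  simp only [quantCoef, Finset.range_zero, Finset.prod_empty, one_smul, pow_zero, Nat.sub_zero,
    Module.End.one_apply, add_sub_cancel_right]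
  refine Submodule.sum_mem _ fun l hl => Submodule.smul_mem _ _ (symbolOp_mem ?_ _)
  have := Finset.mem_range.1 hl
  simp only [Set.mem_ofPred_eq]
  omega

theorem quantOp_mem (lam : ℂ) {p : ℂ} {j : ℕ} (hj : j ∈ nonResonantIdx p) (G : SPoly) :
    quantOp lam p j G ∈ DiffOps p := by
  rw [quantOp_apply]
  exact Submodule.sum_mem _ fun l _ =>
    Submodule.smul_mem _ _ (symbolOp_mem (nonResonantIdx_of_le hj (Nat.sub_le _ _)) _)

theorem sigma_lower_quantOp (lam p : ℂ) (j : ℕ) (G : SPoly) :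
    sigma lam p (oddField 1) (quantOp lam p j G) = quantOp lam p j (D G) := by
  rw [quantOp_apply, quantOp_apply, map_sum]
  refine Finset.sum_congr rfl fun l _ => ?_
  rw [map_smul, symbolOp_apply, sigma_lower_mulOp, symbolOp_apply, ← Module.End.mul_apply D,
    ← pow_succ', pow_succ, Module.End.mul_apply]

/-- Comparing coefficients of $\bar D^{j-l-1}$ for the ansatz $\sum_l c_l D^l(G)\bar D^{j-l}$ gives
a relation between $c_{l+1}$ and $c_l$, which `quantCoef` solves; its denominators are nonzero by
non-resonance. -/
theorem sigma_raise_quantOp (lam : ℂ) {p : ℂ} {j : ℕ} (hj : j ∈ nonResonantIdx p) (G : SPoly) :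
    sigma lam p (oddField Polynomial.X) (quantOp lam p j G)
      = quantOp lam p j (density (p - j / 2) (oddField Polynomial.X) G) := by
  have hl : ∀ l ∈ Finset.range (j + 1),
      sigma lam p (oddField Polynomial.X) (quantCoef lam p j l • symbolOp (j - l) ((D ^ l) G))
      = quantCoef lam p j l • symbolOp (j - l)
          (density (p - (j - l : ℕ) / 2) (oddField Polynomial.X) ((D ^ l) G))
        + (quantCoef lam p j l * orderCoef lam (j - l)) • symbolOp (j - l - 1) (eps ((D ^ l) G)) :=
    fun l _ => by
      rw [map_smul, symbolOp_apply, sigma_raise_mulOp, smul_add, smul_smul]; rfl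
  have hr : ∀ l ∈ Finset.range (j + 1),
      quantCoef lam p j l • symbolOp (j - l)
        ((D ^ l) (density (p - j / 2) (oddField Polynomial.X) G))
      = quantCoef lam p j l • symbolOp (j - l)
          (density (p - (j - l : ℕ) / 2) (oddField Polynomial.X) ((D ^ l) G))
        + (quantCoef lam p j l * orderCoef (p - j / 2) l)
          • symbolOp (j - l) (eps ((D ^ (l - 1)) G)) := fun l hl => by
      have h := LinearMap.congr_fun (D_pow_mul_raise (p - j / 2) l) G
      simp only [Module.End.mul_apply, LinearMap.add_apply, LinearMap.smul_apply] at h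
      rw [h, map_add, map_smul, smul_add, smul_smul,
        Nat.cast_sub (Nat.lt_succ_iff.1 (Finset.mem_range.1 hl)),
        show p - ((j : ℂ) - l) / 2 = p - j / 2 + l / 2 by ring]
  rw [quantOp_apply, quantOp_apply, map_sum, Finset.sum_congr rfl hl, Finset.sum_congr rfl hr,
    Finset.sum_add_distrib, Finset.sum_add_distrib]
  congr 1
  -- Shifting one sum by one index matches the error terms. The two unmatched ends carry `orderCoef
  -- _ 0`, which is zero.
  rw [Finset.sum_range_succ, Finset.sum_range_succ']
  simp only [Nat.sub_self, orderCoef_zero, mul_zero, zero_smul, add_zero]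
  refine Finset.sum_congr rfl fun l hl => ?_
  have h : quantCoef lam p j (l + 1) * orderCoef (p - j / 2) (l + 1)
      = quantCoef lam p j l * orderCoef lam (j - l) := by
    rw [quantCoef, Finset.prod_range_succ, ← quantCoef, mul_assoc,
      div_mul_cancel₀ _ (orderCoef_ne_zero hj (Finset.mem_range.1 hl))]
  rw [h, Nat.sub_sub, Nat.add_sub_cancel]

theorem epsHom_quantOp (lam p : ℂ) (j : ℕ) (G : SPoly) :
    epsHom (quantOp lam p j G) = (-1 : ℂ) ^ j • quantOp lam p j (eps G) := by
  rw [quantOp_apply, quantOp_apply, map_sum, Finset.smul_sum]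
  refine Finset.sum_congr rfl fun l hl => ?_
  have hl' := Nat.lt_succ_iff.1 (Finset.mem_range.1 hl)
  rw [map_smul, D_pow_eps, map_smul, smul_comm _ (quantCoef lam p j l), smul_smul ((-1 : ℂ) ^ j)]
  congr 1
  change eps * (mulOp _ * Dbar ^ _) * eps = _
  rw [eps_conj, symbolOp_apply]
  congr 1
  obtain ⟨k, rfl⟩ := Nat.exists_eq_add_of_le hl'
  rw [Nat.add_sub_cancel_left, pow_add, mul_right_comm, neg_one_pow_mul_self, one_mul]

/-- The conformal quantization as a linear map. -/
def quantMap (lam p : ℂ) : SymbolSpace p →ₗ[ℂ] DiffOps p :=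
  Finsupp.lsum ℂ fun j : SymIdx p =>
    (quantOp lam p j).codRestrict (DiffOps p) fun G => quantOp_mem lam j.2 G

theorem quantMap_single (lam p : ℂ) (j : SymIdx p) (G : SPoly) :
    (quantMap lam p (Finsupp.single j G) : Op) = quantOp lam p j G := by
  simp [quantMap]

/-! ### Bijectivity of the quantization map -/

theorem D_locally_nilpotent (G : SPoly) : ∃ N, (D ^ N) G = 0 := by
  have hG : G ∈ Submodule.span ℂ (Set.range mon) := span_mon ▸ Submodule.mem_top
  induction hG using Submodule.span_induction with
  | mem G hG =>
    obtain ⟨d, rfl⟩ := hG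
    refine ⟨d + 1, ?_⟩
    induction d with
    | zero => simpa using D_mon_zero
    | succ d ih =>
      rw [pow_succ, Module.End.mul_apply, D_mon_succ, map_smul, ih, smul_zero]
  | zero => exact ⟨0, map_zero _⟩
  | add F G _ _ hF hG =>
    obtain ⟨M, hM⟩ := hF
    obtain ⟨N, hN⟩ := hG
    refine ⟨M + N, ?_⟩
    rw [map_add, pow_add, Module.End.mul_apply, Module.End.mul_apply, hN, map_zero, add_zero,
      ← Module.End.mul_apply, ← pow_add, add_comm, pow_add, Module.End.mul_apply, hM, map_zero]
  | smul c G _ hG =>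
    obtain ⟨N, hN⟩ := hG
    exact ⟨N, by rw [map_smul, hN, smul_zero]⟩

/-- The leading coefficient of an operator is well defined: lowering replaces $G$ by $D^lG$ without
leaving the lower-order space, so all $D^lG$ have zero constant term. -/
theorem eq_zero_of_symbolOp_mem {j : ℕ} {G : SPoly} (h : symbolOp j G ∈ fineOps {i | i < j}) :
    G = 0 := by
  -- The parameters $\lambda=p=0$ are arbitrary, as the lowering formula does not involve them.
  have lower : ∀ T ∈ fineOps {i | i < j}, sigma 0 0 (oddField 1) T ∈ fineOps {i | i < j} := by
    intro T hT
    induction hT using Submodule.span_induction with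
    | mem T hT =>
      obtain ⟨k, hk, H, rfl⟩ := hT
      rw [sigma_lower_mulOp]
      exact symbolOp_mem hk _
    | zero => simp
    | add S T _ _ hS hT => rw [map_add]; exact add_mem hS hT
    | smul c T _ hT => rw [map_smul]; exact Submodule.smul_mem _ _ hT
  have mem : ∀ l, symbolOp j ((D ^ l) G) ∈ fineOps {i | i < j} := by
    intro l
    induction l with
    | zero => simpa using h
    | succ l ih =>
      have := lower _ ih
      rwa [symbolOp_apply, sigma_lower_mulOp, ← Module.End.mul_apply, ← pow_succ'] at this
  have hev : ∀ l, ev0 ((D ^ l) G) = 0 := by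
    intro l
    have := ev0_of_mem_fineOps (mem l)
    rw [symbolOp_apply, ev0_mulOp_Dbar_pow, if_pos rfl] at this
    exact (mul_eq_zero.1 this).resolve_left (diagCoef_ne_zero j)
  obtain ⟨N, hN⟩ := D_locally_nilpotent G
  induction N with
  | zero => simpa using hN
  | succ N ih =>
    refine ih ?_
    rw [pow_succ', Module.End.mul_apply] at hN
    rw [eq_smul_mon_zero hN, hev, zero_smul]

theorem coe_quantMap (lam p : ℂ) (w : SymbolSpace p) :
    (quantMap lam p w : Op) = ∑ k ∈ w.support, quantOp lam p k (w k) := by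
  have h : (DiffOps p).subtype ∘ₗ quantMap lam p
      = Finsupp.lsum ℂ fun j : SymIdx p => quantOp lam p j := by
    refine Finsupp.lhom_ext fun j G => ?_
    rw [LinearMap.comp_apply, Submodule.subtype_apply, quantMap_single]
    simp
  exact LinearMap.congr_fun h w

/-- The quantization is unitriangular in the order. If $w\ne0$, the component of largest order in
the finite support would have vanishing leading coefficient. -/
theorem eq_zero_of_quantMap_eq_zero {lam p : ℂ} {w : SymbolSpace p}
    (hw : (quantMap lam p w : Op) = 0) : w = 0 := by
  by_contra hne
  obtain ⟨j, hjw, hmax⟩ := w.support.exists_max_image (fun k => (k : ℕ))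
    (Finsupp.support_nonempty_iff.2 hne)
  refine Finsupp.mem_support_iff.1 hjw (eq_zero_of_symbolOp_mem (j := (j : ℕ)) ?_)
  have hrest : ∑ k ∈ w.support.erase j, quantOp lam p k (w k) ∈ fineOps {i | i < (j : ℕ)} := by
    refine Submodule.sum_mem _ fun k hk => ?_
    have hk' := Finset.mem_erase.1 hk
    have hlt : (k : ℕ) < (j : ℕ) :=
      lt_of_le_of_ne (hmax k hk'.2) fun h => hk'.1 (Subtype.ext h)
    rw [quantOp_apply]
    refine Submodule.sum_mem _ fun l _ => Submodule.smul_mem _ _ (symbolOp_mem ?_ _)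
    rw [Set.mem_ofPred_eq]
    omega
  have h1 := quantOp_sub_mem lam p j (w j)
  have h := sub_mem (zero_mem (fineOps {i | i < (j : ℕ)})) (add_mem h1 hrest)
  have h0 : quantOp lam p j (w j) + ∑ k ∈ w.support.erase j, quantOp lam p k (w k) = 0 := by
    rw [← hw, coe_quantMap]
    exact Finset.add_sum_erase w.support (fun k => quantOp lam p k (w k)) hjw
  rwa [sub_add_eq_add_sub, h0, zero_sub, zero_sub, neg_neg] at h

theorem quantMap_injective (lam p : ℂ) : Function.Injective (quantMap lam p) := by
  intro v w h
  refine sub_eq_zero.1 (eq_zero_of_quantMap_eq_zero (lam := lam) ?_)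
  have h1 := map_sub ((DiffOps p).subtype ∘ₗ quantMap lam p) v w
  simp only [LinearMap.comp_apply, h, sub_self] at h1
  exact h1

theorem quantMap_surjective (lam p : ℂ) : Function.Surjective (quantMap lam p) := by
  set R : Submodule ℂ Op := LinearMap.range ((DiffOps p).subtype ∘ₗ quantMap lam p) with hR
  have key : ∀ j ∈ nonResonantIdx p, ∀ G, symbolOp j G ∈ R := by
    intro j
    induction j using Nat.strong_induction_on with
    | _ j ih =>
      intro hj G
      have h1 : quantOp lam p j G ∈ R :=
        ⟨Finsupp.single ⟨j, hj⟩ G, quantMap_single lam p ⟨j, hj⟩ G⟩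
      have h2 : fineOps {i | i < j} ≤ R := by
        refine Submodule.span_le.2 ?_
        rintro _ ⟨i, hi, H, rfl⟩
        exact ih i hi (nonResonantIdx_of_le hj (le_of_lt hi)) H
      have := sub_mem h1 (h2 (quantOp_sub_mem lam p j G))
      rwa [sub_sub_cancel] at this
  have hle : DiffOps p ≤ R := by
    refine Submodule.span_le.2 ?_
    rintro _ ⟨i, hi, H, rfl⟩
    exact key i hi H
  rintro ⟨T, hT⟩
  obtain ⟨w, hw⟩ := hle hT
  exact ⟨w, Subtype.ext hw⟩

/-- The conformal quantization. -/
def quantEquiv (lam p : ℂ) : SymbolSpace p ≃ₗ[ℂ] DiffOps p :=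
  LinearEquiv.ofBijective (quantMap lam p) ⟨quantMap_injective lam p, quantMap_surjective lam p⟩

theorem quantEquiv_apply (lam p : ℂ) (w : SymbolSpace p) :
    quantEquiv lam p w = quantMap lam p w := rfl

/-! ### Equivariance of the quantization map -/

theorem quantEquiv_lower (lam p : ℂ) (w : SymbolSpace p) :
    sigma lam p (oddField 1) (quantEquiv lam p w)
      = quantEquiv lam p (symbolAction p (oddField 1) w) := by
  rw [quantEquiv_apply, quantEquiv_apply]
  induction w using Finsupp.induction_linear with
  | zero => simp
  | add v w hv hw => 
    rw [map_add, map_add, map_add, Submodule.coe_add, Submodule.coe_add, map_add, hv, hw]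
  | single j G =>
    rw [symbolAction_single, quantMap_single, quantMap_single, sigma_lower_quantOp, density_lower]

theorem quantEquiv_raise (lam p : ℂ) (w : SymbolSpace p) :
    sigma lam p (oddField Polynomial.X) (quantEquiv lam p w)
      = quantEquiv lam p (symbolAction p (oddField Polynomial.X) w) := by
  rw [quantEquiv_apply, quantEquiv_apply]
  induction w using Finsupp.induction_linear with
  | zero => simp
  | add v w hv hw => 
    rw [map_add, map_add, map_add, Submodule.coe_add, Submodule.coe_add, map_add, hv, hw]
  | single j G =>
    rw [symbolAction_single, quantMap_single, quantMap_single, sigma_raise_quantOp _ j.2]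

theorem symbolAction_oddField_anticomm (p : ℂ) (f g : Polynomial ℂ) (w : SymbolSpace p) :
    symbolAction p (oddField f) (symbolAction p (oddField g) w)
      + symbolAction p (oddField g) (symbolAction p (oddField f) w)
      = (2 : ℂ) • symbolAction p (evenField (f * g)) w := by
  refine Finsupp.ext fun k => ?_
  have h := LinearMap.congr_fun (oddField_anticomm (p - (k : ℕ) / 2) f g) (w k)
  simpa [symbolAction_apply] using h

theorem quantEquiv_even (lam p : ℂ) {f g : Polynomial ℂ}
    (hf : ∀ w, sigma lam p (oddField f) (quantEquiv lam p w)
      = quantEquiv lam p (symbolAction p (oddField f) w))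
    (hg : ∀ w, sigma lam p (oddField g) (quantEquiv lam p w)
      = quantEquiv lam p (symbolAction p (oddField g) w)) (w : SymbolSpace p) :
    sigma lam p (evenField (f * g)) (quantEquiv lam p w)
      = quantEquiv lam p (symbolAction p (evenField (f * g)) w) := by
  have h1 := LinearMap.congr_fun (sigma_oddField_anticomm lam p f g) (quantEquiv lam p w)
  have h2 := congrArg (fun v => (quantEquiv lam p v : Op)) (symbolAction_oddField_anticomm p f g w)
  simp only [LinearMap.add_apply, Module.End.mul_apply, LinearMap.smul_apply, hf, hg, map_add,
    map_smul, Submodule.coe_add, Submodule.coe_smul] at h1 h2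
  exact smul_right_injective _ (two_ne_zero' ℂ) (h1.symm.trans h2)

/-- Up to the factor 2, the even generators $e_{-1},e_0,e_1$ are the anticommutators of
$e_{\pm1/2}$, corresponding to $1=1\cdot1$, $x=1\cdot x$ and $x^2=x\cdot x$. -/
theorem quantEquiv_intertwines (lam p : ℂ) {Z : contactAlgebra} (hZ : Z ∈ conformalAlgebra)
    (w : SymbolSpace p) :
    sigma lam p Z (quantEquiv lam p w) = quantEquiv lam p (symbolAction p Z w) := by
  induction hZ using Submodule.span_induction with
  | mem Z hZ =>
    obtain ⟨a, ha, rfl⟩ := hZ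
    interval_cases a
    · have := quantEquiv_even lam p (quantEquiv_lower lam p) (quantEquiv_lower lam p) w
      rw [mul_one] at this
      rwa [show virasoro 0 = evenField 1 by simpa using virasoro_even 0]
    · rw [virasoro_one, quantEquiv_lower]
    · have := quantEquiv_even lam p (quantEquiv_lower lam p) (quantEquiv_raise lam p) w
      rw [one_mul] at this
      rwa [virasoro_two]
    · rw [virasoro_three, quantEquiv_raise]
    · have := quantEquiv_even lam p (quantEquiv_raise lam p) (quantEquiv_raise lam p) w
      rw [← pow_two] at this
      rwa [show virasoro 4 = evenField (Polynomial.X ^ 2) from virasoro_even 2]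
  | zero =>
    have h1 : sigma lam p 0 = 0 := by simpa using sigma_smul lam p 0 0
    have h2 : symbolAction p 0 = 0 := by simpa using symbolAction_smul p 0 0
    simp [h1, h2]
  | add Y Z _ _ hY hZ =>
    rw [sigma_add, symbolAction_add, LinearMap.add_apply, hY, hZ, LinearMap.add_apply, map_add,
      Submodule.coe_add]
  | smul c Z _ hZ =>
    rw [sigma_smul, symbolAction_smul, LinearMap.smul_apply, hZ, LinearMap.smul_apply, map_smul,
      Submodule.coe_smul]

theorem quantEquiv_even_map (lam p : ℂ) :
    diffEps p ∘ₗ (quantEquiv lam p).toLinearMap ∘ₗ symbolEps p = (quantEquiv lam p).toLinearMap := by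
  refine LinearMap.ext fun w => Subtype.ext ?_
  change epsHom (quantMap lam p (symbolEps p w)) = quantMap lam p w
  induction w using Finsupp.induction_linear with
  | zero => simp
  | add v w hv hw => 
    rw [map_add, map_add, map_add, Submodule.coe_add, Submodule.coe_add, map_add, hv, hw]
  | single j G =>
    have h : eps (eps G) = G := LinearMap.congr_fun eps_mul_eps G
    rw [symbolEps_single, quantMap_single, quantMap_single, epsHom_quantOp, map_smul, map_smul, h,
      smul_smul, neg_one_pow_mul_self, one_smul]

theorem quantEquiv_isConformalQuantization (lam p : ℂ) :
    IsConformalQuantization lam p (quantEquiv lam p) where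
  invariant Z hZ := by
    rw [homAction_even_map _ _ _ _ _ (quantEquiv_even_map lam p)]
    refine LinearMap.ext fun w => Subtype.ext ?_
    exact sub_eq_zero.2 (quantEquiv_intertwines lam p hZ w)
  normalized j G := by
    rw [quantEquiv_apply, quantMap_single]
    exact quantOp_sub_mem lam p j G

theorem quantEquiv_single_mon_zero (lam p : ℂ) (j : SymIdx p) :
    (quantEquiv lam p (Finsupp.single j (mon 0)) : Op) = Dbar ^ (j : ℕ) := by
  rw [quantEquiv_apply, quantMap_single, quantOp_apply, Finset.sum_range_succ']
  have h : ∀ l, (D ^ (l + 1)) (mon 0) = 0 := fun l => by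
    rw [pow_succ, Module.End.mul_apply, D_mon_zero, map_zero]
  simp only [h, map_zero, smul_zero, Finset.sum_const_zero, zero_add]
  simp [quantCoef, symbolOp_apply, mulOp_mon_zero]

end SuperLine
end

noncomputable section

namespace SuperLine

/-! ## Matrix entries of the action on symbols -/

theorem quantEquiv_symbolRep (lam p : ℂ) (Z : contactAlgebra) (w : SymbolSpace p) :
    (quantEquiv lam p (symbolRep lam p (quantEquiv lam p) Z w) : Op)
      = sigma lam p Z (quantEquiv lam p w) := by
  change (quantEquiv lam p ((quantEquiv lam p).symm _) : Op) = _
  rw [LinearEquiv.apply_symm_apply]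
  rfl

theorem quantEquiv_ext {lam p : ℂ} {v w : SymbolSpace p}
    (h : (quantEquiv lam p v : Op) = quantEquiv lam p w) : v = w :=
  (quantEquiv lam p).injective (Subtype.ext h)

theorem symbolRep_of_mem (lam p : ℂ) {Z : contactAlgebra} (hZ : Z ∈ conformalAlgebra)
    (w : SymbolSpace p) :
    symbolRep lam p (quantEquiv lam p) Z w = symbolAction p Z w :=
  quantEquiv_ext (by rw [quantEquiv_symbolRep, quantEquiv_intertwines _ _ hZ])

theorem symbolRep_add (lam p : ℂ) (Y Z : contactAlgebra) (w : SymbolSpace p) :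
    symbolRep lam p (quantEquiv lam p) (Y + Z) w
      = symbolRep lam p (quantEquiv lam p) Y w + symbolRep lam p (quantEquiv lam p) Z w :=
  quantEquiv_ext (by
    rw [map_add, Submodule.coe_add, quantEquiv_symbolRep, quantEquiv_symbolRep,
      quantEquiv_symbolRep, sigma_add, LinearMap.add_apply])

theorem symbolRep_smul (lam p c : ℂ) (Z : contactAlgebra) (w : SymbolSpace p) :
    symbolRep lam p (quantEquiv lam p) (c • Z) w = c • symbolRep lam p (quantEquiv lam p) Z w :=
  quantEquiv_ext (by
    rw [map_smul, Submodule.coe_smul, quantEquiv_symbolRep, quantEquiv_symbolRep, sigma_smul,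
      LinearMap.smul_apply])

theorem symbolRep_oddField_anticomm (lam p : ℂ) (f g : Polynomial ℂ) (w : SymbolSpace p) :
    symbolRep lam p (quantEquiv lam p) (oddField f)
        (symbolRep lam p (quantEquiv lam p) (oddField g) w)
      + symbolRep lam p (quantEquiv lam p) (oddField g)
        (symbolRep lam p (quantEquiv lam p) (oddField f) w)
      = (2 : ℂ) • symbolRep lam p (quantEquiv lam p) (evenField (f * g)) w :=
  quantEquiv_ext (by
    have h := LinearMap.congr_fun (sigma_oddField_anticomm lam p f g) (quantEquiv lam p w)
    simp only [LinearMap.add_apply, Module.End.mul_apply, LinearMap.smul_apply] at h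
    rw [map_add, Submodule.coe_add, map_smul, Submodule.coe_smul]
    rw [quantEquiv_symbolRep, quantEquiv_symbolRep, quantEquiv_symbolRep, quantEquiv_symbolRep,
      quantEquiv_symbolRep]
    exact h)

theorem symbolRep_oddField_evenField_comm (lam p : ℂ) (f g : Polynomial ℂ) (w : SymbolSpace p) :
    symbolRep lam p (quantEquiv lam p) (oddField g)
        (symbolRep lam p (quantEquiv lam p) (evenField f) w)
      = symbolRep lam p (quantEquiv lam p) (evenField f)
          (symbolRep lam p (quantEquiv lam p) (oddField g) w)
        + symbolRep lam p (quantEquiv lam p) (oddField ((1 / 2 : ℂ) • (Polynomial.derivative f * g)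
          - f * Polynomial.derivative g)) w :=
  quantEquiv_ext (by
    have h := LinearMap.congr_fun (sigma_oddField_evenField_comm lam p f g) (quantEquiv lam p w)
    simp only [LinearMap.sub_apply, Module.End.mul_apply] at h
    rw [map_add, Submodule.coe_add]
    rw [quantEquiv_symbolRep, quantEquiv_symbolRep, quantEquiv_symbolRep, quantEquiv_symbolRep,
      quantEquiv_symbolRep, ← h, add_sub_cancel])

/-- The matrix entry `π_{rs}(λ, p)` for the conformal quantization. -/
def entry (lam p : ℂ) (i j : SymIdx p) (Z : contactAlgebra) : Op :=
  matrixEntry lam p (quantEquiv lam p) i j Z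

theorem entry_apply (lam p : ℂ) (i j : SymIdx p) (Z : contactAlgebra) (G : SPoly) :
    entry lam p i j Z G = symbolRep lam p (quantEquiv lam p) Z (Finsupp.single j G) i := rfl

theorem entry_add (lam p : ℂ) (i j : SymIdx p) (Y Z : contactAlgebra) :
    entry lam p i j (Y + Z) = entry lam p i j Y + entry lam p i j Z :=
  LinearMap.ext fun G => by
    rw [LinearMap.add_apply, entry_apply, entry_apply, entry_apply, symbolRep_add,
      Finsupp.add_apply]

theorem entry_smul (lam p : ℂ) (i j : SymIdx p) (c : ℂ) (Z : contactAlgebra) :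
    entry lam p i j (c • Z) = c • entry lam p i j Z :=
  LinearMap.ext fun G => by
    rw [LinearMap.smul_apply, entry_apply, entry_apply, symbolRep_smul, Finsupp.smul_apply]

theorem entry_of_mem (lam p : ℂ) {i j : SymIdx p} (hij : i ≠ j) {Z : contactAlgebra}
    (hZ : Z ∈ conformalAlgebra) : entry lam p i j Z = 0 :=
  LinearMap.ext fun G => by
    rw [entry_apply, symbolRep_of_mem _ _ hZ, symbolAction_single, Finsupp.single_eq_of_ne hij]
    rfl

/-- Elements of $\mathfrak s$ act diagonally on symbols, so this component of a bracket relation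
with one argument in $\mathfrak s$ involves no other off-diagonal entry. The same holds for the next
two relations. -/
theorem entry_anticomm (lam p : ℂ) (i j : SymIdx p) {f : Polynomial ℂ}
    (hf : oddField f ∈ conformalAlgebra) (g : Polynomial ℂ) :
    density (p - (i : ℕ) / 2) (oddField f) * entry lam p i j (oddField g)
      + entry lam p i j (oddField g) * density (p - (j : ℕ) / 2) (oddField f)
      = (2 : ℂ) • entry lam p i j (evenField (f * g)) :=
  LinearMap.ext fun G => by
    have h := DFunLike.congr_fun (symbolRep_oddField_anticomm lam p f g (Finsupp.single j G)) i
    rw [symbolRep_of_mem _ _ hf, symbolRep_of_mem _ _ hf, symbolAction_single, Finsupp.add_apply,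
      symbolAction_apply, Finsupp.smul_apply] at h
    exact h

theorem entry_comm (lam p : ℂ) (i j : SymIdx p) {g : Polynomial ℂ}
    (hg : oddField g ∈ conformalAlgebra) (f : Polynomial ℂ) :
    density (p - (i : ℕ) / 2) (oddField g) * entry lam p i j (evenField f)
      = entry lam p i j (evenField f) * density (p - (j : ℕ) / 2) (oddField g)
        + entry lam p i j (oddField ((1 / 2 : ℂ) • (Polynomial.derivative f * g)
          - f * Polynomial.derivative g)) :=
  LinearMap.ext fun G => by
    have h := DFunLike.congr_fun
      (symbolRep_oddField_evenField_comm lam p f g (Finsupp.single j G)) i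
    rw [symbolRep_of_mem _ _ hg, symbolRep_of_mem _ _ hg, symbolAction_single, Finsupp.add_apply,
      symbolAction_apply] at h
    exact h

theorem entry_weight (lam p : ℂ) (i j : SymIdx p) {f : Polynomial ℂ}
    (hf : evenField f ∈ conformalAlgebra) (g : Polynomial ℂ) :
    entry lam p i j (oddField g) * density (p - (j : ℕ) / 2) (evenField f)
      = density (p - (i : ℕ) / 2) (evenField f) * entry lam p i j (oddField g)
        + entry lam p i j (oddField ((1 / 2 : ℂ) • (Polynomial.derivative f * g)
          - f * Polynomial.derivative g)) :=
  LinearMap.ext fun G => by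
    have h := DFunLike.congr_fun
      (symbolRep_oddField_evenField_comm lam p f g (Finsupp.single j G)) i
    rw [symbolRep_of_mem _ _ hf, symbolRep_of_mem _ _ hf, symbolAction_single, Finsupp.add_apply,
      symbolAction_apply] at h
    exact h

theorem eps_pow_mul_D (n : ℕ) : eps ^ n * D = (-1 : ℂ) ^ n • (D * eps ^ n) := by
  induction n with
  | zero => simp
  | succ n ih =>
    rw [pow_succ, mul_assoc, eps_mul_D, pow_succ, mul_smul]
    refine LinearMap.ext fun u => ?_
    have h := LinearMap.congr_fun ih (eps u)
    simp only [Module.End.mul_apply, LinearMap.smul_apply] at h ⊢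
    simp [h]

theorem eps_pow_mul_raise (n : ℕ) (t : ℂ) :
    eps ^ n * density t (oddField Polynomial.X)
      = (-1 : ℂ) ^ n • (density t (oddField Polynomial.X) * eps ^ n) := by
  induction n with
  | zero => simp
  | succ n ih =>
    rw [pow_succ, mul_assoc, eps_mul_oddField, pow_succ, mul_smul]
    refine LinearMap.ext fun u => ?_
    have h := LinearMap.congr_fun ih (eps u)
    simp only [Module.End.mul_apply, LinearMap.smul_apply] at h ⊢
    simp [h]

theorem ev0_eps_pow (n : ℕ) (F : SPoly) : ev0 ((eps ^ n) F) = ev0 F := by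
  induction n with
  | zero => rfl
  | succ n ih => rw [pow_succ', Module.End.mul_apply, ev0_eps, ih]

/-- The matrix entry at `e_{3/2}` is a multiple of `ε^n D̄^{n-3}`. -/
theorem entry_lowest (lam p : ℂ) {i j : SymIdx p} {n : ℕ} (hn : 3 ≤ n)
    (hij : (j : ℕ) = (i : ℕ) + n) :
    ∃ b : ℂ, entry lam p i j (oddField (Polynomial.X ^ 2))
      = b • (eps ^ n * ((4 : ℂ) • Dbar ^ (n - 3))) := by
  have hne : i ≠ j := fun h => by subst h; omega
  set W := entry lam p i j (oddField (Polynomial.X ^ 2)) with hW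
  -- The bracket of $e_{-1/2}$ and $e_{3/2}$ is a multiple of $e_1\in\mathfrak s$, where an
  -- off-diagonal entry vanishes.
  have hD : ∀ F, D (W F) = -W (D F) := fun F => by
    have h := entry_anticomm lam p i j lower_mem (Polynomial.X ^ 2)
    have h0 : evenField (Polynomial.X ^ 2) ∈ conformalAlgebra := by
      rw [← virasoro_even]; exact virasoro_mem (by norm_num)
    rw [one_mul, entry_of_mem lam p hne h0, smul_zero, density_lower, density_lower] at h
    exact eq_neg_of_add_eq_zero_left (LinearMap.congr_fun h F)
  -- The entry at $e_{3/2}$ raises weights by $3/2$. It can send `mon d`, of weight $s+d/2$, to a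
  -- nonzero constant, of weight $s+n/2$, only if $d=n-3$.
  have hwt : ∀ d : ℕ, d ≠ n - 3 → ev0 (W (mon d)) = 0 := fun d hd => by
    have h := entry_weight lam p i j weight_mem (Polynomial.X ^ 2)
    have h1 : (1 / 2 : ℂ) • (Polynomial.derivative Polynomial.X * Polynomial.X ^ 2)
        - Polynomial.X * Polynomial.derivative (Polynomial.X ^ 2)
        = (-3 / 2 : ℂ) • (Polynomial.X ^ 2 : Polynomial ℂ) := by
      rw [Polynomial.derivative_X, Polynomial.derivative_X_sq, one_mul, mul_left_comm, ← pow_two,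
        ← Polynomial.smul_eq_C_mul]
      module
    rw [h1, oddField_smul, entry_smul, ← hW] at h
    have h2 := congrArg ev0 (LinearMap.congr_fun h (mon d))
    simp only [LinearMap.add_apply, Module.End.mul_apply, density_weight_mon, map_smul, map_add,
      ev0_weight, LinearMap.smul_apply, smul_eq_mul, hij] at h2
    have h3 : ((d : ℂ) + 3 - n) * ev0 (W (mon d)) = 0 := by
      push_cast at h2
      linear_combination 2 * h2
    refine (mul_eq_zero.1 h3).resolve_left fun h4 => hd ?_
    have h5 : ((d + 3 : ℕ) : ℂ) = n := by push_cast; linear_combination h4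
    have h6 : d + 3 = n := by exact_mod_cast h5
    omega
  set T : Op := eps ^ n * ((4 : ℂ) • Dbar ^ (n - 3)) with hT
  -- The factors $\epsilon^n$ and $\bar D^{n-3}$ each contribute signs, in all $(-1)^{2n-3}=-1$: the
  -- candidate anticommutes with $D$ just as the entry does.
  have hTD : ∀ F, D (T F) = -T (D F) := fun F => by
    have h1 := LinearMap.congr_fun (eps_pow_mul_D n) ((Dbar ^ (n - 3)) F)
    have h2 := LinearMap.congr_fun (D_mul_Dbar_pow (n - 3)) F
    simp only [Module.End.mul_apply, LinearMap.smul_apply] at h1 h2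
    have h3 : (-1 : ℂ) ^ n * (-1) ^ (n - 3) = -1 := by
      obtain ⟨k, rfl⟩ := Nat.exists_eq_add_of_le hn
      rw [Nat.add_sub_cancel_left, pow_add, mul_assoc, neg_one_pow_mul_self]
      norm_num
    rw [h2, map_smul] at h1
    have h4 : D ((eps ^ n) ((Dbar ^ (n - 3)) F))
        = ((-1 : ℂ) ^ n * (-1) ^ (n - 3)) • (eps ^ n) ((Dbar ^ (n - 3)) (D F)) := by
      rw [mul_smul, h1, smul_smul, neg_one_pow_mul_self, one_smul]
    rw [h3] at h4
    simp only [hT, Module.End.mul_apply, LinearMap.smul_apply, map_smul, h4]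
    simp
  have hTev : ∀ d, ev0 (T (mon d)) = if d = n - 3 then 4 * diagCoef (n - 3) else 0 := fun d => by
    simp only [hT, Module.End.mul_apply, LinearMap.smul_apply, map_smul, ev0_eps_pow, ev0_Dbar_pow]
    split_ifs <;> simp
  refine ⟨ev0 (W (mon (n - 3))) / (4 * diagCoef (n - 3)), sub_eq_zero.1 (eq_zero_of_lower ?_ ?_ ?_)⟩
  · rw [LinearMap.sub_apply, map_sub, LinearMap.smul_apply, map_smul, hD, hTD, D_mon_zero]
    simp
  · intro d hd
    rw [LinearMap.sub_apply, LinearMap.smul_apply, sub_eq_zero] at hd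
    rw [LinearMap.sub_apply, map_sub, LinearMap.smul_apply, map_smul, hD, hTD, D_mon_succ, map_smul,
      map_smul, hd]
    module
  · intro d
    rw [LinearMap.sub_apply, map_sub, LinearMap.smul_apply, map_smul, hTev]
    by_cases hd : d = n - 3
    · rw [if_pos hd, hd, smul_eq_mul, div_mul_cancel₀ _
        (mul_ne_zero (by norm_num) (diagCoef_ne_zero _)), sub_self]
    · rw [if_neg hd, hwt d hd, smul_zero, sub_self]

/-! ## The cochain `β` -/

theorem eps_conj_sigma_raise (lam p : ℂ) (T : Op) :
    eps * sigma lam p (oddField Polynomial.X) T * eps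
      = -sigma lam p (oddField Polynomial.X) (eps * T * eps) := by
  rw [sigma_oddField, sigma_oddField]
  have e1 := eps_mul_oddField (lam + p) Polynomial.X
  have e2 := eps_mul_oddField lam Polynomial.X
  refine LinearMap.ext fun u => ?_
  have h1 : ∀ v, eps (density (lam + p) (oddField Polynomial.X) v)
    = -density (lam + p) (oddField Polynomial.X) (eps v) := fun v => LinearMap.congr_fun e1 v
  have h2 : ∀ v, eps (density lam (oddField Polynomial.X) v)
    = -density lam (oddField Polynomial.X) (eps v) := fun v => LinearMap.congr_fun e2 v
  have h3 : ∀ v, eps (eps v) = v := LinearMap.congr_fun eps_mul_eps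
  simp only [Module.End.mul_apply, LinearMap.sub_apply, LinearMap.neg_apply, map_sub, map_neg, h1,
    h2, h3]
  abel

theorem eps_conj_sigma_raise_pow (lam p : ℂ) (k a : ℕ) :
    eps * (sigma lam p (oddField Polynomial.X) ^ a) ((4 : ℂ) • Dbar ^ k) * eps
      = (-1 : ℂ) ^ (k + a) • (sigma lam p (oddField Polynomial.X) ^ a) ((4 : ℂ) • Dbar ^ k) := by
  induction a with
  | zero =>
    have h := eps_conj (mon 0) k
    rw [mulOp_mon_zero, one_mul, eps_mon, pow_zero, one_smul, mulOp_mon_zero, one_mul] at h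
    rw [pow_zero, Module.End.one_apply, mul_smul_comm, smul_mul_assoc, h, smul_comm, add_zero]
  | succ a ih =>
    rw [pow_succ', Module.End.mul_apply, eps_conj_sigma_raise, ih, map_smul, ← add_assoc, pow_succ]
    module

theorem virasoro_five : virasoro 5 = oddField (Polynomial.X ^ 2) := virasoro_odd 2

/-- The factor of `σ(e_{1/2})^a` in `β̄(e_{(a+3)/2})`. -/
def betaFactor (n a : ℕ) : ℂ :=
  ((2 : ℂ) ^ (a % 2))⁻¹ / ((a / 2).factorial : ℂ) * (-1) ^ (a * n)

theorem betaBarValue_add_three (n : ℕ) (lam : ℂ) (a : ℕ) :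
    betaBarValue n lam (a + 3) = betaFactor n a •
      (sigma lam (n / 2) (oddField Polynomial.X) ^ a) ((4 : ℂ) • Dbar ^ (n - 3)) := by
  have h1 : (a + 3 - 1) % 2 = a % 2 := by omega
  have h2 : (-1 : ℂ) ^ ((a + 3 - 1) * n) = (-1) ^ (a * n) := by
    rw [show (a + 3 - 1) * n = a * n + 2 * n by
      rw [show a + 3 - 1 = a + 2 by omega]; ring, pow_add, pow_mul _ 2]
    simp
  rw [betaBarValue, if_neg (by omega), h1, h2, Nat.add_sub_cancel, virasoro_three, betaFactor]

/-- The ratios here and in `betaFactor_even` are the structure constants of bracketing with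
$e_{1/2}$: from $e_{c+3/2}$ to $2e_{c+2}$, and from $e_{c+2}$ to $\tfrac{c+1}2e_{c+5/2}$. The sign
$(-1)^n$ comes from moving $\epsilon^n$ past the odd $e_{1/2}$. -/
theorem betaFactor_odd (n c : ℕ) :
    2 * betaFactor n (2 * c + 1) = (-1) ^ n * betaFactor n (2 * c) := by
  have h1 : (2 * c + 1) % 2 = 1 := by omega
  have h2 : (2 * c + 1) / 2 = c := by omega
  rw [betaFactor, betaFactor, h1, h2, Nat.mul_mod_right, Nat.mul_div_cancel_left _ two_pos, add_mul,
    pow_add, one_mul]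
  simp
  ring

theorem betaFactor_even (n c : ℕ) :
    ((c : ℂ) + 1) / 2 * betaFactor n (2 * (c + 1)) = (-1) ^ n * betaFactor n (2 * c + 1) := by
  have h1 : (2 * c + 1) % 2 = 1 := by omega
  have h2 : (2 * c + 1) / 2 = c := by omega
  have h3 : (c : ℂ) + 1 ≠ 0 := Nat.cast_add_one_ne_zero c
  have h4 : (-1 : ℂ) ^ n * (-1) ^ ((2 * c + 1) * n) = 1 := by
    rw [← pow_add, show n + (2 * c + 1) * n = 2 * ((c + 1) * n) by ring, pow_mul]; simp
  have h5 : (-1 : ℂ) ^ (2 * (c + 1) * n) = 1 := by rw [mul_assoc, pow_mul]; simp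
  have h6 : (c.factorial : ℂ) ≠ 0 := Nat.cast_ne_zero.2 (Nat.factorial_ne_zero c)
  rw [betaFactor, betaFactor, h1, h2, h5, Nat.mul_mod_right, Nat.mul_div_cancel_left _ two_pos,
    Nat.factorial_succ, show (-1 : ℂ) ^ n * ((2 ^ 1)⁻¹ / (c.factorial : ℂ) * (-1) ^ ((2 * c + 1) * n))
      = (-1 : ℂ) ^ n * (-1) ^ ((2 * c + 1) * n) * (2⁻¹ / (c.factorial : ℂ)) by ring, h4]
  push_cast
  field_simp

/-- Composition with $\epsilon^n$ turns the superbracket with $e_{1/2}$ into the anticommutator (`a`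
even) or commutator (`a` odd) in which the matrix entries satisfy their relations. -/
theorem eps_pow_mul_sigma_raise_pow (lam : ℂ) {n : ℕ} (hn : 3 ≤ n) (a : ℕ) :
    eps ^ n * (sigma lam (n / 2) (oddField Polynomial.X) ^ (a + 1)) ((4 : ℂ) • Dbar ^ (n - 3))
      = (-1 : ℂ) ^ n • (density (lam + n / 2) (oddField Polynomial.X) * (eps ^ n *
            (sigma lam (n / 2) (oddField Polynomial.X) ^ a) ((4 : ℂ) • Dbar ^ (n - 3)))
          + (-1 : ℂ) ^ a • (eps ^ n *
            (sigma lam (n / 2) (oddField Polynomial.X) ^ a) ((4 : ℂ) • Dbar ^ (n - 3))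
              * density lam (oddField Polynomial.X))) := by
  have h3 : (-1 : ℂ) ^ (n - 3 + a) = -((-1) ^ n * (-1) ^ a) := by
    obtain ⟨k, rfl⟩ := Nat.exists_eq_add_of_le hn
    rw [Nat.add_sub_cancel_left, pow_add, pow_add _ 3]
    ring
  rw [pow_succ', Module.End.mul_apply, sigma_oddField, eps_conj_sigma_raise_pow, h3, mul_sub,
    ← mul_assoc, eps_pow_mul_raise, smul_mul_assoc, smul_mul_assoc, mul_smul_comm, mul_assoc,
    ← mul_assoc (eps ^ n) _ (density lam _)]
  module

/-- Induction along $e_{3/2},e_2,e_{5/2},\dots$: for `a` even the anticommutator with $e_{1/2}$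
yields the next value, for `a` odd the commutator does, after division by the nonzero constant
$(c+1)/2$. -/
theorem entry_virasoro (lam p : ℂ) {i j : SymIdx p} {n : ℕ} (hn : 3 ≤ n)
    (hij : (j : ℕ) = (i : ℕ) + n) {b : ℂ}
    (hb : entry lam p i j (oddField (Polynomial.X ^ 2))
      = b • (eps ^ n * ((4 : ℂ) • Dbar ^ (n - 3)))) (a : ℕ) :
    entry lam p i j (virasoro (a + 5))
      = b • (eps ^ n * betaBarValue n (p - (j : ℕ) / 2) (a + 3)) := by
  have hr : p - ((i : ℕ) : ℂ) / 2 = p - (j : ℕ) / 2 + n / 2 := by rw [hij]; push_cast; ring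
  induction a with
  | zero =>
    rw [betaBarValue_add_three, zero_add, virasoro_five, hb]
    simp [betaFactor]
  | succ a ih =>
    rw [betaBarValue_add_three, mul_smul_comm] at ih ⊢
    rw [eps_pow_mul_sigma_raise_pow _ hn]
    generalize eps ^ n * (sigma (p - (j : ℕ) / 2) (n / 2) (oddField Polynomial.X) ^ a)
      ((4 : ℂ) • Dbar ^ (n - 3)) = T at *
    rcases Nat.even_or_odd' a with ⟨c, rfl | rfl⟩
    · have h := entry_anticomm lam p i j raise_mem (Polynomial.X ^ (c + 2))
      rw [show 2 * c + 5 = 2 * (c + 2) + 1 by ring, virasoro_odd] at ih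
      rw [ih, hr, ← pow_succ'] at h
      rw [show 2 * c + 1 + 5 = 2 * (c + 3) by ring, virasoro_even]
      have h2 := congrArg ((1 / 2 : ℂ) • ·) h
      simp only [smul_smul] at h2
      norm_num at h2
      have h6 : (-1 : ℂ) ^ (2 * c) = 1 := by rw [pow_mul]; simp
      rw [← h2, h6, show betaFactor n (2 * c + 1) = (-1) ^ n * betaFactor n (2 * c) / 2 by
        rw [← betaFactor_odd]; ring]
      have h4 := neg_one_pow_mul_self n
      generalize (-1 : ℂ) ^ n = e at *
      rw [smul_smul b, smul_smul _ e, show b * (e * betaFactor n (2 * c) / 2) * e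
        = (e * e) * (b * betaFactor n (2 * c) / 2) by ring, h4]
      module
    · have h := entry_comm lam p i j raise_mem (Polynomial.X ^ (c + 3))
      have h1 : (1 / 2 : ℂ) • (Polynomial.derivative (Polynomial.X ^ (c + 3)) * Polynomial.X)
          - Polynomial.X ^ (c + 3) * Polynomial.derivative Polynomial.X
          = (((c : ℂ) + 1) / 2) • (Polynomial.X ^ (c + 3) : Polynomial ℂ) := by
        rw [Polynomial.derivative_X, Polynomial.derivative_X_pow, mul_one, mul_assoc,
          show c + 3 - 1 = c + 2 from rfl, ← pow_succ, ← Polynomial.smul_eq_C_mul]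
        push_cast
        module
      rw [show 2 * c + 1 + 5 = 2 * (c + 3) by ring, virasoro_even] at ih
      rw [h1, oddField_smul, entry_smul, ih, hr] at h
      rw [show 2 * c + 1 + 1 + 5 = 2 * (c + 3) + 1 by ring, virasoro_odd,
        show 2 * c + 1 + 1 = 2 * (c + 1) by ring]
      have h3 : (c : ℂ) + 1 ≠ 0 := Nat.cast_add_one_ne_zero c
      have h4 := neg_one_pow_mul_self n
      have h5 := betaFactor_even n c
      have h6 : (-1 : ℂ) ^ (2 * c + 1) = -1 := by rw [pow_succ, pow_mul]; simp
      rw [h6]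
      generalize (-1 : ℂ) ^ n = e at *
      have h7 : betaFactor n (2 * (c + 1)) * e = 2 / (c + 1) * betaFactor n (2 * c + 1) := by
        field_simp
        field_simp at h5
        linear_combination e * h5 + 2 * betaFactor n (2 * c + 1) * h4
      have h8 : ((2 : ℂ) / (c + 1)) • ((((c : ℂ) + 1) / 2)
            • entry lam p i j (oddField (Polynomial.X ^ (c + 3))))
          = entry lam p i j (oddField (Polynomial.X ^ (c + 3))) := by
        rw [smul_smul, show (2 : ℂ) / (c + 1) * ((c + 1) / 2) = 1 by field_simp, one_smul]
      rw [← h8, ← sub_eq_iff_eq_add'.2 h, smul_smul b, smul_smul _ e, h7]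
      simp only [mul_smul_comm, smul_mul_assoc]
      module

/-- `β̄_{n/2}(λ)` as a linear function of the contact Hamiltonian. -/
def betaBarHamiltonian (n : ℕ) (lam : ℂ) : SPoly →ₗ[ℂ] Op :=
  Polynomial.lsum (fun k => LinearMap.toSpanSingleton ℂ Op (betaBarValue n lam (2 * k - 2)))
      ∘ₗ (TrivSqZeroExt.fstHom ℂ (Polynomial ℂ) (Polynomial ℂ)).toLinearMap
    + Polynomial.lsum (fun k => (1 / 2 : ℂ) •
        LinearMap.toSpanSingleton ℂ Op (betaBarValue n lam (2 * k - 1)))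
      ∘ₗ (TrivSqZeroExt.sndHom (Polynomial ℂ) (Polynomial ℂ)).restrictScalars ℂ

theorem betaBar_eq (n : ℕ) (lam : ℂ) (F : SPoly) :
    betaBar n lam (contactEquiv F) = betaBarHamiltonian n lam F := by
  have h : hamiltonian (contactEquiv F) = F := contactEquiv.symm_apply_apply F
  rw [betaBar, h]
  simp only [betaBarHamiltonian, LinearMap.add_apply, LinearMap.comp_apply]
  congr 1
  simp only [Polynomial.lsum, LinearMap.coe_mk, AddHom.coe_mk]
  refine Finset.sum_congr rfl fun k _ => ?_
  change (F.snd.coeff k / 2) • _ = (1 / 2 : ℂ) • (F.snd.coeff k • betaBarValue n lam (2 * k - 1))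
  rw [smul_smul]
  congr 1
  ring

/-- The factor $1/2$ undoes the normalization $e_{k-1/2}=2\mathbb X(\xi x^k)$. Truncation in `d - 2`
is harmless, since `betaBarValue` is zero below index 3. -/
theorem betaBarHamiltonian_mon (n : ℕ) (lam : ℂ) (d : ℕ) :
    betaBarHamiltonian n lam (mon d)
      = (if d % 2 = 0 then (1 : ℂ) else 1 / 2) • betaBarValue n lam (d - 2) := by
  rcases Nat.even_or_odd' d with ⟨a, rfl | rfl⟩
  · rw [mon_even]
    simp [betaBarHamiltonian, Polynomial.lsum, Polynomial.X_pow_eq_monomial]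
  · rw [mon_odd]
    simp [betaBarHamiltonian, Polynomial.lsum, Nat.add_mod, Polynomial.X_pow_eq_monomial]

theorem contactEquiv_mon (d : ℕ) :
    contactEquiv (mon d) = (if d % 2 = 0 then (1 : ℂ) else 1 / 2) • virasoro d := by
  rcases Nat.even_or_odd' d with ⟨a, rfl | rfl⟩
  · rw [mon_even, virasoro_even, evenField]; simp
  · rw [mon_odd, virasoro_odd, oddField, smul_smul]; simp [Nat.add_mod]

theorem beta_virasoro (n : ℕ) (lam : ℂ) (d : ℕ) :
    beta n lam (virasoro d) = eps ^ n * betaBarValue n lam (d - 2) := by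
  have h0 : (if d % 2 = 0 then (1 : ℂ) else 1 / 2) ≠ 0 := by split_ifs <;> norm_num
  have h : virasoro d = contactEquiv ((if d % 2 = 0 then (1 : ℂ) else 1 / 2)⁻¹ • mon d) := by
    rw [map_smul, contactEquiv_mon, smul_smul, inv_mul_cancel₀ h0, one_smul]
  rw [beta, h, betaBar_eq, map_smul, betaBarHamiltonian_mon, smul_smul, inv_mul_cancel₀ h0, one_smul]

/-- The off-diagonal matrix entries are multiples of `β`. -/
theorem exists_entry_eq_smul_beta (lam p : ℂ) {i j : SymIdx p} {n : ℕ} (hn : 3 ≤ n)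
    (hij : (j : ℕ) = (i : ℕ) + n) :
    ∃ b : ℂ, ∀ Z, entry lam p i j Z = b • beta n (p - (j : ℕ) / 2) Z := by
  obtain ⟨b, hb⟩ := entry_lowest lam p hn hij
  have hne : i ≠ j := fun h => by subst h; omega
  have key : ∀ d, entry lam p i j (virasoro d)
      = b • (eps ^ n * betaBarValue n (p - (j : ℕ) / 2) (d - 2)) := by
    intro d
    rcases le_or_gt d 4 with hd | hd
    · rw [entry_of_mem lam p hne (virasoro_mem hd), betaBarValue, if_pos (by omega)]
      simp
    · obtain ⟨a, rfl⟩ := Nat.exists_eq_add_of_le' (Nat.succ_le_of_lt hd)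
      exact entry_virasoro lam p hn hij hb a
  refine ⟨b, fun Z => ?_⟩
  obtain ⟨F, rfl⟩ := contactEquiv.surjective Z
  rw [beta, betaBar_eq]
  have hF : F ∈ Submodule.span ℂ (Set.range mon) := span_mon ▸ Submodule.mem_top
  induction hF using Submodule.span_induction with
  | mem F hF =>
    obtain ⟨d, rfl⟩ := hF
    rw [contactEquiv_mon, entry_smul, key, betaBarHamiltonian_mon, mul_smul_comm, smul_comm]
  | zero =>
    have h := entry_smul lam p i j 0 0
    rw [zero_smul, zero_smul] at h
    rw [map_zero, h, map_zero, mul_zero, smul_zero]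
  | add F G _ _ hF hG => rw [map_add, entry_add, hF, hG, map_add, mul_add, smul_add]
  | smul c F _ hF => rw [map_smul, entry_smul, hF, map_smul, mul_smul_comm, smul_comm]

end SuperLine
end

noncomputable section

namespace SuperLine

/-! ## The values of `β` on the lowest weight vector -/

theorem lowCoef_sigma_raise_pow (lam p : ℂ) (k l : ℕ) (T : Op) :
    lowCoef k ((sigma lam p (oddField Polynomial.X) ^ l) T)
      = (∏ x ∈ Finset.range l, orderCoef lam (k + 1 + x)) * lowCoef (k + l) T := by
  induction l generalizing T with
  | zero => simp
  | succ l ih =>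
    rw [pow_succ, Module.End.mul_apply, ih, lowCoef_sigma_raise, Finset.prod_range_succ, mul_assoc,
      show k + l + 1 = k + 1 + l by ring, show k + (l + 1) = k + 1 + l by ring]

theorem lowCoef_zero (T : Op) : lowCoef 0 T = ev0 (T (mon 0)) := by
  simp [lowCoef_apply, diagCoef]

theorem prod_orderCoef (s : ℂ) (a : ℕ) :
    ∏ x ∈ Finset.range a, orderCoef s (0 + 1 + x)
      = ((a / 2).factorial : ℂ) * ∏ k ∈ Finset.range ((a + 1) / 2), (2 * s + k) := by
  induction a with
  | zero => simp
  | succ a ih =>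
    rw [Finset.prod_range_succ, ih]
    rcases Nat.even_or_odd' a with ⟨c, rfl | rfl⟩
    · rw [show (2 * c + 1) / 2 = c by omega, show 2 * c / 2 = c by omega,
        show (2 * c + 1 + 1) / 2 = c + 1 by omega, show 0 + 1 + 2 * c = 2 * c + 1 by ring,
        orderCoef_odd, Finset.prod_range_succ]
      ring
    · rw [show (2 * c + 1 + 1) / 2 = c + 1 by omega, show (2 * c + 1) / 2 = c by omega,
        show (2 * c + 1 + 1 + 1) / 2 = c + 1 by omega,
        show 0 + 1 + (2 * c + 1) = 2 * (c + 1) by ring, orderCoef_even, Nat.factorial_succ]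
      push_cast
      ring

/-- Constant terms ignore $\epsilon^n$, and $n-3$ raisings of $\bar D^{n-3}$ produce a product of
`orderCoef`s. Its factors of even index form the factorial in the denominator of `betaFactor`; those
of odd index form the product in $B_{rs}$. -/
theorem ev0_beta (s : ℂ) {n : ℕ} (hn : 3 ≤ n) :
    ev0 (beta n s (virasoro (n + 2)) (mon 0)) = scalarB n s := by
  obtain ⟨a, rfl⟩ := Nat.exists_eq_add_of_le' hn
  have hf : ((a / 2).factorial : ℂ) ≠ 0 := Nat.cast_ne_zero.2 (Nat.factorial_ne_zero _)
  rw [beta_virasoro, Nat.add_sub_cancel, betaBarValue_add_three, Nat.add_sub_cancel,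
    Module.End.mul_apply, ev0_eps_pow, ← lowCoef_zero, map_smul, lowCoef_sigma_raise_pow, map_smul,
    zero_add a, lowCoef_Dbar_pow, prod_orderCoef, scalarB, betaFactor,
    show (a + 3) / 2 - 1 = (a + 1) / 2 by omega]
  -- The numbers $a$ and $a+3$ have opposite parity, so the exponent is even.
  have h1 : (-1 : ℂ) ^ (a * (a + 3)) = 1 := by
    refine Even.neg_one_pow ?_
    rcases Nat.even_or_odd a with h | h
    · exact h.mul_right _
    · exact (h.add_odd (by decide)).mul_left _
  have h2 : (2 : ℂ) ^ (1 + (a + 3) % 2) = 4 * (2 ^ (a % 2))⁻¹ := by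
    rcases Nat.mod_two_eq_zero_or_one a with h | h
    · rw [show (a + 3) % 2 = 1 by omega, h]; norm_num
    · rw [show (a + 3) % 2 = 0 by omega, h]; norm_num
  rw [h1, h2]
  simp only [smul_eq_mul]
  field_simp

/-! ## Lowering and falling factorials -/

theorem fallingFactorial_succ (z : ℂ) (n : ℕ) :
    fallingFactorial z (n + 1) = fallingFactorial z n * (z - n) := Finset.prod_range_succ _ _

theorem fallingFactorial_succ' (z : ℂ) (n : ℕ) :
    fallingFactorial z (n + 1) = z * fallingFactorial (z - 1) n := by
  rw [fallingFactorial, Finset.prod_range_succ', mul_comm, fallingFactorial]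
  congr 1
  · simp
  · refine Finset.prod_congr rfl fun k _ => ?_
    push_cast; ring

theorem fallingFactorial_natCast (a h : ℕ) :
    (a.factorial : ℂ) * fallingFactorial ((a : ℂ) + h) h = ((a + h).factorial : ℂ) := by
  induction h with
  | zero => simp [fallingFactorial]
  | succ h ih =>
    rw [fallingFactorial_succ', ← add_assoc, Nat.factorial_succ, Nat.cast_mul, ← ih]
    push_cast
    rw [show (a : ℂ) + (h + 1) - 1 = a + h by ring]
    ring

theorem adCoef_even_even (h c : ℕ) : adCoef (2 * h) (2 * c) = fallingFactorial (h + 1) c := by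
  simp [adCoef, show (2 * c + 1) / 2 = c by omega, Nat.mul_mod]

theorem adCoef_even_odd (h c : ℕ) :
    adCoef (2 * h) (2 * c + 1) = 1 / 2 * fallingFactorial (h + 1) (c + 1) := by
  simp [adCoef, show (2 * c + 1 + 1) / 2 = c + 1 by omega, Nat.mul_mod, Nat.add_mod]

theorem adCoef_odd_even (h c : ℕ) : adCoef (2 * h + 1) (2 * c) = fallingFactorial (h + 1) c := by
  simp [adCoef, show (2 * c + 1) / 2 = c by omega, show (2 * h + 1) / 2 = h by omega, Nat.mul_mod]

theorem adCoef_odd_odd (h c : ℕ) :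
    adCoef (2 * h + 1) (2 * c + 1) = 2 * fallingFactorial (h + 1) c := by
  simp [adCoef, show (2 * c + 1 + 1) / 2 = c + 1 by omega, show (2 * h + 1) / 2 = h by omega,
    Nat.mul_mod, Nat.add_mod, pow_succ, pow_mul]

theorem sigma_lower_odd (lam p : ℂ) (j k : ℕ) :
    sigma lam p (oddField 1) (sigma lam p (virasoro (2 * k + 1)) (Dbar ^ j))
      = (2 : ℂ) • sigma lam p (virasoro (2 * k)) (Dbar ^ j) := by
  have h := LinearMap.congr_fun (sigma_oddField_anticomm lam p 1 (Polynomial.X ^ k)) (Dbar ^ j)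
  simp only [LinearMap.add_apply, Module.End.mul_apply, LinearMap.smul_apply,
    sigma_lower_Dbar_pow, map_zero, add_zero, one_mul] at h
  rw [virasoro_odd, virasoro_even, h]

theorem sigma_lower_even (lam p : ℂ) (j k : ℕ) :
    sigma lam p (oddField 1) (sigma lam p (virasoro (2 * (k + 1))) (Dbar ^ j))
      = (((k : ℂ) + 1) / 2) • sigma lam p (virasoro (2 * k + 1)) (Dbar ^ j) := by
  have h := LinearMap.congr_fun
    (sigma_oddField_evenField_comm lam p (Polynomial.X ^ (k + 1)) 1) (Dbar ^ j)
  have h1 : (1 / 2 : ℂ) • (Polynomial.derivative (Polynomial.X ^ (k + 1)) * 1)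
      - Polynomial.X ^ (k + 1) * Polynomial.derivative 1
      = (((k : ℂ) + 1) / 2) • (Polynomial.X ^ k : Polynomial ℂ) := by
    rw [Polynomial.derivative_one, Polynomial.derivative_X_pow, mul_zero, sub_zero, mul_one,
      Nat.add_sub_cancel, ← Polynomial.smul_eq_C_mul]
    push_cast
    module
  simp only [LinearMap.sub_apply, Module.End.mul_apply, sigma_lower_Dbar_pow, map_zero, sub_zero,
    h1, oddField_smul, sigma_smul, LinearMap.smul_apply] at h
  rw [virasoro_odd, virasoro_even, h]

/-- Lowering kills $\bar D^j$, so only $\mathrm{ad}(e_{-1/2})$ acts. The bound on `l` stops at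
$e_{-1/2}$ and keeps the subtraction `M + 2 - l` from truncating. -/
theorem sigma_lower_pow (lam p : ℂ) (j M l : ℕ) (hl : l ≤ M + 1) :
    (sigma lam p (oddField 1) ^ l) (sigma lam p (virasoro (M + 2)) (Dbar ^ j))
      = adCoef M l • sigma lam p (virasoro (M + 2 - l)) (Dbar ^ j) := by
  induction l with
  | zero =>
    rcases Nat.even_or_odd' M with ⟨h, rfl | rfl⟩
    · have := adCoef_even_even h 0
      rw [mul_zero] at this
      simp [this, fallingFactorial]
    · have := adCoef_odd_even h 0
      rw [mul_zero] at this
      simp [this, fallingFactorial]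
  | succ l ih =>
    rw [pow_succ', Module.End.mul_apply, ih (by omega), map_smul]
    rcases Nat.even_or_odd' M with ⟨h, rfl | rfl⟩ <;>
      rcases Nat.even_or_odd' l with ⟨c, rfl | rfl⟩
    · obtain ⟨k, rfl⟩ := Nat.exists_eq_add_of_le (show c ≤ h by omega)
      rw [show 2 * (c + k) + 2 - 2 * c = 2 * (k + 1) by omega,
        show 2 * (c + k) + 2 - (2 * c + 1) = 2 * k + 1 by omega, sigma_lower_even, smul_smul,
        adCoef_even_even, adCoef_even_odd, fallingFactorial_succ]
      congr 1
      push_cast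
      ring
    · obtain ⟨k, rfl⟩ := Nat.exists_eq_add_of_le (show c ≤ h by omega)
      rw [show 2 * (c + k) + 2 - (2 * c + 1) = 2 * k + 1 by omega,
        show 2 * (c + k) + 2 - (2 * c + 1 + 1) = 2 * k by omega, sigma_lower_odd, smul_smul,
        adCoef_even_odd, show 2 * c + 1 + 1 = 2 * (c + 1) by ring, adCoef_even_even]
      congr 1
      ring
    · have hk : 2 * h + 1 + 2 - 2 * c = 2 * (h + 1 - c) + 1 := by omega
      rw [hk, show 2 * h + 1 + 2 - (2 * c + 1) = 2 * (h + 1 - c) by omega, sigma_lower_odd,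
        smul_smul, adCoef_odd_even, adCoef_odd_odd]
      congr 1
      ring
    · obtain ⟨k, rfl⟩ := Nat.exists_eq_add_of_le (show c ≤ h by omega)
      rw [show 2 * (c + k) + 1 + 2 - (2 * c + 1) = 2 * (k + 1) by omega,
        show 2 * (c + k) + 1 + 2 - (2 * c + 1 + 1) = 2 * k + 1 by omega, sigma_lower_even,
        smul_smul, adCoef_odd_odd, show 2 * c + 1 + 1 = 2 * (c + 1) by ring, adCoef_odd_even,
        fallingFactorial_succ]
      congr 1
      push_cast
      ring

/-! ### The scalars $F$ and $E$ as operator coefficients -/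

theorem diagCoef_even (a : ℕ) : diagCoef (2 * a) = (-1) ^ a * (a.factorial : ℂ) := by
  induction a with
  | zero => simp [diagCoef]
  | succ a ih =>
    rw [show 2 * (a + 1) = 2 * a + 1 + 1 by ring, diagCoef_succ, diagCoef_succ, ih, lowerCoef_even,
      lowerCoef_odd, Nat.factorial_succ, pow_succ _ (2 * a), pow_mul, pow_succ]
    push_cast
    simp
    ring

theorem diagCoef_odd (a : ℕ) : diagCoef (2 * a + 1) = (-1) ^ a * (a.factorial : ℂ) := by
  rw [diagCoef_succ, diagCoef_even, lowerCoef_even, pow_mul]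
  simp

theorem evenField_mon_even (t : ℂ) (h a : ℕ) :
    density t (evenField (Polynomial.X ^ (h + 1))) (mon (2 * a))
      = ((a : ℂ) + t * (h + 1)) • mon (2 * a + 2 * h) := by
  rw [show 2 * a + 2 * h = 2 * (a + h) by ring, mon_even, mon_even]
  ext1
  · rcases a with _ | a
    · simp [fst_evenField, Polynomial.smul_eq_C_mul, mul_assoc]
    · simp [fst_evenField, Polynomial.smul_eq_C_mul]
      ring
  · simp [snd_evenField]

theorem evenField_mon_odd (t : ℂ) (h a : ℕ) :
    density t (evenField (Polynomial.X ^ (h + 1))) (mon (2 * a + 1))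
      = ((a : ℂ) + (t + 1 / 2) * (h + 1)) • mon (2 * a + 1 + 2 * h) := by
  rw [show 2 * a + 1 + 2 * h = 2 * (a + h) + 1 by ring, mon_odd, mon_odd]
  ext1
  · simp [fst_evenField]
  · rcases a with _ | a
    · simp [snd_evenField, Polynomial.smul_eq_C_mul, mul_assoc]
    · simp [snd_evenField, Polynomial.smul_eq_C_mul]
      ring

theorem oddField_mon_even (t : ℂ) (h a : ℕ) :
    density t (oddField (Polynomial.X ^ (h + 1))) (mon (2 * a))
      = ((a : ℂ) + 2 * t * (h + 1)) • mon (2 * a + (2 * h + 1)) := by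
  rw [show 2 * a + (2 * h + 1) = 2 * (a + h) + 1 by ring, mon_odd, mon_even]
  ext1
  · simp [fst_oddField]
  · rcases a with _ | a
    · simp [snd_oddField, Polynomial.smul_eq_C_mul, mul_assoc]
    · simp [snd_oddField, Polynomial.smul_eq_C_mul]
      ring

theorem oddField_mon_odd (t : ℂ) (h a : ℕ) :
    density t (oddField (Polynomial.X ^ (h + 1))) (mon (2 * a + 1))
      = mon (2 * a + 1 + (2 * h + 1)) := by
  rw [show 2 * a + 1 + (2 * h + 1) = 2 * (a + h + 1) by ring, mon_odd, mon_even]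
  ext1
  · simp [fst_oddField]; ring
  · simp [snd_oddField]

/-- Because $\bar D^{k+N}$ kills `mon k`, only the composition of $\bar D^{k+N}$ with $\pi_\lambda$
on the right contributes. The odd case is the same with a parity sign. -/
theorem lowCoef_sigma_even (lam p : ℂ) (f : Polynomial ℂ) {k N : ℕ} (hN : 0 < N) {u : ℂ}
    (hu : density lam (evenField f) (mon k) = u • mon (k + N)) :
    lowCoef k (sigma lam p (evenField f) (Dbar ^ (k + N)))
      = -(u * ((diagCoef k)⁻¹ * diagCoef (k + N))) := by
  rw [lowCoef_apply, sigma_evenField, LinearMap.sub_apply, Module.End.mul_apply,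
    Module.End.mul_apply, Dbar_pow_mon_lt (by omega), map_zero, hu, map_smul, zero_sub, map_neg,
    map_smul, ev0_Dbar_pow, if_pos rfl, smul_eq_mul]
  ring

theorem lowCoef_sigma_odd (lam p : ℂ) (f : Polynomial ℂ) {k N : ℕ} (hN : N % 2 = 1) {u : ℂ}
    (hu : density lam (oddField f) (mon k) = u • mon (k + N)) :
    lowCoef k (sigma lam p (oddField f) (Dbar ^ (k + N)))
      = (-1) ^ k * u * ((diagCoef k)⁻¹ * diagCoef (k + N)) := by
  have h : (-1 : ℂ) ^ (k + N) = -(-1) ^ k := by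
    rw [pow_add, Odd.neg_one_pow (Nat.odd_iff.2 hN), mul_neg_one]
  rw [lowCoef_apply, sigma_oddField, LinearMap.sub_apply, Module.End.mul_apply,
    Module.End.mul_apply, Module.End.mul_apply, Module.End.mul_apply, Dbar_pow_mon_lt (by omega),
    map_zero, hu, map_smul, map_smul, eps_mon, map_smul, zero_sub, map_neg, map_smul, map_smul,
    ev0_eps, map_smul, ev0_Dbar_pow, if_pos rfl, smul_eq_mul, smul_eq_mul, h]
  ring

theorem diagCoef_ratio_even (a h : ℕ) : (diagCoef (2 * a))⁻¹ * diagCoef (2 * (a + h))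
    = (-1) ^ h * fallingFactorial ((a : ℂ) + h) h := by
  have h0 : (-1 : ℂ) ^ a ≠ 0 := pow_ne_zero _ (by norm_num)
  have h1 : (a.factorial : ℂ) ≠ 0 := Nat.cast_ne_zero.2 (Nat.factorial_ne_zero _)
  rw [diagCoef_even, diagCoef_even, ← fallingFactorial_natCast, pow_add]
  field_simp

theorem coefF_even_even (lam : ℂ) (a h : ℕ) :
    coefF lam (2 * ((a : ℂ) + h)) 0 (2 * h)
      = -((-1) ^ h * fallingFactorial (a + h) h * (a + (h + 1) * lam)) := by
  rw [coefF, if_pos (by omega), show 2 * h / 2 = h by omega]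
  simp only [Nat.cast_zero, sub_zero, pow_zero]
  rw [show 2 * ((a : ℂ) + h) / 2 = a + h by ring]
  ring

theorem coefF_odd_even (lam : ℂ) (a h : ℕ) :
    coefF lam (2 * ((a : ℂ) + h) + 1) 1 (2 * h)
      = -((-1) ^ h * fallingFactorial (a + h) h * (a + (h + 1) * (lam + 1 / 2))) := by
  rw [coefF, if_pos (by omega), show 2 * h / 2 = h by omega]
  simp only [Nat.cast_one, pow_one]
  rw [show (2 * ((a : ℂ) + h) + 1 - 1) / 2 = a + h by ring]
  ring

theorem coefF_even_odd (lam : ℂ) (a h : ℕ) :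
    coefF lam (2 * ((a : ℂ) + h + 1)) 0 (2 * h + 1)
      = (-1) ^ h * fallingFactorial (a + h + 1) (h + 1) := by
  rw [coefF, if_neg (by omega), show (2 * h + 1) / 2 = h by omega, fallingFactorial_succ]
  simp only [Nat.cast_zero, sub_zero]
  rw [show 2 * ((a : ℂ) + h + 1) / 2 = a + h + 1 by ring]
  ring

theorem coefF_odd_odd (lam : ℂ) (a h : ℕ) :
    coefF lam (2 * ((a : ℂ) + h) + 1) 1 (2 * h + 1)
      = (-1) ^ h * fallingFactorial (a + h) h * (a + 2 * lam * (h + 1)) := by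
  rw [coefF, if_neg (by omega), show (2 * h + 1) / 2 = h by omega]
  simp only [Nat.cast_one]
  rw [show (2 * ((a : ℂ) + h) + 1 - 1) / 2 = a + h by ring]
  ring

/-- This is the meaning of $F$: its superscripts are the order $k+N$ of the operator acted upon and
the parity of that order. -/
theorem lowCoef_sigma_virasoro (lam p : ℂ) (k N : ℕ) (hN : 0 < N) :
    lowCoef k (sigma lam p (virasoro (N + 2)) (Dbar ^ (k + N)))
      = coefF lam ((k + N : ℕ) : ℂ) ((k + N) % 2) N := by
  rcases Nat.even_or_odd' N with ⟨h, rfl | rfl⟩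
  · rw [show 2 * h + 2 = 2 * (h + 1) by ring, virasoro_even]
    rcases Nat.even_or_odd' k with ⟨a, rfl | rfl⟩
    · rw [lowCoef_sigma_even lam p _ hN (evenField_mon_even lam h a), ← mul_add, diagCoef_ratio_even,
        Nat.mul_mod_right]
      push_cast
      rw [coefF_even_even]
      ring
    · rw [lowCoef_sigma_even lam p _ hN (evenField_mon_odd lam h a),
        show 2 * a + 1 + 2 * h = 2 * (a + h) + 1 by ring, diagCoef_odd, diagCoef_odd,
        ← diagCoef_even, ← diagCoef_even, diagCoef_ratio_even,
        show (2 * (a + h) + 1) % 2 = 1 by omega]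
      push_cast
      rw [coefF_odd_even]
      ring
  · rw [show 2 * h + 1 + 2 = 2 * (h + 1) + 1 by ring, virasoro_odd]
    rcases Nat.even_or_odd' k with ⟨a, rfl | rfl⟩
    · rw [lowCoef_sigma_odd lam p _ (by omega) (oddField_mon_even lam h a),
        show 2 * a + (2 * h + 1) = 2 * (a + h) + 1 by ring, diagCoef_odd,
        ← diagCoef_even, diagCoef_ratio_even, show (2 * (a + h) + 1) % 2 = 1 by omega, pow_mul]
      push_cast
      rw [coefF_odd_odd]
      simp
      ring
    · have hu := oddField_mon_odd lam h a
      rw [← one_smul ℂ (mon (2 * a + 1 + (2 * h + 1)))] at hu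
      rw [lowCoef_sigma_odd lam p _ (by omega) hu,
        show 2 * a + 1 + (2 * h + 1) = 2 * (a + (h + 1)) by ring, diagCoef_odd, ← diagCoef_even,
        diagCoef_ratio_even, Nat.mul_mod_right, pow_succ, pow_mul]
      push_cast
      rw [← add_assoc, coefF_even_odd]
      simp [pow_succ]

/-- This is the meaning of $E$: the cost of bringing order $i+k$ down to order $i$ by $k$ raisings.
The even and odd orders passed on the way supply the two falling factorials. -/
theorem coefE_eq (lam : ℂ) (i k : ℕ) :
    coefE lam ((i + k : ℕ) : ℂ) ((i + k) % 2) k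
      = ∏ x ∈ Finset.range k, orderCoef lam (i + 1 + x) := by
  induction k with
  | zero => simp [coefE, fallingFactorial]
  | succ k ih =>
    rw [Finset.prod_range_succ, ← ih, show i + 1 + k = i + k + 1 by ring, ← add_assoc]
    generalize i + k = z
    rcases Nat.even_or_odd' z with ⟨a, rfl | rfl⟩
    · rw [orderCoef_odd, show (2 * a + 1) % 2 = 1 by omega, Nat.mul_mod_right, coefE, coefE,
        show (k + 1) / 2 + (1 - 1) * ((k + 1) % 2) = k / 2 + (1 - 0) * (k % 2) by omega,
        show (k + 1) / 2 + 1 * ((k + 1) % 2) = (k / 2 + 0 * (k % 2)) + 1 by omega,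
        fallingFactorial_succ']
      push_cast
      rw [show (2 * (a : ℂ) + 1 - 1) / 2 = a by ring, show (2 * (a : ℂ) - 0) / 2 = a by ring,
        show (2 * (a : ℂ) + 1 + 1) / 2 - 1 + 2 * lam = 2 * lam + a by ring,
        show (2 * (a : ℂ) + 0) / 2 - 1 + 2 * lam = 2 * lam + a - 1 by ring]
      ring
    · rw [show 2 * a + 1 + 1 = 2 * (a + 1) by ring, orderCoef_even,
        show (2 * a + 1) % 2 = 1 by omega, Nat.mul_mod_right, coefE, coefE,
        show (k + 1) / 2 + (1 - 0) * ((k + 1) % 2) = (k / 2 + (1 - 1) * (k % 2)) + 1 by omega,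
        show (k + 1) / 2 + 0 * ((k + 1) % 2) = k / 2 + 1 * (k % 2) by omega,
        fallingFactorial_succ']
      push_cast
      rw [show (2 * (a : ℂ) + 1 - 1) / 2 = a by ring,
        show (2 * ((a : ℂ) + 1) - 0) / 2 = a + 1 by ring,
        show (2 * (a : ℂ) + 1 + 1) / 2 - 1 + 2 * lam = 2 * lam + a by ring,
        show (2 * ((a : ℂ) + 1) + 0) / 2 - 1 + 2 * lam = 2 * lam + a by ring, add_sub_cancel_right]
      ring

end SuperLine
end

noncomputable section

namespace SuperLine

/-! ## The extremal projector -/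

theorem projCoef_odd {ν : ℕ} {t : ℂ} (h : ((ν : ℂ) + 1) - 2 * t ≠ 0) :
    ((ν : ℂ) + 1 - 2 * t) * projCoef (2 * ν + 1) t = projCoef (2 * ν) t := by
  rw [projCoef, projCoef, show (2 * ν + 1 + 1) / 2 = ν + 1 by omega,
    show (2 * ν + 1) / 2 = ν by omega, show 2 * ν / 2 = ν by omega,
    Finset.prod_Icc_succ_top (by omega)]
  push_cast
  field_simp

theorem projCoef_even (ν : ℕ) (t : ℂ) :
    ((ν : ℂ) + 1) * projCoef (2 * (ν + 1)) t = projCoef (2 * ν + 1) t := by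
  have h0 : (ν.factorial : ℂ) ≠ 0 := Nat.cast_ne_zero.2 (Nat.factorial_ne_zero _)
  have h1 : (ν : ℂ) + 1 ≠ 0 := Nat.cast_add_one_ne_zero ν
  rw [projCoef, projCoef, show (2 * ν + 1 + 1) / 2 = ν + 1 by omega,
    show (2 * ν + 1) / 2 = ν by omega, show (2 * (ν + 1) + 1) / 2 = ν + 1 by omega,
    show 2 * (ν + 1) / 2 = ν + 1 by omega, Nat.factorial_succ]
  push_cast
  field_simp

/-- The eigenvalue of `π_t(e_{1/2}) D` on `mon (e + 1)`. -/
def stepEigen (t : ℂ) (e : ℕ) : ℂ := lowerCoef e * raiseCoef t e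

theorem raise_pow_lower_pow (t : ℂ) {d l : ℕ} (hl : l ≤ d) :
    (density t (oddField Polynomial.X) ^ l) ((D ^ l) (mon d))
      = (∏ x ∈ Finset.range l, stepEigen t (d - 1 - x)) • mon d := by
  induction l generalizing d with
  | zero => simp
  | succ l ih =>
    obtain ⟨d, rfl⟩ := Nat.exists_eq_add_of_le' (show 1 ≤ d by omega)
    rw [pow_succ', pow_succ D, Module.End.mul_apply, Module.End.mul_apply, D_mon_succ, map_smul,
      map_smul, ih (by omega), map_smul, map_smul, density_raise_mon, smul_smul, smul_smul,
      Finset.prod_range_succ']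
    congr 1
    simp only [Nat.add_sub_cancel, Nat.sub_zero, stepEigen]
    simp only [Nat.sub_sub, add_comm 1]
    ring

theorem D_pow_mon_lt {d l : ℕ} (h : d < l) : (D ^ l) (mon d) = 0 := by
  induction d generalizing l with
  | zero =>
    obtain ⟨l, rfl⟩ := Nat.exists_eq_add_of_le' (show 1 ≤ l by omega)
    rw [pow_succ, Module.End.mul_apply, D_mon_zero, map_zero]
  | succ d ih =>
    obtain ⟨l, rfl⟩ := Nat.exists_eq_add_of_le' (show 1 ≤ l by omega)
    rw [pow_succ, Module.End.mul_apply, D_mon_succ, map_smul, ih (by omega), smul_zero]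

theorem D_pow_mon_add (l d : ℕ) : ∃ c : ℂ, c ≠ 0 ∧ (D ^ l) (mon (d + l)) = c • mon d := by
  induction l with
  | zero => exact ⟨1, one_ne_zero, by simp⟩
  | succ l ih =>
    obtain ⟨c, hc, h⟩ := ih
    refine ⟨lowerCoef (d + l) * c, mul_ne_zero (lowerCoef_ne_zero _) hc, ?_⟩
    rw [pow_succ, Module.End.mul_apply, ← add_assoc, D_mon_succ, map_smul, h, smul_smul]

/-- The partial sums have a closed form with a factor $\delta-\nu$, so the full sum, at
$\nu=\delta$, vanishes. The hypotheses are the recursions met by the terms of the projector series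
on `mon (2 * δ)` with $c=2r$; the next lemma treats odd index. -/
theorem sum_telescope_even {f : ℕ → ℂ} {δ : ℕ} {c : ℂ}
    (h1 : ∀ ν < δ, ((ν : ℂ) + 1 - c) * f (2 * ν + 1) = (δ - ν) * f (2 * ν))
    (h2 : ∀ ν < δ, ((ν : ℂ) + 1) * f (2 * (ν + 1)) = (c - δ - 1 - ν) * f (2 * ν + 1)) {ν : ℕ}
    (hν : ν ≤ δ) :
    (δ : ℂ) * ∑ x ∈ Finset.range (2 * ν + 1), f x = (δ - ν) * f (2 * ν) := by
  induction ν with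
  | zero => simp
  | succ ν ih =>
    rw [show 2 * (ν + 1) + 1 = 2 * ν + 1 + 1 + 1 by ring, Finset.sum_range_succ,
      Finset.sum_range_succ, show 2 * ν + 1 + 1 = 2 * (ν + 1) by ring]
    push_cast
    linear_combination ih (by omega) - h1 ν (by omega) + h2 ν (by omega)

theorem sum_telescope_odd {f : ℕ → ℂ} {δ : ℕ} {c : ℂ}
    (h1 : ∀ ν ≤ δ, ((ν : ℂ) + 1 - c) * f (2 * ν + 1) = (c - δ - 1 - ν) * f (2 * ν))
    (h2 : ∀ ν < δ, ((ν : ℂ) + 1) * f (2 * (ν + 1)) = (δ - ν) * f (2 * ν + 1)) {ν : ℕ}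
    (hν : ν ≤ δ) :
    ((δ : ℂ) + 1 - c) * ∑ x ∈ Finset.range (2 * ν + 2), f x = (δ - ν) * f (2 * ν + 1) := by
  induction ν with
  | zero =>
    have h := h1 0 (by omega)
    rw [Finset.sum_range_succ, Finset.sum_range_succ]
    simp at h ⊢
    linear_combination h
  | succ ν ih =>
    rw [show 2 * (ν + 1) + 2 = 2 * ν + 2 + 1 + 1 by ring, Finset.sum_range_succ,
      Finset.sum_range_succ, show 2 * ν + 2 = 2 * (ν + 1) by ring]
    rw [show 2 * ν + 2 = 2 * (ν + 1) by ring] at ih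
    have h3 := h1 (ν + 1) (by omega)
    push_cast at h3 ⊢
    linear_combination ih (by omega) - h2 ν (by omega) + h3

/-- The truncated extremal projector annihilates `mon d` for `d ≠ 0` and fixes `mon 0`. -/
theorem projector_mon {r t : ℂ} {n d : ℕ} (hd : d ≤ n) (ht : r = t + d / 2)
    (hr : ∀ a ∈ Finset.Icc 1 ((n + 1) / 2), (a : ℂ) - 2 * r ≠ 0) :
    ∑ l ∈ Finset.range (n + 1),
        projCoef l r • (density t (oddField Polynomial.X) ^ l) ((D ^ l) (mon d))
      = if d = 0 then mon 0 else 0 := by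
  set f : ℕ → ℂ := fun l => projCoef l r * ∏ x ∈ Finset.range l, stepEigen t (d - 1 - x) with hf
  have hsum : ∑ l ∈ Finset.range (n + 1),
        projCoef l r • (density t (oddField Polynomial.X) ^ l) ((D ^ l) (mon d))
      = (∑ l ∈ Finset.range (d + 1), f l) • mon d := by
    rw [Finset.sum_smul, ← Finset.sum_subset (Finset.range_mono (Nat.succ_le_succ hd))]
    · refine Finset.sum_congr rfl fun l hl => ?_
      rw [raise_pow_lower_pow t (Nat.lt_succ_iff.1 (Finset.mem_range.1 hl)), smul_smul]
    · intro l _ hl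
      rw [D_pow_mon_lt (by simpa [Nat.lt_succ_iff] using hl), map_zero, smul_zero]
  rw [hsum]
  have hpole : ∀ ν : ℕ, 2 * ν + 1 ≤ n → (ν : ℂ) + 1 - 2 * r ≠ 0 := fun ν hν => by
    have := hr (ν + 1) (Finset.mem_Icc.2 ⟨by omega, by omega⟩)
    rwa [Nat.cast_add_one] at this
  rcases Nat.even_or_odd' d with ⟨δ, rfl | rfl⟩
  · rcases Nat.eq_zero_or_pos δ with rfl | hδ
    · simp [hf, projCoef]
    · rw [if_neg (by omega)]
      -- The term ratios combine the recursion of $p_l$ with the eigenvalues `stepEigen`; the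
      -- relation $r=t+d/2$ rewrites the factors $2t+k$ as $2r-\delta-1-\nu$.
      have key := sum_telescope_even (f := f) (δ := δ) (c := 2 * r) (fun ν hν => ?_)
        (fun ν hν => ?_) le_rfl
      · rw [sub_self, zero_mul, mul_eq_zero] at key
        rw [key.resolve_left (Nat.cast_ne_zero.2 hδ.ne'), zero_smul]
      · obtain ⟨k, rfl⟩ := Nat.exists_eq_add_of_lt hν
        simp only [hf]
        rw [Finset.prod_range_succ, ← mul_assoc, ← mul_assoc, projCoef_odd (hpole ν (by omega)),
          show 2 * (ν + k + 1) - 1 - 2 * ν = 2 * k + 1 by omega, stepEigen, lowerCoef_odd,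
          raiseCoef_odd]
        push_cast
        ring
      · obtain ⟨k, rfl⟩ := Nat.exists_eq_add_of_lt hν
        simp only [hf]
        rw [← mul_assoc, projCoef_even, show 2 * (ν + 1) = 2 * ν + 1 + 1 by ring,
          Finset.prod_range_succ, show 2 * (ν + k + 1) - 1 - (2 * ν + 1) = 2 * k by omega,
          stepEigen, lowerCoef_even, raiseCoef_even, ht]
        push_cast
        ring
  · rw [if_neg (by omega)]
    have key := sum_telescope_odd (f := f) (δ := δ) (c := 2 * r) (fun ν hν => ?_)
      (fun ν hν => ?_) le_rfl
    · rw [sub_self, zero_mul, mul_eq_zero] at key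
      rw [show 2 * δ + 1 + 1 = 2 * δ + 2 by ring, key.resolve_left (hpole δ hd), zero_smul]
    · obtain ⟨k, rfl⟩ := Nat.exists_eq_add_of_le hν
      simp only [hf]
      rw [Finset.prod_range_succ, ← mul_assoc, ← mul_assoc, projCoef_odd (hpole ν (by omega)),
        show 2 * (ν + k) + 1 - 1 - 2 * ν = 2 * k by omega, stepEigen, lowerCoef_even,
        raiseCoef_even, ht]
      push_cast
      ring
    · obtain ⟨k, rfl⟩ := Nat.exists_eq_add_of_lt hν
      simp only [hf]
      rw [← mul_assoc, projCoef_even, show 2 * (ν + 1) = 2 * ν + 1 + 1 by ring,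
        Finset.prod_range_succ, show 2 * (ν + k + 1) + 1 - 1 - (2 * ν + 1) = 2 * k + 1 by omega,
        stepEigen, lowerCoef_odd, raiseCoef_odd]
      push_cast
      ring

/-! ## Weight vectors -/

/-- The numbers $\mathrm{ev}_0(D^lG)$ are, up to nonzero factors, the coefficients of $G$ in the
monomial basis. -/
theorem eq_zero_of_ev0_D_pow {G : SPoly} (h : ∀ l, ev0 ((D ^ l) G) = 0) : G = 0 := by
  obtain ⟨N, hN⟩ := D_locally_nilpotent G
  induction N with
  | zero => simpa using hN
  | succ N ih =>
    refine ih ?_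
    rw [pow_succ', Module.End.mul_apply] at hN
    rw [eq_smul_mon_zero hN, h, zero_smul]

theorem weight_D_pow {t r : ℂ} {F : SPoly} (hF : density t (evenField Polynomial.X) F = r • F)
    (l : ℕ) :
    density t (evenField Polynomial.X) ((D ^ l) F) = (r - l / 2) • (D ^ l) F := by
  induction l with
  | zero => simpa using hF
  | succ l ih =>
    have h := oddField_evenField_comm t Polynomial.X 1
    have h1 : (1 / 2 : ℂ) • (Polynomial.derivative Polynomial.X * 1)
        - Polynomial.X * Polynomial.derivative 1 = (1 / 2 : ℂ) • (1 : Polynomial ℂ) := by simp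
    rw [h1, oddField_smul, map_smul, density_lower] at h
    have h2 := LinearMap.congr_fun h ((D ^ l) F)
    simp only [LinearMap.sub_apply, Module.End.mul_apply, LinearMap.smul_apply, ih, map_smul] at h2
    rw [pow_succ', Module.End.mul_apply, eq_sub_of_add_eq' (sub_eq_iff_eq_add.1 h2).symm]
    push_cast
    module

/-- Each $D$ lowers the weight by $1/2$, and a nonzero constant term in $\mathbb F(t)$ requires
weight $t$. So at most one of the coefficients $\mathrm{ev}_0(D^lF)$ survives. -/
theorem weight_vector {t r : ℂ} {F : SPoly} (hF : density t (evenField Polynomial.X) F = r • F) :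
    F = 0 ∨ ∃ d : ℕ, r = t + d / 2 ∧ ∃ c : ℂ, F = c • mon d := by
  have hev : ∀ l : ℕ, r ≠ t + l / 2 → ev0 ((D ^ l) F) = 0 := fun l hl => by
    have h := congrArg ev0 (weight_D_pow hF l)
    rw [ev0_weight, map_smul, smul_eq_mul] at h
    have h1 : (r - (t + l / 2)) * ev0 ((D ^ l) F) = 0 := by linear_combination -h
    exact (mul_eq_zero.1 h1).resolve_left (sub_ne_zero.2 hl)
  by_cases h : ∃ d : ℕ, r = t + d / 2
  · obtain ⟨d, hd⟩ := h
    refine Or.inr ⟨d, hd, ?_⟩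
    obtain ⟨c, hc, hcd⟩ := D_pow_mon_add d 0
    rw [zero_add] at hcd
    refine ⟨ev0 ((D ^ d) F) / c, sub_eq_zero.1 (eq_zero_of_ev0_D_pow fun l => ?_)⟩
    rw [map_sub, map_smul, map_sub, map_smul, smul_eq_mul]
    rcases lt_trichotomy l d with hl | rfl | hl
    · obtain ⟨e, rfl⟩ := Nat.exists_eq_add_of_lt hl
      obtain ⟨c', -, h'⟩ := D_pow_mon_add l (e + 1)
      rw [show l + e + 1 = e + 1 + l by ring, h', hev l fun h => ?_]
      · simp [ev0_mon]
      · rw [hd] at h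
        have : ((l + e + 1 : ℕ) : ℂ) = l := by linear_combination 2 * h
        have : l + e + 1 = l := by exact_mod_cast this
        omega
    · rw [hcd, map_smul, ev0_mon_zero, smul_eq_mul, mul_one, div_mul_cancel₀ _ hc, sub_self]
    · rw [D_pow_mon_lt hl, hev l fun h => ?_]
      · simp
      · rw [hd] at h
        have : (d : ℂ) = l := by linear_combination 2 * h
        have : d = l := by exact_mod_cast this
        omega
  · exact Or.inl (eq_zero_of_ev0_D_pow fun l => hev l fun hl => h ⟨l, hl⟩)

/-! ## The scalar -/

theorem symbolAction_pow_apply (p : ℂ) (Z : contactAlgebra) (l : ℕ) (w : SymbolSpace p)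
    (k : SymIdx p) :
    (symbolAction p Z ^ l) w k = (density (p - (k : ℕ) / 2) Z ^ l) (w k) := by
  induction l generalizing w with
  | zero => rfl
  | succ l ih => rw [pow_succ, Module.End.mul_apply, ih, symbolAction_apply, pow_succ,
      Module.End.mul_apply]

theorem quantEquiv_pow (lam p : ℂ) {Z : contactAlgebra} (hZ : Z ∈ conformalAlgebra) (l : ℕ)
    (w : SymbolSpace p) :
    (quantEquiv lam p ((symbolAction p Z ^ l) w) : Op) = (sigma lam p Z ^ l) (quantEquiv lam p w) := by
  induction l generalizing w with
  | zero => rfl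
  | succ l ih =>
    rw [pow_succ, Module.End.mul_apply, ih, ← quantEquiv_intertwines _ _ hZ, pow_succ,
      Module.End.mul_apply]

theorem weight_evenField_comm (t : ℂ) (g : Polynomial ℂ) :
    density t (evenField Polynomial.X) * density t (evenField g)
      = density t (evenField g) * density t (evenField Polynomial.X)
        + density t (evenField (Polynomial.X * Polynomial.derivative g - g)) := by
  ext1 u
  ext1
  · simp [fst_evenField, Polynomial.derivative_mul]
    ring
  · simp [snd_evenField, Polynomial.derivative_mul]
    ring

theorem sigma_weight_evenField (lam p : ℂ) (g : Polynomial ℂ) (T : Op) :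
    sigma lam p (evenField Polynomial.X) (sigma lam p (evenField g) T)
      = sigma lam p (evenField g) (sigma lam p (evenField Polynomial.X) T)
        + sigma lam p (evenField (Polynomial.X * Polynomial.derivative g - g)) T := by
  simp only [sigma_evenField, mul_sub, sub_mul]
  rw [← mul_assoc, weight_evenField_comm (lam + p) g, mul_assoc T, mul_assoc T,
    weight_evenField_comm lam g]
  simp only [mul_add, add_mul, mul_assoc]
  abel

theorem sigma_weight_Dbar_pow (lam p : ℂ) (j : SymIdx p) :
    sigma lam p (evenField Polynomial.X) (Dbar ^ (j : ℕ)) = (p - (j : ℕ) / 2) • Dbar ^ (j : ℕ) := by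
  have h := quantEquiv_intertwines lam p weight_mem (Finsupp.single j (mon 0))
  rw [symbolAction_single, density_weight_mon, ← Finsupp.smul_single, map_smul, Submodule.coe_smul,
    quantEquiv_single_mon_zero] at h
  rw [h]
  simp

theorem sigma_weight_virasoro (lam p : ℂ) (j : SymIdx p) (M : ℕ) :
    sigma lam p (evenField Polynomial.X) (sigma lam p (virasoro (M + 2)) (Dbar ^ (j : ℕ)))
      = (p - (j : ℕ) / 2 + M / 2) • sigma lam p (virasoro (M + 2)) (Dbar ^ (j : ℕ)) := by
  rcases Nat.even_or_odd' M with ⟨k, rfl | rfl⟩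
  · have h1 : Polynomial.X * Polynomial.derivative (Polynomial.X ^ (k + 1)) - Polynomial.X ^ (k + 1)
        = (k : ℂ) • (Polynomial.X ^ (k + 1) : Polynomial ℂ) := by
      rw [Polynomial.derivative_X_pow, mul_left_comm, Nat.add_sub_cancel, ← pow_succ',
        ← Polynomial.smul_eq_C_mul]
      push_cast
      module
    rw [show 2 * k + 2 = 2 * (k + 1) by ring, virasoro_even, sigma_weight_evenField, h1,
      evenField_smul, sigma_smul, LinearMap.smul_apply, sigma_weight_Dbar_pow, map_smul]
    push_cast
    module
  · have h := LinearMap.congr_fun (sigma_oddField_evenField_comm lam p Polynomial.X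
      (Polynomial.X ^ (k + 1))) (Dbar ^ (j : ℕ))
    have h1 : (1 / 2 : ℂ) • (Polynomial.derivative Polynomial.X * Polynomial.X ^ (k + 1))
        - Polynomial.X * Polynomial.derivative (Polynomial.X ^ (k + 1))
        = (-1 / 2 - k : ℂ) • (Polynomial.X ^ (k + 1) : Polynomial ℂ) := by
      rw [Polynomial.derivative_X_pow, mul_left_comm, Nat.add_sub_cancel, ← pow_succ',
        ← Polynomial.smul_eq_C_mul, Polynomial.derivative_X, one_mul]
      push_cast
      module
    simp only [LinearMap.sub_apply, Module.End.mul_apply] at h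
    rw [h1, oddField_smul, sigma_smul, LinearMap.smul_apply, sigma_weight_Dbar_pow, map_smul] at h
    rw [show 2 * k + 1 + 2 = 2 * (k + 1) + 1 by ring, virasoro_odd,
      eq_sub_of_add_eq' (sub_eq_iff_eq_add.1 h).symm]
    push_cast
    module

/-- The constant term of a symbol component is computed by the extremal projector. -/
theorem ev0_symbol (lam p : ℂ) (i : SymIdx p) {n : ℕ}
    (hr : ∀ a ∈ Finset.Icc 1 ((n + 1) / 2), (a : ℂ) - 2 * (p - (i : ℕ) / 2) ≠ 0)
    (w : SymbolSpace p)
    (hw : symbolAction p (evenField Polynomial.X) w = (p - (i : ℕ) / 2) • w)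
    (hw' : (symbolAction p (oddField 1) ^ (n + 1)) w = 0) :
    ev0 (w i) = ∑ l ∈ Finset.range (n + 1), projCoef l (p - (i : ℕ) / 2) *
      lowCoef i ((sigma lam p (oddField Polynomial.X) ^ l)
        ((sigma lam p (oddField 1) ^ l) (quantEquiv lam p w))) := by
  -- Checked componentwise: in each summand $w$ is a multiple of one monomial, and the projector
  -- keeps it only if it is the lowest weight vector, which by weight happens only in summand `i`.
  have key : ∑ l ∈ Finset.range (n + 1), projCoef l (p - (i : ℕ) / 2) •
      (symbolAction p (oddField Polynomial.X) ^ l) ((symbolAction p (oddField 1) ^ l) w)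
      = ev0 (w i) • Finsupp.single i (mon 0) := by
    refine Finsupp.ext fun k => ?_
    rw [Finsupp.finsetSum_apply, Finsupp.smul_apply]
    simp only [Finsupp.smul_apply, symbolAction_pow_apply, density_lower]
    have h1 := DFunLike.congr_fun hw k
    have h2 := DFunLike.congr_fun hw' k
    rw [symbolAction_apply, Finsupp.smul_apply] at h1
    rw [symbolAction_pow_apply, density_lower, Finsupp.zero_apply] at h2
    rcases weight_vector h1 with h0 | ⟨d, hd, c, hc⟩
    · rw [h0]
      by_cases hik : i = k
      · subst hik; rw [h0]; simp
      · rw [Finsupp.single_eq_of_ne' hik]; simp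
    · have hdk : (k : ℕ) = (i : ℕ) + d := by
        have : ((k : ℕ) : ℂ) = ((i : ℕ) + d : ℕ) := by push_cast; linear_combination 2 * hd
        exact_mod_cast this
      -- Nilpotency of lowering bounds the index of the monomial by `n`, so truncating the projector
      -- after $l=n$ loses nothing.
      have hcn : c = 0 ∨ d ≤ n := by
        by_contra! hcon
        obtain ⟨e, rfl⟩ := Nat.exists_eq_add_of_le' (Nat.succ_le_of_lt hcon.2)
        obtain ⟨c', hc', h'⟩ := D_pow_mon_add (n + 1) e
        rw [hc, map_smul, show e + n.succ = e + (n + 1) from rfl, h', smul_smul] at h2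
        have h3 := mul_ne_zero hcon.1 hc'
        have h4 := (smul_eq_zero.1 h2).resolve_left h3
        obtain ⟨c'', hc'', h''⟩ := D_pow_mon_add e 0
        rw [zero_add, h4, map_zero] at h''
        have := congrArg ev0 h''
        simp [hc''.symm] at this
      have hsum : ∑ l ∈ Finset.range (n + 1), projCoef l (p - (i : ℕ) / 2) •
          (density (p - (k : ℕ) / 2) (oddField Polynomial.X) ^ l) ((D ^ l) (w k))
          = c • if d = 0 then mon 0 else 0 := by
        rcases hcn with rfl | hdn
        · rw [hc]; simp
        · rw [← projector_mon hdn hd hr, Finset.smul_sum]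
          refine Finset.sum_congr rfl fun l _ => ?_
          rw [hc, map_smul, map_smul, smul_comm]
      rw [hsum]
      by_cases hik : i = k
      · subst hik
        obtain rfl : d = 0 := by omega
        rw [hc]; simp
      · rw [if_neg fun h => hik (Subtype.ext (by omega)), Finsupp.single_eq_of_ne' hik, smul_zero, smul_zero]
  -- Quantizing carries the lowest weight vector of summand `i` to $\bar D^i$, whose low coefficient
  -- of order `i` is 1.
  have h := congrArg (fun v => lowCoef i (quantEquiv lam p v : Op)) key
  simp only [map_sum, map_smul, Submodule.coe_sum, Submodule.coe_smul,
    quantEquiv_pow lam p raise_mem, quantEquiv_pow lam p lower_mem, quantEquiv_single_mon_zero,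
    lowCoef_Dbar_pow, smul_eq_mul, mul_one] at h
  exact h.symm

/-- These identities merge the last three terms of the projector sum: $e_1=e_{1/2}^2$, and $e_0$
acts on $\bar D^j$ by the scalar $s$. -/
theorem sigma_raise_pow_Dbar_pow (lam p : ℂ) (j : SymIdx p) (l : ℕ) :
    (sigma lam p (oddField Polynomial.X) ^ l) (sigma lam p (virasoro 4) (Dbar ^ (j : ℕ)))
        = (sigma lam p (oddField Polynomial.X) ^ (l + 2)) (Dbar ^ (j : ℕ))
      ∧ (sigma lam p (oddField Polynomial.X) ^ (l + 1)) (sigma lam p (virasoro 3) (Dbar ^ (j : ℕ)))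
        = (sigma lam p (oddField Polynomial.X) ^ (l + 2)) (Dbar ^ (j : ℕ))
      ∧ (sigma lam p (oddField Polynomial.X) ^ (l + 2)) (sigma lam p (virasoro 2) (Dbar ^ (j : ℕ)))
        = (p - (j : ℕ) / 2)
          • (sigma lam p (oddField Polynomial.X) ^ (l + 2)) (Dbar ^ (j : ℕ)) := by
  refine ⟨?_, ?_, ?_⟩
  · have h := LinearMap.congr_fun (sigma_oddField_anticomm lam p Polynomial.X Polynomial.X)
      (Dbar ^ (j : ℕ))
    simp only [LinearMap.add_apply, Module.End.mul_apply, LinearMap.smul_apply] at h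
    rw [← two_smul ℂ, ← pow_two] at h
    have h1 := smul_right_injective Op (two_ne_zero' ℂ) h
    rw [show virasoro 4 = evenField (Polynomial.X ^ 2) from virasoro_even 2, ← h1, pow_add,
      Module.End.mul_apply, pow_two, Module.End.mul_apply]
  · rw [virasoro_three, pow_succ _ (l + 1), Module.End.mul_apply]
  · rw [virasoro_two, sigma_weight_Dbar_pow, map_smul]

/-- The matrix entry on the lowest weight vector. -/
theorem ev0_entry (lam p : ℂ) {i j : SymIdx p} {n : ℕ} (hn : 3 ≤ n)
    (hij : (j : ℕ) = (i : ℕ) + n)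
    (hr : ∀ a ∈ Finset.Icc 1 ((n + 1) / 2), (a : ℂ) - 2 * (p - (i : ℕ) / 2) ≠ 0) :
    ev0 (entry lam p i j (virasoro (n + 2)) (mon 0))
      = scalarP ((j : ℕ) % 2) n lam p (p - (j : ℕ) / 2) := by
  set w := symbolRep lam p (quantEquiv lam p) (virasoro (n + 2)) (Finsupp.single j (mon 0)) with hw
  have hQ : (quantEquiv lam p w : Op) = sigma lam p (virasoro (n + 2)) (Dbar ^ (j : ℕ)) := by
    rw [hw, quantEquiv_symbolRep, quantEquiv_single_mon_zero]
  have hri : p - ((i : ℕ) : ℂ) / 2 = p - (j : ℕ) / 2 + n / 2 := by rw [hij]; push_cast; ring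
  have hwt : symbolAction p (evenField Polynomial.X) w = (p - (i : ℕ) / 2) • w :=
    quantEquiv_ext (lam := lam) (by
      rw [← quantEquiv_intertwines _ _ weight_mem, hQ, sigma_weight_virasoro, map_smul,
        Submodule.coe_smul, hQ, hri])
  -- Here $n+1$ lowerings turn $e_{n/2}$ into a multiple of $e_{-1/2}$, which kills $\bar D^j$.
  have hlow : (symbolAction p (oddField 1) ^ (n + 1)) w = 0 :=
    quantEquiv_ext (lam := lam) (by
      rw [quantEquiv_pow _ _ lower_mem, hQ, sigma_lower_pow _ _ _ _ _ le_rfl,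
        show n + 2 - (n + 1) = 1 by omega, virasoro_one, sigma_lower_Dbar_pow]
      simp)
  rw [entry_apply, ev0_symbol lam p i hr w hwt hlow, hQ]
  obtain ⟨N, rfl⟩ := Nat.exists_eq_add_of_le' hn
  have hterm : ∀ l ∈ Finset.range (N + 3 + 1), projCoef l (p - (i : ℕ) / 2) *
      lowCoef i ((sigma lam p (oddField Polynomial.X) ^ l)
        ((sigma lam p (oddField 1) ^ l) (sigma lam p (virasoro (N + 3 + 2)) (Dbar ^ (j : ℕ)))))
      = adCoef (N + 3) l * projCoef l (p - (i : ℕ) / 2) *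
        lowCoef i ((sigma lam p (oddField Polynomial.X) ^ l)
          (sigma lam p (virasoro (N + 3 + 2 - l)) (Dbar ^ (j : ℕ)))) := fun l hl => by
    rw [sigma_lower_pow _ _ _ _ _ (Finset.mem_range.1 hl).le, map_smul, map_smul, smul_eq_mul]
    ring
  -- The range ends at $k=N+1=n-2$, where $e_{(n-k)/2}=e_1$; the two remaining terms, with $e_{1/2}$
  -- and $e_0$, are reduced to this one.
  have hG : ∀ k ≤ N + 1, lowCoef i ((sigma lam p (oddField Polynomial.X) ^ k)
        (sigma lam p (virasoro (N + 3 + 2 - k)) (Dbar ^ (j : ℕ))))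
      = coefG lam (2 * (p - (p - (j : ℕ) / 2))) ((j : ℕ) % 2) (N + 3) k := fun k hk => by
    have h := lowCoef_sigma_virasoro lam p ((i : ℕ) + k) (N + 3 - k) (by omega)
    rw [show (i : ℕ) + k + (N + 3 - k) = (j : ℕ) by omega,
      show N + 3 - k + 2 = N + 3 + 2 - k by omega] at h
    rw [lowCoef_sigma_raise_pow, h, ← coefE_eq, coefG,
      show ((j : ℕ) % 2 + (N + 3) + k) % 2 = ((i : ℕ) + k) % 2 by omega,
      show 2 * (p - (p - ((j : ℕ) : ℂ) / 2)) = (j : ℕ) by ring,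
      show ((j : ℕ) : ℂ) - ((N + 3 : ℕ) : ℂ) + k = ((i : ℕ) + k : ℕ) by
        rw [hij]; push_cast; ring]
  obtain ⟨h4, h3, h2⟩ := sigma_raise_pow_Dbar_pow lam p j (N + 1)
  have hG' := hG (N + 1) le_rfl
  rw [show N + 3 + 2 - (N + 1) = 4 by omega, h4] at hG'
  have hsum : ∑ l ∈ Finset.range (N + 1), adCoef (N + 3) l * projCoef l (p - (i : ℕ) / 2) *
        lowCoef i ((sigma lam p (oddField Polynomial.X) ^ l)
          (sigma lam p (virasoro (N + 3 + 2 - l)) (Dbar ^ (j : ℕ))))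
      = ∑ k ∈ Finset.range (N + 1), stepCoef (N + 3) k (p - (i : ℕ) / 2) *
        coefG lam (2 * (p - (p - (j : ℕ) / 2))) ((j : ℕ) % 2) (N + 3) k :=
    Finset.sum_congr rfl fun k hk => by
      have hk := Finset.mem_range.1 hk
      rw [hG k hk.le, stepCoef, if_pos (by omega)]
  have htop : stepCoef (N + 3) (N + 1) (p - (i : ℕ) / 2)
      = adCoef (N + 3) (N + 1) * projCoef (N + 1) (p - (i : ℕ) / 2)
        + adCoef (N + 3) (N + 2) * projCoef (N + 2) (p - (i : ℕ) / 2)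
        + (p - (j : ℕ) / 2) * adCoef (N + 3) (N + 3) * projCoef (N + 3) (p - (i : ℕ) / 2) := by
    rw [stepCoef, if_neg (by omega), show p - ((i : ℕ) : ℂ) / 2 - ((N + 3 : ℕ) : ℂ) / 2
      = p - (j : ℕ) / 2 by rw [hri]; ring]
  rw [Finset.sum_congr rfl hterm, scalarP, show N + 3 - 1 = N + 1 + 1 by omega,
    Finset.sum_range_succ, Finset.sum_range_succ, Finset.sum_range_succ,
    Finset.sum_range_succ _ (N + 1), ← hri, hsum,
    show N + 3 + 2 - (N + 3) = 2 by omega, show N + 3 + 2 - (N + 2) = 3 by omega,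
    show N + 3 + 2 - (N + 1) = 4 by omega, h4, htop]
  change _ + _ * lowCoef i ((sigma lam p (oddField Polynomial.X) ^ (N + 1 + 1)) _)
    + _ * lowCoef i ((sigma lam p (oddField Polynomial.X) ^ (N + 1 + 2)) _) = _
  rw [h3, h2, map_smul, hG', smul_eq_mul]
  ring

end SuperLine
end

noncomputable section
namespace SuperLine

/-! ## Polynomiality of the matrix entries -/

/-- The function `f` of several variables agrees on `S` with a polynomial. -/
def IsPolynomialOn {ι : Type*} (S : Set (ι → ℂ)) (f : (ι → ℂ) → ℂ) : Prop :=
  ∃ N : MvPolynomial ι ℂ, ∀ v ∈ S, f v = MvPolynomial.eval v N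

namespace IsPolynomialOn

variable {ι : Type*} {S : Set (ι → ℂ)} {f g : (ι → ℂ) → ℂ}

theorem const (c : ℂ) : IsPolynomialOn S fun _ => c := ⟨MvPolynomial.C c, by simp⟩

theorem coord (i : ι) : IsPolynomialOn S fun v => v i := ⟨MvPolynomial.X i, by simp⟩

theorem add (hf : IsPolynomialOn S f) (hg : IsPolynomialOn S g) :
    IsPolynomialOn S fun v => f v + g v := by
  obtain ⟨M, hM⟩ := hf
  obtain ⟨N, hN⟩ := hg
  exact ⟨M + N, fun v hv => by simp only [hM v hv, hN v hv, map_add]⟩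

theorem mul (hf : IsPolynomialOn S f) (hg : IsPolynomialOn S g) :
    IsPolynomialOn S fun v => f v * g v := by
  obtain ⟨M, hM⟩ := hf
  obtain ⟨N, hN⟩ := hg
  exact ⟨M * N, fun v hv => by simp only [hM v hv, hN v hv, map_mul]⟩

theorem neg (hf : IsPolynomialOn S f) : IsPolynomialOn S fun v => -f v := by
  obtain ⟨M, hM⟩ := hf
  exact ⟨-M, fun v hv => by simp only [hM v hv, map_neg]⟩

theorem sub (hf : IsPolynomialOn S f) (hg : IsPolynomialOn S g) :
    IsPolynomialOn S fun v => f v - g v := by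
  simpa only [sub_eq_add_neg] using hf.add hg.neg

theorem div_const (hf : IsPolynomialOn S f) (c : ℂ) : IsPolynomialOn S fun v => f v / c := by
  simpa only [div_eq_mul_inv] using hf.mul (const c⁻¹)

theorem congr (hf : IsPolynomialOn S f) (h : ∀ v ∈ S, g v = f v) : IsPolynomialOn S g := by
  obtain ⟨M, hM⟩ := hf
  exact ⟨M, fun v hv => by rw [h v hv, hM v hv]⟩

theorem sum {κ : Type*} (s : Finset κ) {F : κ → (ι → ℂ) → ℂ}
    (h : ∀ k ∈ s, IsPolynomialOn S (F k)) : IsPolynomialOn S fun v => ∑ k ∈ s, F k v := by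
  classical
  induction s using Finset.induction_on with
  | empty => simpa using const 0
  | insert a s ha ih =>
    simp only [Finset.sum_insert ha]
    exact (h a (Finset.mem_insert_self a s)).add
      (ih fun k hk => h k (Finset.mem_insert_of_mem hk))

theorem prod {κ : Type*} (s : Finset κ) {F : κ → (ι → ℂ) → ℂ}
    (h : ∀ k ∈ s, IsPolynomialOn S (F k)) : IsPolynomialOn S fun v => ∏ k ∈ s, F k v := by
  classical
  induction s using Finset.induction_on with
  | empty => simpa using const 1
  | insert a s ha ih =>
    simp only [Finset.prod_insert ha]
    exact (h a (Finset.mem_insert_self a s)).mul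
      (ih fun k hk => h k (Finset.mem_insert_of_mem hk))

theorem fallingFactorial (hf : IsPolynomialOn S f) (n : ℕ) :
    IsPolynomialOn S fun v => SuperLine.fallingFactorial (f v) n :=
  prod _ fun _ _ => hf.sub (const _)

theorem coefE (hf : IsPolynomialOn S f) (hg : IsPolynomialOn S g) (m n : ℕ) :
    IsPolynomialOn S fun v => SuperLine.coefE (f v) (g v) m n :=
  (((hg.sub (const _)).div_const 2).fallingFactorial _).mul
    (((((hg.add (const _)).div_const 2).sub (const 1)).add ((const 2).mul hf)).fallingFactorial _)

theorem coefF (hf : IsPolynomialOn S f) (hg : IsPolynomialOn S g) (m n : ℕ) :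
    IsPolynomialOn S fun v => SuperLine.coefF (f v) (g v) m n := by
  have h := ((hg.sub (const (m : ℂ))).div_const 2)
  unfold SuperLine.coefF
  split_ifs
  · exact ((const _).mul (h.fallingFactorial _)).mul
      (((hg.div_const 2).sub (const _)).add ((const _).mul hf))
  · exact ((const _).mul (h.fallingFactorial _)).mul
      ((h.sub (const _)).add ((const _).mul hf))

theorem coefG (hf : IsPolynomialOn S f) (hg : IsPolynomialOn S g) (m M n : ℕ) :
    IsPolynomialOn S fun v => SuperLine.coefG (f v) (g v) m M n :=
  (hf.coefE ((hg.sub (const _)).add (const _)) _ _).mul (hf.coefF hg _ _)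

/-- On the complement of its poles, `p_k` times a common denominator is polynomial. -/
theorem projCoef (hf : IsPolynomialOn S f) {k K : ℕ} (hk : (k + 1) / 2 ≤ K)
    (hS : ∀ v ∈ S, ∀ a ∈ Finset.Icc 1 K, (a : ℂ) - 2 * f v ≠ 0) :
    IsPolynomialOn S fun v =>
      SuperLine.projCoef k (f v) * ∏ a ∈ Finset.Icc 1 K, ((a : ℂ) - 2 * f v) := by
  have hsub : Finset.Icc 1 ((k + 1) / 2) ⊆ Finset.Icc 1 K := Finset.Icc_subset_Icc_right hk
  refine ((prod (Finset.Icc 1 K \ Finset.Icc 1 ((k + 1) / 2)) fun a _ =>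
    (const (a : ℂ)).sub ((const 2).mul hf)).div_const ((k / 2).factorial : ℂ)).congr fun v hv => ?_
  have h0 : ∏ a ∈ Finset.Icc 1 ((k + 1) / 2), ((a : ℂ) - 2 * f v) ≠ 0 :=
    Finset.prod_ne_zero_iff.2 fun a ha => hS v hv a (hsub ha)
  rw [SuperLine.projCoef, ← Finset.prod_sdiff hsub, Finset.prod_inv_distrib]
  field_simp

theorem stepCoef (hf : IsPolynomialOn S f) {n k K : ℕ} (hk : k + 2 ≤ n) (hn : (n + 1) / 2 ≤ K)
    (hS : ∀ v ∈ S, ∀ a ∈ Finset.Icc 1 K, (a : ℂ) - 2 * f v ≠ 0) :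
    IsPolynomialOn S fun v =>
      SuperLine.stepCoef n k (f v) * ∏ a ∈ Finset.Icc 1 K, ((a : ℂ) - 2 * f v) := by
  have h : ∀ l ≤ n, IsPolynomialOn S fun v => adCoef n l *
      (SuperLine.projCoef l (f v) * ∏ a ∈ Finset.Icc 1 K, ((a : ℂ) - 2 * f v)) := fun l hl =>
    (const _).mul (hf.projCoef (by omega) hS)
  unfold SuperLine.stepCoef
  split_ifs
  · exact (h k (by omega)).congr fun v _ => by ring
  · exact (((h k (by omega)).add (h (k + 1) (by omega))).add
      ((hf.sub (const (n / 2 : ℂ))).mul (h (k + 2) hk))).congr fun v _ => by ring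

end IsPolynomialOn

/-- The denominator of the scalar `b_{rs}` as a polynomial in `s`, for `r = s + n/2`. -/
def denominator (n : ℕ) : Polynomial ℂ :=
  Polynomial.C (2 ^ (1 + n % 2)) *
    (∏ k ∈ Finset.range (n / 2 - 1), (Polynomial.C 2 * Polynomial.X + Polynomial.C (k : ℂ))) *
    ∏ a ∈ Finset.Icc 1 ((n + 1) / 2),
      (Polynomial.C (a : ℂ) - Polynomial.C 2 * (Polynomial.X + Polynomial.C (n / 2 : ℂ)))

theorem eval_denominator (n : ℕ) (s : ℂ) :
    (denominator n).eval s
      = scalarB n s * ∏ a ∈ Finset.Icc 1 ((n + 1) / 2), ((a : ℂ) - 2 * (s + n / 2)) := by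
  simp only [denominator, scalarB, Polynomial.eval_mul, Polynomial.eval_prod, Polynomial.eval_add,
    Polynomial.eval_sub, Polynomial.eval_C, Polynomial.eval_X]

/-- Multiplication by all the factors $a-2r$ clears the denominators of every $p_k$ with $k\le n$.
The identity is claimed only off the poles, where the inverses are genuine. -/
theorem exists_numerator (m n : ℕ) : ∃ N : MvPolynomial (Fin 3) ℂ, ∀ lam p s : ℂ,
    (∀ a ∈ Finset.Icc 1 ((n + 1) / 2), (a : ℂ) - 2 * (s + n / 2) ≠ 0) →
    scalarP m n lam p s * ∏ a ∈ Finset.Icc 1 ((n + 1) / 2), ((a : ℂ) - 2 * (s + n / 2))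
      = MvPolynomial.eval ![lam, p, s] N := by
  set S : Set (Fin 3 → ℂ) :=
    {v | ∀ a ∈ Finset.Icc 1 ((n + 1) / 2), (a : ℂ) - 2 * (v 2 + n / 2) ≠ 0} with hS
  have hr : IsPolynomialOn S fun v => v 2 + n / 2 := (IsPolynomialOn.coord 2).add (.const _)
  have h : IsPolynomialOn S fun v => ∑ k ∈ Finset.range (n - 1),
      (stepCoef n k (v 2 + n / 2) *
        ∏ a ∈ Finset.Icc 1 ((n + 1) / 2), ((a : ℂ) - 2 * (v 2 + n / 2))) *
      coefG (v 0) (2 * (v 1 - v 2)) m n k := by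
    refine .sum _ fun k hk => (hr.stepCoef ?_ le_rfl fun v hv => hv).mul
      ((IsPolynomialOn.coord 0).coefG ((IsPolynomialOn.const 2).mul
        ((IsPolynomialOn.coord 1).sub (IsPolynomialOn.coord 2))) m n k)
    have := Finset.mem_range.1 hk
    omega
  obtain ⟨N, hN⟩ := h
  refine ⟨N, fun lam p s hs => ?_⟩
  rw [← hN ![lam, p, s] hs, scalarP, Finset.sum_mul]
  exact Finset.sum_congr rfl fun k _ => mul_right_comm _ _ _

/-! ## The scalars are defined -/

theorem projector_poles {p : ℂ} {i j : SymIdx p} {n : ℕ} (hij : (j : ℕ) = (i : ℕ) + n) :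
    ∀ a ∈ Finset.Icc 1 ((n + 1) / 2), (a : ℂ) - 2 * (p - (i : ℕ) / 2) ≠ 0 := by
  intro a ha h
  obtain ⟨h1, h2⟩ := Finset.mem_Icc.1 ha
  obtain ⟨b, rfl⟩ := Nat.exists_eq_add_of_le' h1
  -- A pole means $2p=a+i$, so non-resonance would give $j\le a+i-1$, against $j=i+n$ and $1\le
  -- a\le(n+1)/2$.
  have := j.2 (b + (i : ℕ)) (by push_cast at h ⊢; linear_combination -h)
  omega

theorem scalarB_ne_zero {p : ℂ} (j : SymIdx p) {n : ℕ} (hn : n ≤ (j : ℕ)) :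
    scalarB n (p - (j : ℕ) / 2) ≠ 0 := by
  refine mul_ne_zero (pow_ne_zero _ two_ne_zero) (Finset.prod_ne_zero_iff.2 fun k hk h => ?_)
  have hk := Finset.mem_range.1 hk
  -- The equation $2s+k=0$ reads $2p=j-k$, which would bound the index set by $j-k-1<j$.
  have := j.2 ((j : ℕ) - k - 1) (by
    rw [Nat.cast_sub (by omega), Nat.cast_sub (by omega)]
    push_cast
    linear_combination h)
  omega

/-! ## The scalars for `r - s = 3/2, 2, 5/2` -/

theorem scalarP_three_zero {lam p s : ℂ} (h1 : 2 * s + 1 ≠ 0) (h2 : s + 1 ≠ 0) :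
    scalarP 0 3 lam p s / scalarB 3 s = -cParam lam p * binom (p - s) 2 * (1 / (s + 1 / 2)) := by
  have h' : s * 2 + 1 ≠ 0 := mul_comm 2 s ▸ h1
  -- The factors $a-2r$ are rewritten as multiples of the quantities assumed nonzero, so that
  -- denominators can be cleared; the later cases do the same.
  have e1 : (1 : ℂ) - 2 * (s + 3 / 2) = -(2 * (s + 1)) := by ring
  have e2 : (2 : ℂ) - 2 * (s + 3 / 2) = -(s * 2 + 1) := by ring
  simp [scalarP, scalarB, Finset.sum_range_succ, stepCoef, adCoef, projCoef, coefG, coefE,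
    coefF, fallingFactorial, binom, Finset.prod_range_succ, Nat.factorial, cParam,
    Finset.prod_Icc_succ_top]
  rw [e1, e2]
  field_simp
  ring

theorem scalarP_three_one {lam p s : ℂ} (h1 : 2 * s + 1 ≠ 0) (h2 : s + 1 ≠ 0) :
    scalarP 1 3 lam p s / scalarB 3 s = (p - s - 1 / 2) *
      ((4 * p * s + 2 * p + 1 - 16 * cParam lam p ^ 2) / (16 * (s + 1 / 2))) := by
  have h' : s * 2 + 1 ≠ 0 := mul_comm 2 s ▸ h1
  have e1 : (1 : ℂ) - 2 * (s + 3 / 2) = -(2 * (s + 1)) := by ring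
  have e2 : (2 : ℂ) - 2 * (s + 3 / 2) = -(s * 2 + 1) := by ring
  simp [scalarP, scalarB, Finset.sum_range_succ, stepCoef, adCoef, projCoef, coefG, coefE,
    coefF, fallingFactorial, Nat.factorial, cParam, Finset.prod_Icc_succ_top]
  rw [e1, e2]
  field_simp
  ring

theorem scalarP_four_zero {lam p s : ℂ} (h0 : s ≠ 0) (h1 : s + 1 ≠ 0) (h2 : 2 * s + 3 ≠ 0) :
    scalarP 0 4 lam p s / scalarB 4 s = binom (p - s) 2 *
      (((2 * s + 3) * (4 * p + 2 * s + 1) - 48 * cParam lam p ^ 2) / (32 * s * (s + 3 / 2))) := by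
  have h' : s * 2 + 3 ≠ 0 := mul_comm 2 s ▸ h2
  have e1 : (1 : ℂ) - 2 * (s + 4 / 2) = -(s * 2 + 3) := by ring
  have e2 : (2 : ℂ) - 2 * (s + 4 / 2) = -(2 * (s + 1)) := by ring
  simp [scalarP, scalarB, Finset.sum_range_succ, stepCoef, adCoef, projCoef, coefG, coefE,
    coefF, fallingFactorial, binom, Finset.prod_range_succ, Nat.factorial, cParam,
    Finset.prod_Icc_succ_top]
  rw [e1, e2]
  field_simp
  ring

theorem scalarP_four_one {lam p s : ℂ} (h0 : s ≠ 0) (h1 : s + 1 ≠ 0) (h2 : 2 * s + 3 ≠ 0) :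
    scalarP 1 4 lam p s / scalarB 4 s = binom (p - s - 1 / 2) 2 *
      ((s * (2 * p + s + 1) - 12 * cParam lam p ^ 2) / (8 * s * (s + 3 / 2))) := by
  have h' : s * 2 + 3 ≠ 0 := mul_comm 2 s ▸ h2
  have e1 : (1 : ℂ) - 2 * (s + 4 / 2) = -(s * 2 + 3) := by ring
  have e2 : (2 : ℂ) - 2 * (s + 4 / 2) = -(2 * (s + 1)) := by ring
  simp [scalarP, scalarB, Finset.sum_range_succ, stepCoef, adCoef, projCoef, coefG, coefE,
    coefF, fallingFactorial, binom, Finset.prod_range_succ, Nat.factorial, cParam,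
    Finset.prod_Icc_succ_top]
  rw [e1, e2]
  field_simp
  ring

theorem scalarP_five_zero {lam p s : ℂ} (h0 : s ≠ 0) (h1 : s + 1 ≠ 0) (h2 : 2 * s + 3 ≠ 0) (h3 : s + 2 ≠ 0) :
    scalarP 0 5 lam p s / scalarB 5 s = -binom (p - s) 3 * (binom (s + 2) 3)⁻¹ *
      ((4 * (s + 1) * p + 3 - 48 * cParam lam p ^ 2) / 64) := by
  have h' : s * 2 + 3 ≠ 0 := mul_comm 2 s ▸ h2
  -- The falling factorial in $\binom{s+2}3$ contains $s+1$ in this unsimplified form.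
  have h'' : s + 2 - 1 ≠ 0 := fun h => h1 (by linear_combination h)
  have e1 : (1 : ℂ) - 2 * (s + 5 / 2) = -(2 * (s + 2)) := by ring
  have e2 : (2 : ℂ) - 2 * (s + 5 / 2) = -(s * 2 + 3) := by ring
  have e3 : (3 : ℂ) - 2 * (s + 5 / 2) = -(2 * (s + 1)) := by ring
  simp [scalarP, scalarB, Finset.sum_range_succ, stepCoef, adCoef, projCoef, coefG, coefE,
    coefF, fallingFactorial, binom, Finset.prod_range_succ, Nat.factorial, cParam,
    Finset.prod_Icc_succ_top]
  rw [e1, e2, e3]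
  field_simp
  ring

theorem scalarP_five_one {lam p s : ℂ} (h0 : s ≠ 0) (h1 : s + 1 ≠ 0) (h2 : 2 * s + 3 ≠ 0) (h3 : s + 2 ≠ 0) :
    scalarP 1 5 lam p s / scalarB 5 s = -cParam lam p * binom (p - s - 1 / 2) 2 * (binom (s + 2) 3)⁻¹ *
      ((4 * (s + 1) * p - s ^ 2 - 2 * s + 2 - 12 * cParam lam p ^ 2) / 24) := by
  have h' : s * 2 + 3 ≠ 0 := mul_comm 2 s ▸ h2
  have h'' : s + 2 - 1 ≠ 0 := fun h => h1 (by linear_combination h)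
  have e1 : (1 : ℂ) - 2 * (s + 5 / 2) = -(2 * (s + 2)) := by ring
  have e2 : (2 : ℂ) - 2 * (s + 5 / 2) = -(s * 2 + 3) := by ring
  have e3 : (3 : ℂ) - 2 * (s + 5 / 2) = -(2 * (s + 1)) := by ring
  simp [scalarP, scalarB, Finset.sum_range_succ, stepCoef, adCoef, projCoef, coefG, coefE,
    coefF, fallingFactorial, binom, Finset.prod_range_succ, Nat.factorial, cParam,
    Finset.prod_Icc_succ_top]
  rw [e1, e2, e3]
  field_simp
  ring

end SuperLine
end

/-! ### The theorem -/

theorem theorem4p2 :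
    (∀ lam p : ℂ, ∃! Q : SuperLine.SymbolSpace p ≃ₗ[ℂ] SuperLine.DiffOps p,
      SuperLine.IsConformalQuantization lam p Q) ∧
    ∀ m n : ℕ, m < 2 → 3 ≤ n →
      ∃ (N : MvPolynomial (Fin 3) ℂ) (d : Polynomial ℂ),
        ∀ (lam p : ℂ) (Q : SuperLine.SymbolSpace p ≃ₗ[ℂ] SuperLine.DiffOps p),
          SuperLine.IsConformalQuantization lam p Q →
          ∀ i j : SuperLine.SymIdx p, (j : ℕ) = (i : ℕ) + n → (j : ℕ) % 2 = m →
          ∀ s : ℂ, s = p - ((j : ℕ) : ℂ) / 2 →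
            (∀ a ∈ Finset.Icc 1 ((n + 1) / 2), (a : ℂ) - 2 * (s + (n : ℂ) / 2) ≠ 0) ∧
            SuperLine.scalarB n s ≠ 0 ∧
            d.eval s ≠ 0 ∧
            ∃ b : ℂ,
              (∀ b' : ℂ, (∀ Z : SuperLine.contactAlgebra,
                SuperLine.matrixEntry lam p Q i j Z = b' • SuperLine.beta n s Z) ↔ b' = b) ∧
              b = SuperLine.scalarP m n lam p s / SuperLine.scalarB n s ∧
              b = MvPolynomial.eval ![lam, p, s] N / d.eval s ∧
              (n = 3 → m = 0 →
                b = -SuperLine.cParam lam p * SuperLine.binom (p - s) 2 * (1 / (s + 1 / 2))) ∧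
              (n = 3 → m = 1 →
                b = (p - s - 1 / 2) *
                  ((4 * p * s + 2 * p + 1 - 16 * SuperLine.cParam lam p ^ 2) /
                    (16 * (s + 1 / 2)))) ∧
              (n = 4 → m = 0 →
                b = SuperLine.binom (p - s) 2 *
                  (((2 * s + 3) * (4 * p + 2 * s + 1) - 48 * SuperLine.cParam lam p ^ 2) /
                    (32 * s * (s + 3 / 2)))) ∧
              (n = 4 → m = 1 →
                b = SuperLine.binom (p - s - 1 / 2) 2 *
                  ((s * (2 * p + s + 1) - 12 * SuperLine.cParam lam p ^ 2) /
                    (8 * s * (s + 3 / 2)))) ∧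
              (n = 5 → m = 0 →
                b = -SuperLine.binom (p - s) 3 * (SuperLine.binom (s + 2) 3)⁻¹ *
                  ((4 * (s + 1) * p + 3 - 48 * SuperLine.cParam lam p ^ 2) / 64)) ∧
              (n = 5 → m = 1 →
                b = -SuperLine.cParam lam p * SuperLine.binom (p - s - 1 / 2) 2 *
                  (SuperLine.binom (s + 2) 3)⁻¹ *
                  ((4 * (s + 1) * p - s ^ 2 - 2 * s + 2 - 12 * SuperLine.cParam lam p ^ 2) / 24)) := by
  refine ⟨fun lam p => ⟨SuperLine.quantEquiv lam p, SuperLine.quantEquiv_isConformalQuantization lam p,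
    fun Q hQ => hQ.unique (SuperLine.quantEquiv_isConformalQuantization lam p)⟩, fun m n hm hn => ?_⟩
  obtain ⟨N, hN⟩ := SuperLine.exists_numerator m n
  refine ⟨N, SuperLine.denominator n, fun lam p Q hQ i j hij hjm s hs => ?_⟩
  obtain rfl : Q = SuperLine.quantEquiv lam p :=
    hQ.unique (SuperLine.quantEquiv_isConformalQuantization lam p)
  have hr : p - ((i : ℕ) : ℂ) / 2 = s + n / 2 := by rw [hs, hij]; push_cast; ring
  have hpole : ∀ a ∈ Finset.Icc 1 ((n + 1) / 2), (a : ℂ) - 2 * (s + (n : ℂ) / 2) ≠ 0 :=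
    hr ▸ SuperLine.projector_poles hij
  have hprod := Finset.prod_ne_zero_iff.2 hpole
  have hB : SuperLine.scalarB n s ≠ 0 := hs ▸ SuperLine.scalarB_ne_zero j (by omega)
  have hd := SuperLine.eval_denominator n s
  obtain ⟨b, hb⟩ := SuperLine.exists_entry_eq_smul_beta lam p hn hij
  rw [← hs] at hb
  have hbeta := SuperLine.ev0_beta s hn
  have hP : b = SuperLine.scalarP m n lam p s / SuperLine.scalarB n s := by
    -- Evaluating the proportionality at $e_{n/2}$ on $\omega^s$ and taking constant terms gives
    -- $b\,B_{rs}=P_{rs}$.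
    have h := SuperLine.ev0_entry lam p hn hij (hr ▸ hpole)
    rw [hb, LinearMap.smul_apply, map_smul, hbeta, hjm, ← hs, smul_eq_mul] at h
    rw [← h, mul_div_cancel_right₀ _ hB]
  refine ⟨hpole, hB, hd ▸ mul_ne_zero hB hprod, b, fun b' => ⟨fun h => ?_, ?_⟩, hP, ?_,
    ?_, ?_, ?_, ?_, ?_, ?_⟩
  · have h := (hb (SuperLine.virasoro (n + 2))).symm.trans (h _)
    have h := congrArg (fun T : SuperLine.Op => SuperLine.ev0 (T (SuperLine.mon 0))) h
    simp only [LinearMap.smul_apply, map_smul, hbeta, smul_eq_mul] at h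
    exact (mul_right_cancel₀ hB h).symm
  · rintro rfl
    exact hb
  · rw [hP, hd, ← hN lam p s hpole, mul_div_mul_right _ _ hprod]
  all_goals
    rintro rfl rfl
    rw [hP]
  · exact SuperLine.scalarP_three_zero
      (fun h => hpole 2 (by decide) (by push_cast; linear_combination -h))
      (fun h => hpole 1 (by decide) (by push_cast; linear_combination -2 * h))
  · exact SuperLine.scalarP_three_one
      (fun h => hpole 2 (by decide) (by push_cast; linear_combination -h))
      (fun h => hpole 1 (by decide) (by push_cast; linear_combination -2 * h))
  -- For $n\ge4$ the product $B_{rs}$ contains the factor $2s$, so $s\ne0$; the other conditions are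
  -- the absence of projector poles.
  · exact SuperLine.scalarP_four_zero (fun h => hB (by simp [SuperLine.scalarB, h]))
      (fun h => hpole 2 (by decide) (by push_cast; linear_combination -2 * h))
      (fun h => hpole 1 (by decide) (by push_cast; linear_combination -h))
  · exact SuperLine.scalarP_four_one (fun h => hB (by simp [SuperLine.scalarB, h]))
      (fun h => hpole 2 (by decide) (by push_cast; linear_combination -2 * h))
      (fun h => hpole 1 (by decide) (by push_cast; linear_combination -h))
  · exact SuperLine.scalarP_five_zero (fun h => hB (by simp [SuperLine.scalarB, h]))
      (fun h => hpole 3 (by decide) (by push_cast; linear_combination -2 * h))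
      (fun h => hpole 2 (by decide) (by push_cast; linear_combination -h))
      (fun h => hpole 1 (by decide) (by push_cast; linear_combination -2 * h))
  · exact SuperLine.scalarP_five_one (fun h => hB (by simp [SuperLine.scalarB, h]))
      (fun h => hpole 3 (by decide) (by push_cast; linear_combination -2 * h))
      (fun h => hpole 2 (by decide) (by push_cast; linear_combination -h))
      (fun h => hpole 1 (by decide) (by push_cast; linear_combination -2 * h))
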